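/- Let $X_1,X_2,\dots$ be i.i.d. real random variables with mean $\mu>0$ and finite variance $\sigma^2$, $\sigma\ge 0$, and let $S_0=0$, $S_t=X_1+\cdots+X_t$ for $t\in\mathbb N$. For a threshold $\Delta>0$ put $\tau_0=0$, $$\tau_{n}=\inf\{t\in\mathbb N:\ t\ge\tau_{n-1},\ S_t-S_{\tau_{n-1}}\ge\Delta\},\qquad \eta_n=S_{\tau_n}-S_{\tau_{n-1}}-\Delta\qquad(n\ge 1),$$ and, for real $t>0$, $N(t)=\max\{n\ge 0:\tau_n\le t\}$ and $\tau(t)=\tau_{N(t)}$. Let $$\delta=\delta(\Delta)=\mathsf E[\tau_1],\qquad \mathsf E[\eta]=\mathsf E[\eta_1],\qquad \check\mu_t=\frac{N(t)\,\Delta}{t},\qquad \hat\mu_t=\frac{N(t)\,\Delta}{\tau(t)}$$ ($\hat\mu_t$ is given the value $0$ when $N(t)=0$). For every $\Delta>0$ all $\tau_n$ are almost surely finite, and $\tau_1$ and $\eta_1$ are integrable. The law of $X_1$ is fixed, while $\Delta>0$ and $t$ vary so that $\delta\to\infty$, $t\to\infty$ and $\delta=o(t)$. Then the following hold. (i) $|\check\mu_t-\mu|$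 is integrable and $$\mathsf E\bigl[|\check\mu_t-\mu|\bigr]=O\!\left(\frac{\delta}{t}\right)+\mathsf E[\eta]\,O\!\left(\frac1\delta\right)+O\!\left(\frac1{\sqrt t}\right).$$ Call $X_1$ *upward skip-free* if there is a $d>0$ with $X_1\in\{d,0,-d,-2d,\dots\}$ almost surely. If $X_1$ is not upward skip-free (for example, if $X_1$ is non-lattice), or if $\sigma=0$, then the last term is not needed: $$\mathsf E\bigl[|\check\mu_t-\mu|\bigr]=O\!\left(\frac{\delta}{t}\right)+\mathsf E[\eta]\,O\!\left(\frac1\delta\right).$$ Consequently (for every law of $X_1$ as above), $\sqrt t\,\mathsf E[|\check\mu_t-\mu|]=O(1)$ when $\delta=\Theta(\sqrt t)$. (ii) $\hat\mu_t\to\mu$ in probability. (iii) If $\sigma>0$ and, in addition, $\sqrt t=o(\delta)$, then $$\frac{\hat\mu_t-\mu}{\sigma/\sqrt t}\longrightarrow\mathcal N(0,1)\quad\text{in distribution}.$$ -/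

import Mathlib

open MeasureTheory ProbabilityTheory Filter Asymptotics Topology

noncomputable section

namespace LowRate

variable {Ω : Type*}

/-- The random walk `S_t = X_1 + ⋯ + X_t`; the variable `X i` of the code is `X_{i+1}`. -/
def walk (X : ℕ → Ω → ℝ) (t : ℕ) (ω : Ω) : ℝ :=
  ∑ i ∈ Finset.range t, X i ω

/-- The sampling times `τ_0 = 0`, `τ_{n+1} = inf {t ≥ τ_n : S_t - S_{τ_n} ≥ Δ}` with values in
`ℕ ∪ {∞}` (the infimum of the empty set is `∞`). -/
def sampleTime (X : ℕ → Ω → ℝ) (Δ : ℝ) : ℕ → Ω → ℕ∞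
  | 0, _ => 0
  | n + 1, ω => sInf ((fun t : ℕ => (t : ℕ∞)) ''
      {t : ℕ | sampleTime X Δ n ω ≤ (t : ℕ∞) ∧
        Δ ≤ walk X t ω - walk X (sampleTime X Δ n ω).toNat ω})

/-- `N(t) = max {n : τ_n ≤ t}`. As `n ≤ τ_n` when `0 < Δ`, the set is finite, and it contains `0`
for `0 ≤ t`. -/
def numSamples (X : ℕ → Ω → ℝ) (Δ t : ℝ) (ω : Ω) : ℕ :=
  sSup {n : ℕ | ∃ m : ℕ, sampleTime X Δ n ω = (m : ℕ∞) ∧ (m : ℝ) ≤ t}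

/-- The last sampling time `τ(t) = τ_{N(t)}`, which is finite. -/
def lastSampleTime (X : ℕ → Ω → ℝ) (Δ t : ℝ) (ω : Ω) : ℝ :=
  ((sampleTime X Δ (numSamples X Δ t ω) ω).toNat : ℝ)

/-- The overshoot `η_{n+1} = S_{τ_{n+1}} - S_{τ_n} - Δ`. -/
def overshoot (X : ℕ → Ω → ℝ) (Δ : ℝ) (n : ℕ) (ω : Ω) : ℝ :=
  walk X (sampleTime X Δ (n + 1) ω).toNat ω - walk X (sampleTime X Δ n ω).toNat ω - Δ

/-- The estimator `N(t) Δ / t`. -/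
def checkMu (X : ℕ → Ω → ℝ) (Δ t : ℝ) (ω : Ω) : ℝ :=
  (numSamples X Δ t ω : ℝ) * Δ / t

/-- The estimator `N(t) Δ / τ(t)`. It is meaningful only on `{τ_1 ≤ t}`; off that event the code
gives it the value `0`. -/
def hatMu (X : ℕ → Ω → ℝ) (Δ t : ℝ) (ω : Ω) : ℝ :=
  (numSamples X Δ t ω : ℝ) * Δ / lastSampleTime X Δ t ω

variable [MeasurableSpace Ω]

/-- The sampling period `δ = E[τ_1]`. -/
def period (P : Measure Ω) (X : ℕ → Ω → ℝ) (Δ : ℝ) : ℝ :=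
  ∫ ω, ((sampleTime X Δ 1 ω).toNat : ℝ) ∂P

/-- The expected overshoot `E[η] = E[η_1]`. -/
def meanOvershoot (P : Measure Ω) (X : ℕ → Ω → ℝ) (Δ : ℝ) : ℝ :=
  ∫ ω, overshoot X Δ 0 ω ∂P

/-- `Y` is upward skip-free: for some span `d > 0`, almost surely `Y` is one of
`d, 0, -d, -2d, …`. -/
def IsSkipFree (P : Measure Ω) (Y : Ω → ℝ) : Prop :=
  ∃ d : ℝ, 0 < d ∧ ∀ᵐ ω ∂P, ∃ k : ℤ, k ≤ 1 ∧ Y ω = k * d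

end LowRate

end

namespace LowRate

open scoped ENNReal

/-! Everything rests on one decomposition. Let `m = τ(t)`, `T = ⌊t⌋`, and let `H` be the sum of the
overshoots of the samples taken up to `t`. Telescoping gives `N(t) Δ = S_m - H`. No sample is due
between `m` and `T`, so `S_T - S_m < Δ`, while `S_m - S_T` is at most the drawdown of the walk at
`T`. Hence `|N(t) Δ - t μ| ≤ |S_T - T μ| + μ + Δ + drawdown + H` (`exists_lastSampleTime`,
`IsIID.integral_abs_checkMu_sub_le`).

In the mean, the first term is at most `σ √t`. The drawdown has bounded mean because the drift is
positive (`IsIID.integral_drawdown_le`). Restarting the walk at each sampling time gives `E[H] ≤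
(E[N(t)] + 1) E[η]`, where `E[N(t)] = O(t / Δ)` (`IsIID.lintegral_sum_overshoot_le`,
`IsIID.integral_numSamples_le`). Since `Δ` and `δ` have the same order
(`IsIID.integrable_sampleTime_one`, `IsIID.threshold_le_period`), division by `t` yields the bound
with three terms.

The delicate input is that `E[η]` is bounded uniformly in `Δ` under two moments only
(`exists_overshoot_bound`). It comes from a nonnegative superharmonic function of the distance to
the threshold that dominates the overshoot up to a factor and is bounded on the positive half-line.

If the steps are not upward skip-free, `E[η]` is also bounded away from zero for large `Δ`
(`IsIID.exists_le_meanOvershoot`). Then `1 / √t ≤ δ / t + 1 / δ` lets the other two terms absorb the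
last one.

For `N(t) Δ / τ(t)`, Kolmogorov's inequality and Markov's inequality for `H` isolate a bad event
(`IsIID.exists_bad_event`). Off it, `τ(t)` is close to `t`, the centered walk hardly moves between
the two times, and `H` is small. This gives consistency. When `√t = o(Δ)`, `E[H] = O(t / Δ)` is
`o(√t)`, so the estimator differs negligibly from the normalized centered walk and inherits its
central limit theorem. -/

/-- The variables `X i` are measurable, independent and have the law `ν`. -/
structure IsIID {Ω : Type*} [MeasurableSpace Ω] (P : Measure Ω) (X : ℕ → Ω → ℝ)
    (ν : Measure ℝ) : Prop where
  meas : ∀ i, Measurable (X i)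
  indep : iIndepFun X P
  law : ∀ i, P.map (X i) = ν

/-! ### Independence of past and future, and stationarity of the path. -/

section IID

variable {Ω : Type*} [MeasurableSpace Ω] {P : Measure Ω} {X : ℕ → Ω → ℝ} {ν : Measure ℝ}

lemma IsIID.shift (h : IsIID P X ν) (m : ℕ) : IsIID P (fun i => X (m + i)) ν where
  meas i := h.meas _
  indep := h.indep.precomp (g := fun i => m + i) (fun a b hab => by simpa using hab)
  law i := h.law _

lemma IsIID.comp (h : IsIID P X ν) {f : ℝ → ℝ} (hf : Measurable f) :
    IsIID P (fun i ω => f (X i ω)) (ν.map f) where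
  meas i := hf.comp (h.meas i)
  indep := h.indep.comp (fun _ => f) (fun _ => hf)
  law i := by
    rw [← h.law i, Measure.map_map hf (h.meas i)]; rfl

lemma IsIID.measurable_path (h : IsIID P X ν) : Measurable (fun ω i => X i ω) :=
  measurable_pi_iff.2 h.meas

lemma IsIID.isProbabilityMeasure [IsProbabilityMeasure P] (h : IsIID P X ν) : IsProbabilityMeasure ν := by
  rw [← h.law 0]
  exact Measure.isProbabilityMeasure_map (h.meas 0).aemeasurable

lemma IsIID.map_path (h : IsIID P X ν) :
    P.map (fun ω i => X i ω) = Measure.infinitePi (fun i => P.map (X i)) :=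
  h.indep.map_fun_eq_infinitePi_map h.meas

/-- Both laws are the same infinite product. This is what allows the walk to restart afresh after a
fixed number of steps. -/
lemma IsIID.map_path_shift [IsProbabilityMeasure P] (h : IsIID P X ν) (m : ℕ) :
    P.map (fun ω i => X (m + i) ω) = P.map (fun ω i => X i ω) := by
  rw [(h.shift m).map_path, h.map_path]
  simp only [h.law]

lemma IsIID.integral_comp (h : IsIID P X ν) (i : ℕ) {f : ℝ → ℝ} (hf : Measurable f) :
    ∫ ω, f (X i ω) ∂P = ∫ x, f x ∂ν := by
  rw [← h.law i, integral_map (h.meas i).aemeasurable hf.aestronglyMeasurable]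

lemma IsIID.integrable_comp (h : IsIID P X ν) (i : ℕ) {f : ℝ → ℝ} (hf : Measurable f) :
    Integrable (fun ω => f (X i ω)) P ↔ Integrable f ν := by
  rw [← h.law i, integrable_map_measure hf.aestronglyMeasurable (h.meas i).aemeasurable]
  rfl

lemma IsIID.memLp (h : IsIID P X ν) (h2 : MemLp id 2 ν) (i : ℕ) : MemLp (X i) 2 P := by
  rw [← h.law i, memLp_map_measure_iff aestronglyMeasurable_id (h.meas i).aemeasurable] at h2
  exact h2

/-- The information contained in `X 0, …, X (n - 1)`. -/
@[reducible]
def past {Ω : Type*} (X : ℕ → Ω → ℝ) (n : ℕ) : MeasurableSpace Ω :=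
  ⨆ i ∈ Set.Iio n, MeasurableSpace.comap (X i) inferInstance

lemma past_mono {Ω : Type*} (X : ℕ → Ω → ℝ) {m n : ℕ} (hmn : m ≤ n) : past X m ≤ past X n :=
  biSup_mono fun _ hi => lt_of_lt_of_le hi hmn

lemma measurable_past {Ω : Type*} (X : ℕ → Ω → ℝ) {i n : ℕ} (hi : i < n) : Measurable[past X n] (X i) := by
  have : MeasurableSpace.comap (X i) inferInstance ≤ past X n :=
    le_iSup₂ (f := fun i (_ : i ∈ Set.Iio n) => MeasurableSpace.comap (X i) inferInstance) i hi
  exact (comap_measurable (X i)).mono this le_rfl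

lemma IsIID.past_le (h : IsIID P X ν) (n : ℕ) : past X n ≤ ‹MeasurableSpace Ω› :=
  iSup₂_le fun i _ => (h.meas i).comap_le

/-- The indices below `n` and those from `n` on form disjoint blocks of an independent family. -/
lemma IsIID.indep_future (h : IsIID P X ν) (n : ℕ) {E : Type*} [MeasurableSpace E] {Y : Ω → E}
    (hY : Measurable[past X n] Y) : IndepFun Y (fun ω i => X (n + i) ω) P := by
  have key := indep_iSup_of_disjoint (m := fun i => MeasurableSpace.comap (X i) inferInstance)
    (fun i => (h.meas i).comap_le) h.indep.iIndep (S := Set.Iio n) (T := Set.Ici n)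
    (Set.disjoint_left.2 fun a ha hb => absurd (Set.mem_Iio.1 ha) (not_lt.2 (Set.mem_Ici.1 hb)))
  rw [IndepFun_iff_Indep]
  refine indep_of_indep_of_le_left (indep_of_indep_of_le_right key ?_) hY.comap_le
  refine Measurable.comap_le ?_
  refine @measurable_pi_lambda _ _ _ (_) _ _ fun i => ?_
  have hle : MeasurableSpace.comap (X (n + i)) inferInstance ≤
      ⨆ j ∈ Set.Ici n, MeasurableSpace.comap (X j) inferInstance :=
    le_iSup₂ (f := fun j (_ : j ∈ Set.Ici n) => MeasurableSpace.comap (X j) inferInstance)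
      (n + i) (Nat.le_add_right n i)
  exact (comap_measurable (X (n + i))).mono hle le_rfl

lemma IsIID.indep_next (h : IsIID P X ν) (n : ℕ) {E : Type*} [MeasurableSpace E] {Y : Ω → E}
    (hY : Measurable[past X n] Y) : IndepFun Y (X n) P :=
  (h.indep_future n hY).comp (φ := id) (ψ := fun x : ℕ → ℝ => x 0) measurable_id
    (measurable_pi_apply 0)

/-- On an event determined by the first `n` variables, a functional of the later variables
integrates to the product. -/
lemma IsIID.lintegral_future [IsProbabilityMeasure P] (h : IsIID P X ν) (n : ℕ) {A : Set Ω}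
    (hA : MeasurableSet[past X n] A) {F : (ℕ → ℝ) → ℝ≥0∞} (hF : Measurable F) :
    ∫⁻ ω in A, F (fun i => X (n + i) ω) ∂P = P A * ∫⁻ ω, F (fun i => X i ω) ∂P := by
  have hA' : MeasurableSet A := h.past_le n A hA
  have hind : Measurable[past X n] (A.indicator (1 : Ω → ℝ≥0∞)) :=
    (@measurable_const _ _ _ (past X n) (1 : ℝ≥0∞)).indicator hA
  have hi := (h.indep_future n hind).comp (φ := id) (ψ := F) measurable_id hF
  have := lintegral_mul_eq_lintegral_mul_lintegral_of_indepFun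
    (hind.mono (h.past_le n) le_rfl) (hF.comp (h.shift n).measurable_path) hi
  have e1 : ∫⁻ ω, F (fun i => X (n + i) ω) ∂P = ∫⁻ ω, F (fun i => X i ω) ∂P := by
    rw [← lintegral_map hF (h.shift n).measurable_path, h.map_path_shift,
      lintegral_map hF h.measurable_path]
  rw [← lintegral_indicator hA', ← e1, ← lintegral_indicator_one hA']
  refine Eq.trans (lintegral_congr fun ω => ?_) this
  by_cases hω : ω ∈ A <;> simp [hω]

end IID

/-! ### The stopped walk as a Markov chain, and its transition operator. -/

section StoppedWalk

open Classical in
/-- The walk that starts at `y`, makes the steps `-X n`, and stops when it leaves `D`. -/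
noncomputable def stoppedWalk {Ω : Type*} (D : Set ℝ) (X : ℕ → Ω → ℝ) (y : ℝ) : ℕ → Ω → ℝ
  | 0, _ => y
  | n + 1, ω => if stoppedWalk D X y n ω ∈ D then stoppedWalk D X y n ω - X n ω
      else stoppedWalk D X y n ω

open Classical in
/-- The transition operator of the stopped walk. -/
noncomputable def stepOp (D : Set ℝ) (ν : Measure ℝ) (f : ℝ → ℝ≥0∞) (y : ℝ) : ℝ≥0∞ :=
  if y ∈ D then ∫⁻ x, f (y - x) ∂ν else f y

variable {D : Set ℝ} {ν : Measure ℝ} {f g : ℝ → ℝ≥0∞}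

lemma stepOp_of_mem {y : ℝ} (hy : y ∈ D) : stepOp D ν f y = ∫⁻ x, f (y - x) ∂ν := if_pos hy

lemma stepOp_of_notMem {y : ℝ} (hy : y ∉ D) : stepOp D ν f y = f y := if_neg hy

lemma stepOp_mono (hfg : f ≤ g) : stepOp D ν f ≤ stepOp D ν g := by
  intro y
  by_cases hy : y ∈ D
  · rw [stepOp_of_mem hy, stepOp_of_mem hy]
    exact lintegral_mono fun x => hfg _
  · rw [stepOp_of_notMem hy, stepOp_of_notMem hy]
    exact hfg y

lemma monotone_stepOp (D : Set ℝ) (ν : Measure ℝ) : Monotone (stepOp D ν) :=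
  fun _ _ => stepOp_mono

/-- Comparison principle: a superharmonic majorant of `f` stays a majorant at all later times. -/
lemma iterate_stepOp_le (hfg : f ≤ g) (hg : stepOp D ν g ≤ g) (n : ℕ) :
    (stepOp D ν)^[n] f ≤ g := by
  induction n with
  | zero => exact hfg
  | succ n ih =>
    rw [Function.iterate_succ_apply']
    exact (stepOp_mono ih).trans hg

lemma measurable_stepOp [SFinite ν] (hD : MeasurableSet D) (hf : Measurable f) :
    Measurable (stepOp D ν f) := by
  classical
  refine Measurable.ite hD ?_ hf
  exact Measurable.lintegral_prod_right' (f := fun p : ℝ × ℝ => f (p.1 - p.2))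
    (hf.comp (measurable_fst.sub measurable_snd))

variable {Ω : Type*} [MeasurableSpace Ω] {P : Measure Ω} {X : ℕ → Ω → ℝ}

lemma measurable_past_stoppedWalk {Ω : Type*} (hD : MeasurableSet D) (X : ℕ → Ω → ℝ) (y : ℝ) (n : ℕ) :
    Measurable[past X n] (stoppedWalk D X y n) := by
  classical
  induction n with
  | zero => exact @measurable_const _ _ _ (past X 0) y
  | succ n ih =>
    have ih' : Measurable[past X (n + 1)] (stoppedWalk D X y n) :=
      ih.mono (past_mono X n.le_succ) le_rfl
    exact Measurable.ite (m := past X (n + 1)) (ih' hD)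
      (ih'.sub (measurable_past X n.lt_succ_self)) ih'

lemma IsIID.measurable_stoppedWalk (h : IsIID P X ν) (hD : MeasurableSet D) (y : ℝ) (n : ℕ) :
    Measurable (stoppedWalk D X y n) :=
  (measurable_past_stoppedWalk hD X y n).mono (h.past_le n) le_rfl

/-- Markov property: the position after `n` steps is independent of `X n`, so their joint law is a
product and Fubini integrates the step out first. -/
lemma IsIID.lintegral_stoppedWalk_succ [IsProbabilityMeasure P] (h : IsIID P X ν) (hD : MeasurableSet D)
    (hf : Measurable f) (y : ℝ) (n : ℕ) :
    ∫⁻ ω, f (stoppedWalk D X y (n + 1) ω) ∂P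
      = ∫⁻ ω, stepOp D ν f (stoppedWalk D X y n ω) ∂P := by
  classical
  have := h.isProbabilityMeasure
  have hm := h.measurable_stoppedWalk hD y n
  have hi := h.indep_next n (measurable_past_stoppedWalk hD X y n)
  have hmap := (indepFun_iff_map_prod_eq_prod_map_map hm.aemeasurable
    (h.meas n).aemeasurable).1 hi
  rw [h.law n] at hmap
  have hF : Measurable fun p : ℝ × ℝ => f (if p.1 ∈ D then p.1 - p.2 else p.1) :=
    hf.comp (Measurable.ite (measurable_fst hD) (measurable_fst.sub measurable_snd)
      measurable_fst)
  calc ∫⁻ ω, f (stoppedWalk D X y (n + 1) ω) ∂P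
      = ∫⁻ p, f (if p.1 ∈ D then p.1 - p.2 else p.1)
          ∂(P.map fun ω => (stoppedWalk D X y n ω, X n ω)) := by
        rw [lintegral_map hF (hm.prodMk (h.meas n))]; rfl
    _ = ∫⁻ z, stepOp D ν f z ∂(P.map (stoppedWalk D X y n)) := by
        have : IsProbabilityMeasure (P.map (stoppedWalk D X y n)) :=
          Measure.isProbabilityMeasure_map hm.aemeasurable
        rw [hmap, lintegral_prod _ hF.aemeasurable]
        refine lintegral_congr fun z => ?_
        by_cases hz : z ∈ D
        · simp [stepOp_of_mem hz, hz]
        · simp [stepOp_of_notMem hz, hz]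
    _ = _ := lintegral_map (measurable_stepOp hD hf) hm

lemma IsIID.lintegral_stoppedWalk [IsProbabilityMeasure P] (h : IsIID P X ν) (hD : MeasurableSet D)
    (hf : Measurable f) (y : ℝ) (n : ℕ) :
    ∫⁻ ω, f (stoppedWalk D X y n ω) ∂P = (stepOp D ν)^[n] f y := by
  have := h.isProbabilityMeasure
  induction n generalizing f with
  | zero => simp [stoppedWalk]
  | succ n ih =>
    rw [h.lintegral_stoppedWalk_succ hD hf, ih (measurable_stepOp hD hf),
      Function.iterate_succ_apply]

end StoppedWalk

/-! ### A bound on the mean overshoot, uniform in the threshold. -/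

section Overshoot

/-- The mean excess over the level `y` of a step with law `ν`. -/
noncomputable def meanExcess (ν : Measure ℝ) (y : ℝ) : ℝ := ∫ x, max (x - y) 0 ∂ν

lemma meanExcess_nonneg (ν : Measure ℝ) (y : ℝ) : 0 ≤ meanExcess ν y :=
  integral_nonneg fun _ => le_max_right _ _

variable {ν : Measure ℝ} [IsProbabilityMeasure ν]

lemma integrable_excess (h1 : Integrable id ν) (y : ℝ) :
    Integrable (fun x : ℝ => max (x - y) 0) ν :=
  (h1.sub (integrable_const y)).pos_part

lemma meanExcess_anti (h1 : Integrable id ν) : Antitone (meanExcess ν) := fun _ _ hab =>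
  integral_mono (integrable_excess h1 _) (integrable_excess h1 _) fun _ =>
    max_le_max (by linarith) le_rfl

lemma tendsto_meanExcess (h1 : Integrable id ν) :
    Tendsto (fun n : ℕ => meanExcess ν n) atTop (𝓝 0) := by
  have : Tendsto (fun n : ℕ => meanExcess ν n) atTop (𝓝 (∫ _, (0 : ℝ) ∂ν)) := by
    refine tendsto_integral_of_dominated_convergence (fun x => |x|)
      (fun n => (integrable_excess h1 _).aestronglyMeasurable) h1.abs (fun n => ?_) ?_
    · refine Eventually.of_forall fun x => ?_
      rw [Real.norm_eq_abs, abs_of_nonneg (le_max_right _ _)]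
      exact max_le (by have := le_abs_self x; have : (0 : ℝ) ≤ n := n.cast_nonneg; linarith)
        (abs_nonneg x)
    · refine Eventually.of_forall fun x => ?_
      obtain ⟨N, hN⟩ := exists_nat_ge x
      refine tendsto_const_nhds.congr' ?_
      filter_upwards [eventually_ge_atTop N] with n hn
      have : (N : ℝ) ≤ n := by exact_mod_cast hn
      rw [max_eq_right (by linarith)]
  simpa using this

/-- For a fixed `ξ`, a concave function of `y`, with derivative `(ξ - max y L)⁺`. -/
noncomputable def excessPotential (L ξ y : ℝ) : ℝ :=
  -(max (ξ - max y L) 0) ^ 2 / 2 + max (ξ - L) 0 * min y L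

/-- Tangent-line inequality for a concave function. The cases locate both points relative to `L` and
`ξ`. -/
lemma excessPotential_sub_le (L ξ y x : ℝ) :
    excessPotential L ξ (y - x) ≤ excessPotential L ξ y - x * max (ξ - max y L) 0 := by
  unfold excessPotential
  obtain ⟨z, rfl⟩ : ∃ z, x = y - z := ⟨y - x, by ring⟩
  rw [sub_sub_cancel]
  have hpos : ∀ w : ℝ, ξ ≤ w → max (ξ - w) 0 = 0 := fun w hw => max_eq_right (by linarith)
  have hneg : ∀ w : ℝ, w ≤ ξ → max (ξ - w) 0 = ξ - w := fun w hw => max_eq_left (by linarith)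
  rcases le_total ξ L with hξ | hξ
  · rw [hpos _ hξ, hpos _ (hξ.trans (le_max_right z L)), hpos _ (hξ.trans (le_max_right y L))]
    simp
  rw [hneg L hξ]
  rcases le_total y L with hy | hy <;> rcases le_total z L with hz | hz
  · rw [max_eq_right hy, max_eq_right hz, min_eq_left hy, min_eq_left hz, hneg L hξ]
    exact le_of_eq (by ring)
  · rw [max_eq_right hy, max_eq_left hz, min_eq_left hy, min_eq_right hz, hneg L hξ]
    rcases le_total ξ z with h | h
    · rw [hpos z h]
      nlinarith [mul_nonneg (sub_nonneg.2 hξ) (sub_nonneg.2 h)]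
    · rw [hneg z h]
      nlinarith [sq_nonneg (z - L)]
  · rw [max_eq_left hy, max_eq_right hz, min_eq_right hy, min_eq_left hz, hneg L hξ]
    rcases le_total ξ y with h | h
    · rw [hpos y h]
      nlinarith [mul_nonneg (sub_nonneg.2 hξ) (sub_nonneg.2 hz), sq_nonneg (ξ - L)]
    · rw [hneg y h]
      nlinarith [mul_nonneg (sub_nonneg.2 hy) (sub_nonneg.2 hz), sq_nonneg (y - L)]
  · rw [max_eq_left hy, max_eq_left hz, min_eq_right hy, min_eq_right hz]
    rcases le_total ξ y with h | h <;> rcases le_total ξ z with h' | h'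
    · rw [hpos y h, hpos z h']; simp
    · rw [hpos y h, hneg z h']; nlinarith [sq_nonneg (ξ - z)]
    · rw [hneg y h, hpos z h']
      nlinarith [mul_nonneg (sub_nonneg.2 h) (sub_nonneg.2 h'), sq_nonneg (ξ - y)]
    · rw [hneg y h, hneg z h']; nlinarith [sq_nonneg (y - z)]

lemma excessPotential_le (L ξ y : ℝ) : excessPotential L ξ y ≤ max (ξ - L) 0 * L := by
  unfold excessPotential
  have : max (ξ - L) 0 * min y L ≤ max (ξ - L) 0 * L :=
    mul_le_mul_of_nonneg_left (min_le_right _ _) (le_max_right _ _)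
  nlinarith [sq_nonneg (max (ξ - max y L) 0)]

lemma le_excessPotential {L : ℝ} (hL : 0 ≤ L) (ξ y : ℝ) :
    -ξ ^ 2 / 2 + max (ξ - L) 0 * min y 0 ≤ excessPotential L ξ y := by
  unfold excessPotential
  have h1 : max (ξ - L) 0 * min y 0 ≤ max (ξ - L) 0 * min y L :=
    mul_le_mul_of_nonneg_left (min_le_min le_rfl hL) (le_max_right _ _)
  have h2 : (max (ξ - max y L) 0) ^ 2 ≤ ξ ^ 2 := by
    rcases max_cases (ξ - max y L) 0 with ⟨h, h'⟩ | ⟨h, h'⟩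
    · rw [h]; nlinarith [le_max_right y L]
    · rw [h]; nlinarith [sq_nonneg ξ]
  linarith

lemma integrable_excessPotential (h2 : MemLp id 2 ν) (L y : ℝ) :
    Integrable (fun ξ => excessPotential L ξ y) ν := by
  have h1 : Integrable id ν := h2.integrable (by norm_num)
  have hs : MemLp (fun ξ : ℝ => max (ξ - max y L) 0) 2 ν :=
    (h2.sub (memLp_const (max y L))).pos_part
  unfold excessPotential
  exact ((hs.integrable_sq.neg).div_const 2).add ((integrable_excess h1 L).mul_const _)

/-- The mean of `excessPotential`. -/
noncomputable def meanPotential (ν : Measure ℝ) (L y : ℝ) : ℝ :=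
  ∫ ξ, excessPotential L ξ y ∂ν

/-- Averaged over a step `x` of mean `μ`, this loses at least `μ * meanExcess ν (max y L)`. For `y ≥
L` and after division by `μ`, that pays exactly for the mean overshoot of the next step. -/
lemma meanPotential_sub_le (h2 : MemLp id 2 ν) (L y x : ℝ) :
    meanPotential ν L (y - x) ≤ meanPotential ν L y - x * meanExcess ν (max y L) := by
  have h1 : Integrable id ν := h2.integrable (by norm_num)
  unfold meanPotential meanExcess
  rw [← integral_const_mul, ← integral_sub (integrable_excessPotential h2 L y)
    ((integrable_excess h1 _).const_mul x)]
  exact integral_mono (integrable_excessPotential h2 L _)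
    ((integrable_excessPotential h2 L y).sub ((integrable_excess h1 _).const_mul x))
    fun ξ => excessPotential_sub_le L ξ y x

lemma meanPotential_le (h2 : MemLp id 2 ν) (L y : ℝ) :
    meanPotential ν L y ≤ meanExcess ν L * L := by
  have h1 : Integrable id ν := h2.integrable (by norm_num)
  unfold meanPotential meanExcess
  rw [← integral_mul_const]
  exact integral_mono (integrable_excessPotential h2 L _) ((integrable_excess h1 _).mul_const L)
    fun ξ => excessPotential_le L ξ y

/-- Freezing the slope at `meanExcess ν L` below `L` keeps the descent linear for negative `y`, and
the second moment controls the constant. -/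
lemma le_meanPotential (h2 : MemLp id 2 ν) {L : ℝ} (hL : 0 ≤ L) (y : ℝ) :
    -(∫ x, x ^ 2 ∂ν) / 2 + meanExcess ν L * min y 0 ≤ meanPotential ν L y := by
  have h1 : Integrable id ν := h2.integrable (by norm_num)
  have hs : Integrable (fun x : ℝ => x ^ 2) ν := h2.integrable_sq
  have e : -(∫ x, x ^ 2 ∂ν) / 2 + meanExcess ν L * min y 0
      = ∫ ξ, (-ξ ^ 2 / 2 + max (ξ - L) 0 * min y 0) ∂ν := by
    unfold meanExcess
    rw [← integral_mul_const, ← integral_neg, ← integral_div]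
    exact (integral_add (hs.neg.div_const 2) ((integrable_excess h1 _).mul_const _)).symm
  rw [e]
  exact integral_mono ((hs.neg.div_const 2).add ((integrable_excess h1 _).mul_const _))
    (integrable_excessPotential h2 L _) fun ξ => le_excessPotential hL ξ y

/-- A bounded function of the distance `y` to the threshold whose mean decreases at every step. -/
noncomputable def stepPotential (θ x₀ y : ℝ) : ℝ := 1 - θ ^ ⌈y / x₀⌉₊

lemma stepPotential_nonneg {θ : ℝ} (h0 : 0 ≤ θ) (h1 : θ ≤ 1) (x₀ y : ℝ) :
    0 ≤ stepPotential θ x₀ y := sub_nonneg.2 (pow_le_one₀ h0 h1)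

lemma stepPotential_le_one {θ : ℝ} (h0 : 0 ≤ θ) (x₀ y : ℝ) :
    stepPotential θ x₀ y ≤ 1 := sub_le_self _ (pow_nonneg h0 _)

/-- A step of size at least `x₀` lowers the ceiling by one or more. Every other step is bounded
trivially by `1`. -/
lemma stepPotential_sub_le {θ x₀ : ℝ} (h0 : 0 < θ) (h1 : θ ≤ 1) (hx₀ : 0 < x₀) (y x : ℝ) :
    stepPotential θ x₀ (y - x)
      ≤ 1 - (Set.Ici x₀).indicator (fun _ => θ ^ (⌈y / x₀⌉₊ - 1)) x := by
  by_cases hx : x ∈ Set.Ici x₀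
  · rw [Set.indicator_of_mem hx, stepPotential]
    refine sub_le_sub_left (pow_le_pow_of_le_one h0.le h1 ?_) 1
    rw [Nat.ceil_le]
    have hx' : x₀ ≤ x := hx
    have : (y - x) / x₀ ≤ y / x₀ - 1 := by
      rw [div_le_iff₀ hx₀, sub_mul, div_mul_cancel₀ _ hx₀.ne']; linarith
    have h2 : y / x₀ ≤ (⌈y / x₀⌉₊ : ℝ) := Nat.le_ceil _
    have h3 : ((⌈y / x₀⌉₊ : ℕ) : ℝ) ≤ ((⌈y / x₀⌉₊ - 1 : ℕ) : ℝ) + 1 := by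
      exact_mod_cast (by omega : ⌈y / x₀⌉₊ ≤ ⌈y / x₀⌉₊ - 1 + 1)
    linarith
  · rw [Set.indicator_of_notMem hx, sub_zero]
    exact stepPotential_le_one h0.le _ _

/-- The mean of a law with positive expectation charges a half-line `[x₀, ∞)` with `x₀ > 0`. -/
lemma exists_pos_measure_Ici (hμ : 0 < ∫ x, x ∂ν) : ∃ x₀ : ℝ, 0 < x₀ ∧ 0 < ν.real (Set.Ici x₀) := by
  by_contra! hcon
  have h0 : ∀ n : ℕ, ν (Set.Ici (1 / ((n : ℝ) + 1))) = 0 := fun n => by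
    have := hcon (1 / ((n : ℝ) + 1)) (by positivity)
    exact (measureReal_eq_zero_iff).1 (le_antisymm this measureReal_nonneg)
  have h1 : ∀ᵐ x ∂ν, ∀ n : ℕ, x < 1 / ((n : ℝ) + 1) := by
    refine ae_all_iff.2 fun n => ?_
    have := measure_eq_zero_iff_ae_notMem.1 (h0 n)
    filter_upwards [this] with x hx
    simpa using hx
  have h2 : ∫ x, x ∂ν ≤ 0 := by
    refine integral_nonpos_of_ae ?_
    filter_upwards [h1] with x hx
    by_contra! hpos
    obtain ⟨n, hn⟩ := exists_nat_one_div_lt hpos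
    exact absurd (hx n) (not_lt.2 hn.le)
  linarith

/-- The excess of a walk with positive drift and square integrable steps over a level, stopped
when it passes the level, has a mean that is bounded uniformly in the level. -/
theorem exists_overshoot_bound (h2 : MemLp id 2 ν) (hμ : 0 < ∫ x, x ∂ν) :
    ∃ C : ℝ, 0 ≤ C ∧ ∀ y : ℝ, 0 < y → ∀ n : ℕ,
      (stepOp (Set.Ioi 0) ν)^[n] (fun z => ENNReal.ofReal (-z)) y ≤ ENNReal.ofReal C := by
  have h1 : Integrable id ν := h2.integrable (by norm_num)
  set μ := ∫ x, x ∂ν with hμdef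
  set q := ∫ x, x ^ 2 ∂ν with hq
  have hq0 : 0 ≤ q := integral_nonneg fun x => sq_nonneg x
  -- With slope at most `μ / 2` below `L`, the potential divided by `μ` cancels at most half of `max
  -- (-y) 0`, so `V` still dominates the other half.
  obtain ⟨L, hL0, hL⟩ : ∃ L : ℝ, 0 ≤ L ∧ meanExcess ν L ≤ μ / 2 := by
    obtain ⟨n, hn⟩ := ((tendsto_meanExcess h1).eventually_le_const (half_pos hμ)).exists
    exact ⟨n, n.cast_nonneg, hn⟩
  obtain ⟨x₀, hx₀, hp⟩ := exists_pos_measure_Ici hμ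
  set p := ν.real (Set.Ici x₀) with hpdef
  have hp1 : p ≤ 1 := measureReal_le_one
  -- The factor `2` leaves a margin: from `k = ⌈y / x₀⌉₊` the mean of `stepPotential` drops by at
  -- least `p * θ ^ (k - 1) - θ ^ k = θ ^ k`.
  set θ := p / 2 with hθ
  have hθ0 : 0 < θ := by positivity
  have hθ1 : θ ≤ 1 := by linarith
  set ε := θ * θ ^ ⌈L / x₀⌉₊ with hε
  have hε0 : 0 < ε := by positivity
  -- For `0 < y ≤ L` the drop is at least `ε`, so `B` makes it pay for the largest possible excess,
  -- `meanExcess ν 0`.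
  set B := meanExcess ν 0 / ε with hB
  have hB0 : 0 ≤ B := div_nonneg (meanExcess_nonneg ν 0) hε0.le
  set A := q / (2 * μ) with hA
  have hA0 : 0 ≤ A := by positivity
  set V : ℝ → ℝ := fun y =>
    max (-y) 0 + meanPotential ν L y / μ + B * stepPotential θ x₀ y + A with hV
  have hΦlow : ∀ y, -A + min y 0 / 2 ≤ meanPotential ν L y / μ := fun y => by
    have h := le_meanPotential h2 hL0 y
    have h' : μ / 2 * min y 0 ≤ meanExcess ν L * min y 0 :=
      mul_le_mul_of_nonpos_right hL (min_le_right _ _)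
    rw [le_div_iff₀ hμ, hA]
    have e : (-(q / (2 * μ)) + min y 0 / 2) * μ = -q / 2 + μ / 2 * min y 0 := by
      field_simp
    rw [e]
    linarith
  have hVlow : ∀ y, max (-y) 0 / 2 ≤ V y := fun y => by
    have h := hΦlow y
    have h' : 0 ≤ B * stepPotential θ x₀ y :=
      mul_nonneg hB0 (stepPotential_nonneg hθ0.le hθ1 _ _)
    have : min y 0 = - max (-y) 0 := by
      rw [← min_neg_neg]; simp
    simp only [hV]
    rw [this] at h
    linarith
  have hVup : ∀ y, 0 < y → V y ≤ L / 2 + B + A := fun y hy => by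
    have h := meanPotential_le h2 L y
    have h' : B * stepPotential θ x₀ y ≤ B := by
      nlinarith [stepPotential_le_one hθ0.le x₀ y]
    have h'' : meanPotential ν L y / μ ≤ L / 2 := by
      rw [div_le_iff₀ hμ]; nlinarith
    simp only [hV]
    rw [max_eq_right (show -y ≤ 0 by linarith)]
    linarith
  set f : ℝ → ℝ≥0∞ := fun z => ENNReal.ofReal (-z) with hf
  set W : ℝ → ℝ≥0∞ := fun z => ENNReal.ofReal (2 * V z) with hW
  have hfW : f ≤ W := fun z => by
    refine ENNReal.ofReal_le_ofReal ?_
    have := hVlow z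
    have := le_max_left (-z) 0
    linarith
  -- Superharmonicity: above `L` the potential pays for the overshoot of the next step, and below
  -- `L` the step potential does.
  have hstep : stepOp (Set.Ioi 0) ν W ≤ W := fun y => by
    by_cases hy : y ∈ Set.Ioi (0 : ℝ)
    swap
    · rw [stepOp_of_notMem hy]
    have hy0 : 0 < y := hy
    rw [stepOp_of_mem hy]
    set k := ⌈y / x₀⌉₊ with hk
    have hk1 : 1 ≤ k := Nat.one_le_ceil_iff.2 (by positivity)
    set U : ℝ → ℝ := fun x => max (x - y) 0
      + (meanPotential ν L y - x * meanExcess ν (max y L)) / μ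
      + B * (1 - (Set.Ici x₀).indicator (fun _ => θ ^ (k - 1)) x) + A with hU
    have hVU : ∀ x, V (y - x) ≤ U x := fun x => by
      simp only [hV, hU]
      have e1 := stepPotential_sub_le hθ0 hθ1 hx₀ y x
      have e2 := meanPotential_sub_le h2 L y x
      rw [show -(y - x) = x - y by ring]
      gcongr
    have i1 := integrable_excess h1 y
    have i2 : Integrable (fun x : ℝ =>
        (meanPotential ν L y - x * meanExcess ν (max y L)) / μ) ν :=
      ((integrable_const _).sub (h1.mul_const _)).div_const μ
    have i3 : Integrable (fun x : ℝ =>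
        B * (1 - (Set.Ici x₀).indicator (fun _ => θ ^ (k - 1)) x)) ν :=
      ((integrable_const _).sub ((integrable_const _).indicator measurableSet_Ici)).const_mul B
    have iU : Integrable U ν := ((i1.add i2).add i3).add (integrable_const A)
    have hUint : ∫ x, U x ∂ν = meanExcess ν y
        + (meanPotential ν L y / μ - meanExcess ν (max y L))
        + B * (1 - p * θ ^ (k - 1)) + A := by
      have e1 : ∫ x, U x ∂ν = ∫ x, max (x - y) 0 ∂ν
          + ∫ x, (meanPotential ν L y - x * meanExcess ν (max y L)) / μ ∂ν
          + ∫ x, B * (1 - (Set.Ici x₀).indicator (fun _ => θ ^ (k - 1)) x) ∂ν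
          + ∫ _, A ∂ν :=
        (integral_add ((i1.add i2).add i3) (integrable_const A)).trans <| congrArg (· + _) <|
          (integral_add (i1.add i2) i3).trans <| congrArg (· + _) <| integral_add i1 i2
      have h1' : Integrable (fun x : ℝ => x) ν := h1
      rw [e1, integral_div, integral_const_mul,
        integral_sub (integrable_const _) (h1'.mul_const _), integral_mul_const,
        integral_sub (integrable_const _) ((integrable_const _).indicator measurableSet_Ici),
        integral_indicator measurableSet_Ici]
      simp only [integral_const, probReal_univ, smul_eq_mul, measureReal_restrict_apply_univ,
        one_mul, ← hpdef, ← hμdef]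
      rw [sub_div, mul_div_cancel_left₀ _ hμ.ne']
      rfl
    have hUV : ∫ x, U x ∂ν ≤ V y := by
      rw [hUint]
      simp only [hV, stepPotential, ← hk]
      rw [max_eq_right (show -y ≤ 0 by linarith)]
      have hpow : θ ^ k = θ * θ ^ (k - 1) := by
        rw [← pow_succ']; congr 1; omega
      have hp2 : p = 2 * θ := by rw [hθ]; ring
      have key : meanExcess ν y - meanExcess ν (max y L) ≤ B * (θ * θ ^ (k - 1)) := by
        rcases le_total L y with hLy | hLy
        · rw [max_eq_left hLy, sub_self]; positivity
        · have a1 : meanExcess ν y ≤ meanExcess ν 0 := meanExcess_anti h1 hy0.le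
          have a2 := meanExcess_nonneg ν (max y L)
          have a3 : θ ^ ⌈L / x₀⌉₊ ≤ θ ^ (k - 1) := by
            refine pow_le_pow_of_le_one hθ0.le hθ1 ?_
            have : k ≤ ⌈L / x₀⌉₊ := Nat.ceil_mono (by gcongr)
            omega
          have a4 : meanExcess ν 0 = B * ε := by
            rw [hB, div_mul_cancel₀ _ hε0.ne']
          have a5 : B * ε ≤ B * (θ * θ ^ (k - 1)) := by
            rw [hε]; gcongr
          linarith
      rw [hpow, hp2]
      nlinarith
    have hU0 : ∀ x, 0 ≤ U x := fun x =>
      ((div_nonneg (le_max_right _ _) two_pos.le).trans (hVlow _)).trans (hVU x)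
    calc ∫⁻ x, W (y - x) ∂ν ≤ ∫⁻ x, ENNReal.ofReal (2 * U x) ∂ν :=
          lintegral_mono fun x => ENNReal.ofReal_le_ofReal (by linarith [hVU x])
      _ = ENNReal.ofReal (∫ x, 2 * U x ∂ν) :=
          (ofReal_integral_eq_lintegral_ofReal (iU.const_mul 2)
            (Eventually.of_forall fun x => by have := hU0 x; positivity)).symm
      _ ≤ W y := by
          rw [integral_const_mul]
          exact ENNReal.ofReal_le_ofReal (by linarith)
  refine ⟨2 * (L / 2 + B + A), by positivity, fun y hy n => ?_⟩
  refine (iterate_stepOp_le hfW hstep n y).trans ?_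
  exact ENNReal.ofReal_le_ofReal (by linarith [hVup y hy])

end Overshoot

/-! ### Positive overshoots for steps that are not upward skip-free. -/

section LowerBound

/-- The mean overshoot, over a threshold at distance `y`, made during the first `n` steps. -/
noncomputable def meanOvershootUpTo (ν : Measure ℝ) (n : ℕ) : ℝ → ℝ≥0∞ :=
  (stepOp (Set.Ioi 0) ν)^[n] (fun z => ENNReal.ofReal (-z))

variable {ν : Measure ℝ}

/-- The function vanishes on the region where the chain moves, so it is subharmonic. -/
lemma le_stepOp_ofReal_neg :
    (fun z : ℝ => ENNReal.ofReal (-z)) ≤ stepOp (Set.Ioi 0) ν (fun z => ENNReal.ofReal (-z)) := by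
  intro y
  by_cases hy : y ∈ Set.Ioi (0 : ℝ)
  · have hy' : 0 < y := hy
    simp [ENNReal.ofReal_of_nonpos (show -y ≤ 0 by linarith)]
  · rw [stepOp_of_notMem hy]

lemma le_iterate_succ_stepOp {D : Set ℝ} {g : ℝ → ℝ≥0∞} (hg : g ≤ stepOp D ν g) (n : ℕ) :
    (stepOp D ν)^[n] g ≤ (stepOp D ν)^[n + 1] g := by
  rw [Function.iterate_succ_apply]
  exact (monotone_stepOp D ν).iterate n hg

lemma monotone_meanOvershootUpTo (ν : Measure ℝ) : Monotone (meanOvershootUpTo ν) :=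
  monotone_nat_of_le_succ fun n => le_iterate_succ_stepOp le_stepOp_ofReal_neg n

lemma meanOvershootUpTo_succ (n : ℕ) :
    meanOvershootUpTo ν (n + 1) = stepOp (Set.Ioi 0) ν (meanOvershootUpTo ν n) :=
  Function.iterate_succ_apply' _ _ _

/-- Optional stopping: a subharmonic `g` has a smaller mean when the walk is stopped earlier, at
level `L` instead of `0`. -/
lemma iterate_stepOp_Ioi_le {L : ℝ} (hL : 0 ≤ L) {g : ℝ → ℝ≥0∞}
    (hg : g ≤ stepOp (Set.Ioi 0) ν g) (n : ℕ) :
    (stepOp (Set.Ioi L) ν)^[n] g ≤ (stepOp (Set.Ioi 0) ν)^[n] g := by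
  induction n with
  | zero => exact le_rfl
  | succ n ih =>
    rw [Function.iterate_succ_apply', Function.iterate_succ_apply']
    refine (stepOp_mono ih).trans fun y => ?_
    have h1 := le_iterate_succ_stepOp hg n
    rw [Function.iterate_succ_apply'] at h1
    by_cases hy : y ∈ Set.Ioi L
    · rw [stepOp_of_mem hy, stepOp_of_mem (Set.Ioi_subset_Ioi hL hy)]
    · rw [stepOp_of_notMem hy]
      exact h1 y

lemma iterate_stepOp_translate (L : ℝ) (g : ℝ → ℝ≥0∞) (n : ℕ) (y : ℝ) :
    (stepOp (Set.Ioi L) ν)^[n] g (y + L)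
      = (stepOp (Set.Ioi 0) ν)^[n] (fun z => g (z + L)) y := by
  induction n generalizing y with
  | zero => rfl
  | succ n ih =>
    rw [Function.iterate_succ_apply', Function.iterate_succ_apply']
    by_cases hy : 0 < y
    · rw [stepOp_of_mem (show y + L ∈ Set.Ioi L from by simpa using hy),
        stepOp_of_mem (show y ∈ Set.Ioi 0 from hy)]
      refine lintegral_congr fun x => ?_
      rw [← ih, show y + L - x = y - x + L by ring]
    · rw [stepOp_of_notMem (show y + L ∉ Set.Ioi L from by simpa using hy),
        stepOp_of_notMem (show y ∉ Set.Ioi 0 from hy), ih]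

/-- Keeps only the steps within `ε` of `w`. -/
lemma mul_le_stepOp {D : Set ℝ} {g : ℝ → ℝ≥0∞} {y w ε : ℝ} {q : ℝ≥0∞} (hy : y ∈ D)
    (hg : ∀ x, |x - w| < ε → q ≤ g (y - x)) :
    ν (Metric.ball w ε) * q ≤ stepOp D ν g y := by
  rw [stepOp_of_mem hy, mul_comm, ← lintegral_indicator_const Metric.isOpen_ball.measurableSet]
  refine lintegral_mono fun x => ?_
  by_cases hx : x ∈ Metric.ball w ε
  · rw [Set.indicator_of_mem hx]
    exact hg x (by rwa [Metric.mem_ball, Real.dist_eq] at hx)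
  · rw [Set.indicator_of_notMem hx]
    exact bot_le

/-- `k` steps close to `a`, before a lower bound on `(lo, hi]` is used. -/
lemma pow_mul_le_meanOvershootUpTo {a ε lo hi : ℝ} {p q : ℝ≥0∞} {m : ℕ} (ha : 0 < a) (hε : 0 < ε)
    (hlo : 0 ≤ lo + a) (hp : p ≤ ν (Metric.ball a ε))
    (hq : ∀ y, lo < y → y ≤ hi → q ≤ meanOvershootUpTo ν m y) (k : ℕ) :
    ∀ y, lo + k * (a + ε) < y → y ≤ hi + k * (a - ε) →
      p ^ k * q ≤ meanOvershootUpTo ν (k + m) y := by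
  induction k with
  | zero =>
    intro y h1 h2
    simpa using hq y (by simpa using h1) (by simpa using h2)
  | succ k ih =>
    intro y h1 h2
    push_cast at h1 h2
    have hy : y ∈ Set.Ioi (0 : ℝ) := by
      have : 0 ≤ (k : ℝ) * (a + ε) := by positivity
      simp only [Set.mem_Ioi]
      nlinarith
    rw [show k + 1 + m = (k + m) + 1 by ring, meanOvershootUpTo_succ, pow_succ', mul_assoc]
    refine le_trans ?_ (mul_le_stepOp (q := p ^ k * q) hy (w := a) (ε := ε) fun x hx => ?_)
    · gcongr
    · rw [abs_lt] at hx
      exact ih (y - x) (by nlinarith [hx.1, hx.2]) (by nlinarith [hx.1, hx.2])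

lemma ofReal_le_meanOvershootUpTo_zero {c y : ℝ} (hy : y ≤ -c) :
    ENNReal.ofReal c ≤ meanOvershootUpTo ν 0 y :=
  ENNReal.ofReal_le_ofReal (by linarith)

/-- Two kinds of steps `a > 0` and `b ∉ {a, 0, -a, …}` allow to pass the threshold by a positive
amount, from any starting point in a window. -/
lemma exists_le_meanOvershootUpTo [IsProbabilityMeasure ν] {a b : ℝ} (ha : 0 < a)
    (hb : ¬ ∃ k : ℤ, k ≤ 1 ∧ b = k * a)
    (hsa : ∀ ε, 0 < ε → 0 < ν (Metric.ball a ε)) (hsb : ∀ ε, 0 < ε → 0 < ν (Metric.ball b ε)) :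
    ∃ L₁ : ℝ, 0 < L₁ ∧ ∀ L ≥ L₁, ∃ M : ℕ, ∃ c : ℝ≥0∞, 0 < c ∧
      ∀ y ∈ Set.Icc L (2 * L), c ≤ meanOvershootUpTo ν M y := by
  set j : ℤ := -⌊b / a⌋ with hj
  set f : ℝ := b + j * a with hf
  have hf0 : 0 ≤ f := by
    have := Int.floor_le (b / a)
    rw [le_div_iff₀ ha] at this
    simp only [hf, hj]; push_cast; linarith
  have hfa : f < a := by
    have := Int.lt_floor_add_one (b / a)
    rw [div_lt_iff₀ ha] at this
    simp only [hf, hj]; push_cast; linarith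
  obtain ⟨η, hη, hηa, hηf⟩ : ∃ η : ℝ, 0 < η ∧ η ≤ a / 2 ∧
      (0 < f → 2 * η ≤ f ∧ 2 * η ≤ a - f) := by
    rcases hf0.eq_or_lt with h | h
    · exact ⟨a / 2, by linarith, le_rfl, fun h' => absurd h' (by rw [← h]; exact lt_irrefl _)⟩
    · refine ⟨min f (a - f) / 2, by have := lt_min h (sub_pos.2 hfa); linarith, ?_, fun _ => ?_⟩
      · have := min_le_left f (a - f); linarith
      · constructor
        · have := min_le_left f (a - f); linarith
        · have := min_le_right f (a - f); linarith
  -- For `y` beyond this level, `y - η` exceeds `|j| * a`, so that `k ≥ 1` and `k + j ≥ 0` below.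
  refine ⟨η + |(j : ℝ)| * a + 1, by positivity, fun L hL => ?_⟩
  have hL0 : 0 < L := lt_of_lt_of_le (by positivity) hL
  obtain ⟨K, hK⟩ := exists_nat_ge (2 * L / a + 2 + |(j : ℝ)|)
  have hK0 : (0 : ℝ) ≤ K := K.cast_nonneg
  -- At most `K + 1` steps are used, so their total error is at most `η / 2`, half of the margin.
  set ε : ℝ := η / (2 * (K + 1)) with hε
  have hε0 : 0 < ε := by positivity
  have hKε : (K + 1) * ε = η / 2 := by rw [hε]; field_simp
  have hkε : ∀ k : ℝ, k ≤ K → k * ε + ε ≤ η / 2 := fun k hk => by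
    rw [← hKε]; nlinarith
  set p : ℝ≥0∞ := min (ν (Metric.ball a ε)) (ν (Metric.ball b ε)) with hp
  have hp0 : 0 < p := lt_min (hsa ε hε0) (hsb ε hε0)
  have hp1 : p ≤ 1 := (min_le_left _ _).trans prob_le_one
  set q := ENNReal.ofReal (η / 2) with hq
  have hq0 : 0 < q := ENNReal.ofReal_pos.2 (by linarith)
  have hfin : ∀ (k : ℕ) (y : ℝ), k ≤ K + 1 → p ^ k * q ≤ meanOvershootUpTo ν k y →
      p ^ (K + 1) * q ≤ meanOvershootUpTo ν (K + 1) y := fun k y hk h => by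
    refine le_trans ?_ (h.trans (monotone_meanOvershootUpTo ν hk y))
    gcongr ?_ * q
    exact pow_le_pow_of_le_one bot_le hp1 hk
  have hA := pow_mul_le_meanOvershootUpTo (ν := ν) (a := a) (ε := ε) (lo := -a) (hi := -(η / 2))
    (p := p) (q := q) (m := 0) ha hε0 (by linarith) (min_le_left _ _)
    (fun y _ h => ofReal_le_meanOvershootUpTo_zero h)
  refine ⟨K + 1, p ^ (K + 1) * q, ENNReal.mul_pos (ENNReal.pow_pos hp0 _).ne' hq0.ne',
    fun y hy => ?_⟩
  obtain ⟨hy1, hy2⟩ := hy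
  have hyη : 0 < y - η := by
    have : 0 ≤ |(j : ℝ)| * a := by positivity
    linarith
  set k := ⌈(y - η) / a⌉₊ with hk
  have hk1 : y - η ≤ k * a := by
    rw [← div_le_iff₀ ha]; exact Nat.le_ceil _
  have hk2 : k * a < y - η + a := by
    have := Nat.ceil_lt_add_one (show 0 ≤ (y - η) / a by positivity)
    have h' : (k : ℝ) - 1 < (y - η) / a := by linarith
    rw [lt_div_iff₀ ha] at h'
    linarith
  have hkK : (k : ℝ) + |(j : ℝ)| ≤ K := by
    have h1 : (y - η) / a ≤ 2 * L / a := by gcongr; linarith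
    have := Nat.ceil_lt_add_one (show 0 ≤ (y - η) / a by positivity)
    linarith
  have hkK' : (k : ℝ) ≤ K := by have := abs_nonneg (j : ℝ); linarith
  have hkKn : k ≤ K := by exact_mod_cast hkK'
  have hkpos : 1 ≤ k := Nat.one_le_ceil_iff.2 (by positivity)
  have hkε' := hkε k hkK'
  -- Steps near `a` alone suffice unless `k * a` lies within `η` of `y`. In that case a step near
  -- `b` shifts the landing point away from the threshold.
  by_cases he : η ≤ k * a - y
  · refine hfin k y (by omega) ?_
    have := hA k y (by nlinarith) (by nlinarith)
    simpa using this
  push Not at he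
  rcases hf0.eq_or_lt with h0 | h0
  -- With remainder zero, `b` is a multiple of `a`, and the hypothesis forces the multiple to be at
  -- least `2`. Taking `b` as the last step then overshoots by about `a` or more.
  · have hj2 : 2 * a ≤ b := by
      have e : b = (-j : ℤ) * a := by push_cast; linarith
      have : 2 ≤ -j := by
        by_contra! hcon
        exact hb ⟨-j, by omega, e⟩
      have h2 : (2 : ℝ) ≤ ((-j : ℤ) : ℝ) := by exact_mod_cast this
      rw [e]
      nlinarith
    obtain ⟨i, hi⟩ : ∃ i, k = i + 1 := ⟨k - 1, by omega⟩
    have hB := pow_mul_le_meanOvershootUpTo (ν := ν) (a := a) (ε := ε) (lo := 0)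
      (hi := b - η / 2 - ε) (p := p) (q := p * q) (m := 1) ha hε0 (by linarith) (min_le_left _ _)
      (fun z hz1 hz2 => by
        rw [meanOvershootUpTo_succ]
        refine le_trans ?_ (mul_le_stepOp (q := q) (show z ∈ Set.Ioi 0 from hz1)
          (w := b) (ε := ε) fun x hx => ?_)
        · gcongr; exact min_le_right _ _
        · rw [abs_lt] at hx
          exact ofReal_le_meanOvershootUpTo_zero (by linarith [hx.1])) i
    refine hfin k y (by omega) ?_
    have hik : (k : ℝ) = i + 1 := by rw [hi]; push_cast; ring
    rw [hik] at hk1 hk2 he hkε'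
    have := hB y (by nlinarith) (by nlinarith)
    rw [hi, pow_succ, mul_assoc]
    exact this
  -- The step near `b` comes first, since it may point away from the threshold. The bound `2 * η ≤ a
  -- - f` keeps the walk below the threshold until its last step.
  · obtain ⟨hf1, hf2⟩ := hηf h0
    have hkj : 0 ≤ (k : ℤ) + j := by
      have h1 : |(j : ℝ)| * a ≤ k * a := by linarith
      have h2 : |(j : ℝ)| ≤ k := le_of_mul_le_mul_right h1 ha
      have h3 : (0 : ℝ) ≤ k + j := by have := neg_abs_le (j : ℝ); linarith
      exact_mod_cast h3
    obtain ⟨i, hi⟩ := Int.eq_ofNat_of_zero_le hkj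
    have hi' : (i : ℝ) = k + j := by
      have : ((k : ℤ) + j : ℤ) = (i : ℤ) := hi
      exact_mod_cast this.symm
    have hiK : (i : ℝ) ≤ K := by have := le_abs_self (j : ℝ); linarith
    have hiKn : i ≤ K := by exact_mod_cast hiK
    have hiε := hkε i hiK
    refine hfin (i + 1) y (by omega) ?_
    rw [meanOvershootUpTo_succ, pow_succ', mul_assoc]
    refine le_trans ?_ (mul_le_stepOp (q := p ^ i * q)
      (show y ∈ Set.Ioi (0 : ℝ) from hL0.trans_le hy1) (w := b) (ε := ε) fun x hx => ?_)
    · gcongr; exact min_le_right _ _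
    · rw [abs_lt] at hx
      have e1 : (i : ℝ) * a = k * a + (f - b) := by rw [hi', hf]; ring
      have := hA i (y - x) (by nlinarith [hx.1, hx.2]) (by nlinarith [hx.1, hx.2])
      simpa using this

/-- The steps of a law that is not upward skip-free allow to pass the threshold by a positive
amount. -/
lemma exists_window [IsProbabilityMeasure ν] (hμ : 0 < ∫ x, x ∂ν)
    (hsf : ∀ d : ℝ, 0 < d → ¬ ∀ᵐ x ∂ν, ∃ k : ℤ, k ≤ 1 ∧ x = k * d) :
    ∃ L₁ : ℝ, 0 < L₁ ∧ ∀ L ≥ L₁, ∃ M : ℕ, ∃ c : ℝ≥0∞, 0 < c ∧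
      ∀ y ∈ Set.Icc L (2 * L), c ≤ meanOvershootUpTo ν M y := by
  have hsupp : ∀ x ∈ ν.support, ∀ ε, 0 < ε → 0 < ν (Metric.ball x ε) := fun x hx ε hε =>
    (Measure.mem_support_iff_forall x).1 hx _ (Metric.ball_mem_nhds x hε)
  have hae : ∀ᵐ x ∂ν, x ∈ ν.support := Measure.support_mem_ae
  obtain ⟨a, ha, has⟩ : ∃ a, 0 < a ∧ a ∈ ν.support := by
    by_contra! hcon
    have : ∫ x, x ∂ν ≤ 0 := by
      refine integral_nonpos_of_ae ?_
      filter_upwards [hae] with x hx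
      by_contra! hpos
      exact hcon x hpos hx
    linarith
  -- A law whose support lies in `{a, 0, -a, …}` would be skip-free with span `a`.
  obtain ⟨b, hb, hbs⟩ : ∃ b, (¬ ∃ k : ℤ, k ≤ 1 ∧ b = k * a) ∧ b ∈ ν.support := by
    by_contra! hcon
    refine hsf a ha ?_
    filter_upwards [hae] with x hx
    by_contra hx'
    exact hcon x (fun k h1 h2 => hx' ⟨k, h1, h2⟩) hx
  exact exists_le_meanOvershootUpTo ha hb (hsupp a has) (hsupp b hbs)

end LowerBound

/-! ### Pathwise properties of the sampling times and of the number of samples. -/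

section Paths

variable {Ω : Type*} {X : ℕ → Ω → ℝ} {Δ : ℝ} {ω : Ω}

/-- Replaces infima in `ℕ∞` by least elements in `ℕ`. The empty set is excluded because its infimum
is `⊤`. -/
lemma sInf_coe_image_eq_iff {T : Set ℕ} {k : ℕ} :
    sInf ((fun t : ℕ => (t : ℕ∞)) '' T) = (k : ℕ∞) ↔ IsLeast T k := by
  have key : ∀ k, IsLeast T k → sInf ((fun t : ℕ => (t : ℕ∞)) '' T) = (k : ℕ∞) := fun k hk =>
    (IsLeast.isGLB ⟨Set.mem_image_of_mem _ hk.1, by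
      rintro _ ⟨j, hj, rfl⟩
      exact Nat.cast_le.2 (hk.2 hj)⟩).sInf_eq
  refine ⟨fun h => ?_, key k⟩
  rcases T.eq_empty_or_nonempty with rfl | hT
  · simp at h
  · have hl : IsLeast T (sInf T) := ⟨Nat.sInf_mem hT, fun j hj => Nat.sInf_le hj⟩
    have := key _ hl
    rw [h, Nat.cast_inj] at this
    rwa [this]

lemma walk_zero : walk X 0 ω = 0 := by simp [walk]

lemma walk_succ (n : ℕ) : walk X (n + 1) ω = walk X n ω + X n ω := Finset.sum_range_succ _ _

lemma walk_add_sub (m j : ℕ) :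
    walk X (m + j) ω - walk X m ω = walk (fun i => X (m + i)) j ω := by
  simp [walk, Finset.sum_range_add]

lemma sampleTime_succ_eq_iff {n m k : ℕ} (h : sampleTime X Δ n ω = (m : ℕ∞)) :
    sampleTime X Δ (n + 1) ω = (k : ℕ∞) ↔ m ≤ k ∧ Δ ≤ walk X k ω - walk X m ω ∧
      ∀ j, m ≤ j → j < k → walk X j ω - walk X m ω < Δ := by
  rw [sampleTime, sInf_coe_image_eq_iff, h]
  simp only [IsLeast, lowerBounds, Set.mem_ofPred_eq, Nat.cast_le, ENat.toNat_natCast]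
  constructor
  · rintro ⟨⟨h1, h2⟩, h3⟩
    refine ⟨h1, h2, fun j hj hjk => ?_⟩
    by_contra! hcon
    exact absurd (h3 ⟨hj, hcon⟩) (not_le.2 hjk)
  · rintro ⟨h1, h2, h3⟩
    refine ⟨⟨h1, h2⟩, fun j hj => ?_⟩
    by_contra! hcon
    exact absurd (h3 j hj.1 hcon) (not_lt.2 hj.2)

lemma exists_sampleTime_eq_of_succ {n k : ℕ} (h : sampleTime X Δ (n + 1) ω = (k : ℕ∞)) :
    ∃ m ≤ k, sampleTime X Δ n ω = (m : ℕ∞) := by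
  rw [sampleTime, sInf_coe_image_eq_iff] at h
  have h1 : sampleTime X Δ n ω ≤ (k : ℕ∞) := h.1.1
  obtain ⟨m, hm⟩ := ENat.ne_top_iff_exists.1 (ne_top_of_le_ne_top (ENat.natCast_ne_top k) h1)
  exact ⟨m, by rw [← hm] at h1; exact_mod_cast h1, hm.symm⟩

lemma sampleTime_zero : sampleTime X Δ 0 ω = ((0 : ℕ) : ℕ∞) := rfl

lemma sampleTime_one_eq_iff {k : ℕ} :
    sampleTime X Δ 1 ω = (k : ℕ∞) ↔ Δ ≤ walk X k ω ∧ ∀ j < k, walk X j ω < Δ := by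
  rw [sampleTime_succ_eq_iff sampleTime_zero]
  simp [walk_zero]

lemma exists_sampleTime_succ_of_le {n m j : ℕ} (h : sampleTime X Δ n ω = (m : ℕ∞))
    (hmj : m ≤ j) (hj : Δ ≤ walk X j ω - walk X m ω) :
    ∃ k ≤ j, sampleTime X Δ (n + 1) ω = (k : ℕ∞) := by
  classical
  have hex : ∃ k, m ≤ k ∧ Δ ≤ walk X k ω - walk X m ω := ⟨j, hmj, hj⟩
  refine ⟨Nat.find hex, Nat.find_min' hex ⟨hmj, hj⟩, ?_⟩
  rw [sampleTime_succ_eq_iff h]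
  refine ⟨(Nat.find_spec hex).1, (Nat.find_spec hex).2, fun i hi hik => ?_⟩
  have := Nat.find_min hex hik
  push Not at this
  exact this hi

lemma sampleTime_lt_succ (hΔ : 0 < Δ) {n m k : ℕ} (h : sampleTime X Δ n ω = (m : ℕ∞))
    (h' : sampleTime X Δ (n + 1) ω = (k : ℕ∞)) : m < k := by
  obtain ⟨h1, h2, -⟩ := (sampleTime_succ_eq_iff h).1 h'
  refine lt_of_le_of_ne h1 fun he => ?_
  rw [he, sub_self] at h2
  linarith

lemma le_of_sampleTime_eq (hΔ : 0 < Δ) {n : ℕ} : ∀ {m : ℕ},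
    sampleTime X Δ n ω = (m : ℕ∞) → n ≤ m := by
  induction n with
  | zero => intro m _; exact m.zero_le
  | succ n ih =>
    intro k hk
    obtain ⟨m, -, hm⟩ := exists_sampleTime_eq_of_succ hk
    have := sampleTime_lt_succ hΔ hm hk
    have := ih hm
    omega

/-- After `τ_n = m`, the next sampling time is the first sampling time of the later steps. -/
lemma sampleTime_succ_shift {n m k : ℕ} (h : sampleTime X Δ n ω = (m : ℕ∞)) :
    sampleTime X Δ (n + 1) ω = ((m + k : ℕ) : ℕ∞)
      ↔ sampleTime (fun i => X (m + i)) Δ 1 ω = (k : ℕ∞) := by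
  rw [sampleTime_succ_eq_iff h, sampleTime_one_eq_iff, walk_add_sub]
  constructor
  · rintro ⟨-, h1, h2⟩
    refine ⟨h1, fun j hj => ?_⟩
    rw [← walk_add_sub]
    exact h2 _ (by omega) (by omega)
  · rintro ⟨h1, h2⟩
    refine ⟨by omega, h1, fun j hj hjk => ?_⟩
    obtain ⟨i, rfl⟩ := Nat.exists_eq_add_of_le hj
    rw [walk_add_sub]
    exact h2 i (by omega)

lemma sampleTime_succ_ne_top_iff {n m : ℕ} (h : sampleTime X Δ n ω = (m : ℕ∞)) :
    sampleTime X Δ (n + 1) ω ≠ ⊤ ↔ sampleTime (fun i => X (m + i)) Δ 1 ω ≠ ⊤ := by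
  rw [ENat.ne_top_iff_exists, ENat.ne_top_iff_exists]
  constructor
  · rintro ⟨k, hk⟩
    obtain ⟨i, rfl⟩ := Nat.exists_eq_add_of_le ((sampleTime_succ_eq_iff h).1 hk.symm).1
    exact ⟨i, ((sampleTime_succ_shift h).1 hk.symm).symm⟩
  · rintro ⟨k, hk⟩
    exact ⟨m + k, ((sampleTime_succ_shift h).2 hk.symm).symm⟩

lemma overshoot_zero_eq {k : ℕ} (h : sampleTime X Δ 1 ω = (k : ℕ∞)) :
    overshoot X Δ 0 ω = walk X k ω - Δ := by
  rw [overshoot, h, sampleTime_zero]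
  simp [walk_zero]

lemma overshoot_eq_shift {n m : ℕ} (h : sampleTime X Δ n ω = (m : ℕ∞))
    (h' : sampleTime X Δ (n + 1) ω ≠ ⊤) :
    overshoot X Δ n ω = overshoot (fun i => X (m + i)) Δ 0 ω := by
  obtain ⟨k, hk⟩ := ENat.ne_top_iff_exists.1 h'
  obtain ⟨i, rfl⟩ := Nat.exists_eq_add_of_le ((sampleTime_succ_eq_iff h).1 hk.symm).1
  rw [overshoot_zero_eq ((sampleTime_succ_shift h).1 hk.symm), overshoot, h, ← hk,
    ENat.toNat_natCast, ENat.toNat_natCast, walk_add_sub]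

lemma overshoot_nonneg {n : ℕ} (h' : sampleTime X Δ (n + 1) ω ≠ ⊤) : 0 ≤ overshoot X Δ n ω := by
  obtain ⟨k, hk⟩ := ENat.ne_top_iff_exists.1 h'
  obtain ⟨m, -, hm⟩ := exists_sampleTime_eq_of_succ hk.symm
  have := ((sampleTime_succ_eq_iff hm).1 hk.symm).2.1
  rw [overshoot, hm, ← hk, ENat.toNat_natCast, ENat.toNat_natCast]
  linarith

/-- Writes the sampling time as a functional of the path, so that equality of path laws transfers to
it. -/
lemma sampleTime_path (n : ℕ) :
    sampleTime X Δ n ω = sampleTime (fun i (x : ℕ → ℝ) => x i) Δ n (fun i => X i ω) := by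
  induction n with
  | zero => rfl
  | succ n ih => rw [sampleTime, sampleTime, ← ih]; rfl

lemma overshoot_path (n : ℕ) :
    overshoot X Δ n ω = overshoot (fun i (x : ℕ → ℝ) => x i) Δ n (fun i => X i ω) := by
  rw [overshoot, overshoot, ← sampleTime_path, ← sampleTime_path]; rfl

/-! ### The stopped walk and the first sampling time -/

lemma stoppedWalk_eq {D : Set ℝ} {y : ℝ} {n : ℕ} (h : ∀ j < n, y - walk X j ω ∈ D) :
    stoppedWalk D X y n ω = y - walk X n ω := by
  induction n with
  | zero => simp [stoppedWalk, walk_zero]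
  | succ n ih =>
    have e := ih fun j hj => h j (by omega)
    rw [stoppedWalk, e, if_pos (h n n.lt_succ_self), walk_succ]
    ring

lemma stoppedWalk_of_notMem {D : Set ℝ} {y : ℝ} {n m : ℕ} (h : stoppedWalk D X y n ω ∉ D)
    (hnm : n ≤ m) : stoppedWalk D X y m ω = stoppedWalk D X y n ω := by
  induction m, hnm using Nat.le_induction with
  | base => rfl
  | succ m _ ih => rw [stoppedWalk, if_neg (by rwa [ih]), ih]

/-- Outside `D` the walk is frozen, so being in `D` now means never having left it. -/
lemma stoppedWalk_mem_iff {D : Set ℝ} {y : ℝ} {n : ℕ} :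
    stoppedWalk D X y n ω ∈ D ↔ ∀ j ≤ n, y - walk X j ω ∈ D := by
  constructor
  · intro h j
    induction j using Nat.strong_induction_on with
    | _ j ih =>
      intro hj
      rw [← stoppedWalk_eq fun i hi => ih i hi (by omega)]
      by_contra hcon
      rw [stoppedWalk_of_notMem hcon hj] at h
      exact hcon h
  · intro h
    rw [stoppedWalk_eq fun j hj => h j hj.le]
    exact h n le_rfl

/-- Started at `Δ`, the stopped walk records the distance still to cover, and it stays positive
exactly until `τ_1`. -/
lemma lt_sampleTime_one_iff {n : ℕ} :
    (n : ℕ∞) < sampleTime X Δ 1 ω ↔ 0 < stoppedWalk (Set.Ioi 0) X Δ n ω := by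
  have h : 0 < stoppedWalk (Set.Ioi 0) X Δ n ω ↔ ∀ j ≤ n, walk X j ω < Δ := by
    have := stoppedWalk_mem_iff (X := X) (ω := ω) (D := Set.Ioi (0 : ℝ)) (y := Δ) (n := n)
    simpa using this
  rw [h]
  constructor
  · intro hlt j hj
    by_contra! hcon
    obtain ⟨k, hk, hk'⟩ := exists_sampleTime_succ_of_le (X := X) (Δ := Δ) (ω := ω) (j := j)
      sampleTime_zero j.zero_le (by rwa [walk_zero, sub_zero])
    rw [zero_add] at hk'
    rw [hk', Nat.cast_lt] at hlt
    omega
  · intro hw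
    by_contra! hcon
    obtain ⟨k, hk⟩ := ENat.ne_top_iff_exists.1 (ne_top_of_le_ne_top (ENat.natCast_ne_top n) hcon)
    have hkn : k ≤ n := by rw [← hk] at hcon; exact_mod_cast hcon
    exact absurd (hw k hkn) (not_lt.2 (sampleTime_one_eq_iff.1 hk.symm).1)

lemma stoppedWalk_eq_neg_overshoot {k n : ℕ} (h : sampleTime X Δ 1 ω = (k : ℕ∞)) (hkn : k ≤ n) :
    stoppedWalk (Set.Ioi 0) X Δ n ω = -overshoot X Δ 0 ω := by
  obtain ⟨h1, h2⟩ := sampleTime_one_eq_iff.1 h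
  have e : stoppedWalk (Set.Ioi 0) X Δ k ω = -overshoot X Δ 0 ω := by
    rw [stoppedWalk_eq fun j hj => by simpa using h2 j hj, overshoot_zero_eq h]
    ring
  rw [stoppedWalk_of_notMem _ hkn, e]
  rw [e, overshoot_zero_eq h]
  simpa using h1

/-! ### The number of samples -/

/-- The event `{τ_n ≤ T}`. -/
def sampledBy (X : ℕ → Ω → ℝ) (Δ : ℝ) (n T : ℕ) : Set Ω :=
  {ω | ∃ m ≤ T, sampleTime X Δ n ω = (m : ℕ∞)}

lemma numSamples_eq_sSup {t : ℝ} (ht : 0 ≤ t) :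
    numSamples X Δ t ω = sSup {n : ℕ | ω ∈ sampledBy X Δ n ⌊t⌋₊} := by
  unfold numSamples sampledBy
  congr 1
  ext n
  simp only [Set.mem_ofPred_eq, Nat.le_floor_iff ht]
  exact exists_congr fun m => and_comm

lemma sampledBy_succ_subset (X : ℕ → Ω → ℝ) (Δ : ℝ) (n T : ℕ) :
    sampledBy X Δ (n + 1) T ⊆ sampledBy X Δ n T := by
  rintro ω ⟨k, hk, hk'⟩
  obtain ⟨m, hm, hm'⟩ := exists_sampleTime_eq_of_succ hk'
  exact ⟨m, hm.trans hk, hm'⟩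

lemma sampledBy_anti (X : ℕ → Ω → ℝ) (Δ : ℝ) (T : ℕ) : Antitone fun n => sampledBy X Δ n T :=
  antitone_nat_of_succ_le fun n => sampledBy_succ_subset X Δ n T

lemma le_of_mem_sampledBy (hΔ : 0 < Δ) {n T : ℕ} (h : ω ∈ sampledBy X Δ n T) : n ≤ T := by
  obtain ⟨m, hm, hm'⟩ := h
  exact (le_of_sampleTime_eq hΔ hm').trans hm

/-- The admissible `n` form an initial segment, bounded because `n ≤ τ_n`, so the supremum is
attained. -/
lemma mem_sampledBy_iff (hΔ : 0 < Δ) {t : ℝ} (ht : 0 ≤ t) {n : ℕ} :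
    ω ∈ sampledBy X Δ n ⌊t⌋₊ ↔ n ≤ numSamples X Δ t ω := by
  rw [numSamples_eq_sSup ht]
  have hbdd : BddAbove {n : ℕ | ω ∈ sampledBy X Δ n ⌊t⌋₊} :=
    ⟨⌊t⌋₊, fun n hn => le_of_mem_sampledBy hΔ hn⟩
  have hne : {n : ℕ | ω ∈ sampledBy X Δ n ⌊t⌋₊}.Nonempty := ⟨0, 0, Nat.zero_le _, rfl⟩
  refine ⟨fun h => le_csSup hbdd h, fun h => ?_⟩
  exact sampledBy_anti X Δ _ h (Nat.sSup_mem hne hbdd)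

/-- Default value of the supremum of the empty set. It matters because integrability is claimed at
every index, including those where `t` is negative. -/
lemma numSamples_of_neg {t : ℝ} (ht : t < 0) : numSamples X Δ t ω = 0 := by
  unfold numSamples
  have : {n : ℕ | ∃ m : ℕ, sampleTime X Δ n ω = (m : ℕ∞) ∧ (m : ℝ) ≤ t} = ∅ := by
    ext n
    simp only [Set.mem_ofPred_eq, Set.mem_empty_iff_false, iff_false]
    rintro ⟨m, -, hm⟩
    have : (0 : ℝ) ≤ m := m.cast_nonneg
    linarith
  rw [this, csSup_empty]; rfl

lemma numSamples_le (hΔ : 0 < Δ) (t : ℝ) : numSamples X Δ t ω ≤ ⌊t⌋₊ := by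
  rcases lt_or_ge t 0 with ht | ht
  · rw [numSamples_of_neg ht]; exact Nat.zero_le _
  · exact le_of_mem_sampledBy hΔ ((mem_sampledBy_iff hΔ ht).2 le_rfl)

/-- The decomposition of the walk at the last sampling time `τ`: all samples but the overshoots
are full, and no sample is due between `τ` and `t`. -/
lemma exists_lastSampleTime (hΔ : 0 < Δ) {t : ℝ} (ht : 0 ≤ t) : ∃ m : ℕ, m ≤ ⌊t⌋₊ ∧
    lastSampleTime X Δ t ω = m ∧
    numSamples X Δ t ω * Δ = walk X m ω
      - ∑ n ∈ Finset.range (numSamples X Δ t ω), overshoot X Δ n ω ∧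
    (∀ n < numSamples X Δ t ω, 0 ≤ overshoot X Δ n ω) ∧
    ∀ j, m ≤ j → j ≤ ⌊t⌋₊ → walk X j ω - walk X m ω < Δ := by
  set N := numSamples X Δ t ω with hN
  obtain ⟨m, hm, hm'⟩ := (mem_sampledBy_iff (X := X) (ω := ω) hΔ ht).2 hN.le
  refine ⟨m, hm, ?_, ?_, fun n hn => ?_, fun j hj hj' => ?_⟩
  · rw [lastSampleTime, ← hN, hm', ENat.toNat_natCast]
  · simp only [overshoot]
    rw [Finset.sum_sub_distrib,
      Finset.sum_range_sub (fun n => walk X (sampleTime X Δ n ω).toNat ω), hm', sampleTime_zero]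
    simp [walk_zero]
  · obtain ⟨k, -, hk⟩ := (mem_sampledBy_iff (X := X) (ω := ω) hΔ ht).2
      (show n + 1 ≤ numSamples X Δ t ω from hn)
    exact overshoot_nonneg (by rw [hk]; exact ENat.natCast_ne_top k)
  · by_contra! hcon
    obtain ⟨k, hk, hk'⟩ := exists_sampleTime_succ_of_le hm' hj hcon
    have := (mem_sampledBy_iff hΔ ht).1 (⟨k, hk.trans hj', hk'⟩ : ω ∈ sampledBy X Δ (N + 1) ⌊t⌋₊)
    omega

end Paths

/-! ### Sampling times as stopping times, and measurability of the estimators. -/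

section Measurability

variable {Ω : Type*} {X : ℕ → Ω → ℝ}

lemma measurable_past_walk (X : ℕ → Ω → ℝ) (n : ℕ) : Measurable[past X n] (walk X n) :=
  Finset.measurable_fun_sum (m := past X n) _ fun _ hi => measurable_past X (Finset.mem_range.1 hi)

/-- The stopping time property: the event is a finite Boolean combination of conditions on the first
`k` partial sums. -/
lemma measurableSet_past_sampleTime (X : ℕ → Ω → ℝ) (Δ : ℝ) (n k : ℕ) :
    MeasurableSet[past X k] {ω | sampleTime X Δ n ω = (k : ℕ∞)} := by
  induction n generalizing k with
  | zero =>
    simp only [sampleTime_zero, Nat.cast_inj]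
    exact @MeasurableSet.const _ (past X k) _
  | succ n ih =>
    have hw : ∀ j ≤ k, Measurable[past X k] (walk X j) := fun j hj =>
      (measurable_past_walk X j).mono (past_mono X hj) le_rfl
    have : {ω | sampleTime X Δ (n + 1) ω = (k : ℕ∞)} = ⋃ m ∈ Finset.range (k + 1),
        ({ω | sampleTime X Δ n ω = (m : ℕ∞)} ∩ ({ω | Δ ≤ walk X k ω - walk X m ω} ∩
          ⋂ j ∈ Finset.Ico m k, {ω | walk X j ω - walk X m ω < Δ})) := by
      ext ω
      simp only [Set.mem_ofPred_eq, Set.mem_iUnion, Set.mem_inter_iff, Set.mem_iInter,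
        Finset.mem_range, Finset.mem_Ico, exists_prop]
      constructor
      · intro h
        obtain ⟨m, hm, hm'⟩ := exists_sampleTime_eq_of_succ h
        obtain ⟨-, h1, h2⟩ := (sampleTime_succ_eq_iff hm').1 h
        exact ⟨m, by omega, hm', h1, fun j hj => h2 j hj.1 hj.2⟩
      · rintro ⟨m, hm, hm', h1, h2⟩
        exact (sampleTime_succ_eq_iff hm').2 ⟨by omega, h1, fun j hj hj' => h2 j ⟨hj, hj'⟩⟩
    rw [this]
    refine Finset.measurableSet_biUnion _ fun m hm => ?_
    have hm' : m ≤ k := by have := Finset.mem_range.1 hm; omega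
    refine MeasurableSet.inter (past_mono X hm' _ (ih m)) (MeasurableSet.inter ?_ ?_)
    · exact ((hw k le_rfl).sub (hw m hm')) measurableSet_Ici
    · refine Finset.measurableSet_biInter _ fun j hj => ?_
      have hj' : j ≤ k := by have := Finset.mem_Ico.1 hj; omega
      exact ((hw j hj').sub (hw m hm')) measurableSet_Iio

lemma measurableSet_past_sampledBy (X : ℕ → Ω → ℝ) (Δ : ℝ) (n T : ℕ) :
    MeasurableSet[past X T] (sampledBy X Δ n T) := by
  have : sampledBy X Δ n T
      = ⋃ m ∈ Finset.range (T + 1), {ω | sampleTime X Δ n ω = (m : ℕ∞)} := by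
    ext ω
    simp [sampledBy]
  rw [this]
  refine Finset.measurableSet_biUnion _ fun m hm => ?_
  exact past_mono X (by have := Finset.mem_range.1 hm; omega) _
    (measurableSet_past_sampleTime X Δ n m)

variable [MeasurableSpace Ω]

lemma past_le (hX : ∀ i, Measurable (X i)) (n : ℕ) : past X n ≤ ‹MeasurableSpace Ω› :=
  iSup₂_le fun i _ => (hX i).comap_le

lemma measurable_walk (hX : ∀ i, Measurable (X i)) (n : ℕ) : Measurable (walk X n) :=
  (measurable_past_walk X n).mono (past_le hX n) le_rfl

lemma measurableSet_sampleTime (hX : ∀ i, Measurable (X i)) (Δ : ℝ) (n k : ℕ) :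
    MeasurableSet {ω | sampleTime X Δ n ω = (k : ℕ∞)} :=
  past_le hX k _ (measurableSet_past_sampleTime X Δ n k)

lemma measurableSet_sampledBy (hX : ∀ i, Measurable (X i)) (Δ : ℝ) (n T : ℕ) :
    MeasurableSet (sampledBy X Δ n T) :=
  past_le hX T _ (measurableSet_past_sampledBy X Δ n T)

lemma measurableSet_sampleTime_ne_top (hX : ∀ i, Measurable (X i)) (Δ : ℝ) (n : ℕ) :
    MeasurableSet {ω | sampleTime X Δ n ω ≠ ⊤} := by
  have : {ω | sampleTime X Δ n ω ≠ ⊤} = ⋃ k : ℕ, {ω | sampleTime X Δ n ω = (k : ℕ∞)} := by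
    ext ω
    simp only [Set.mem_ofPred_eq, Set.mem_iUnion, ENat.ne_top_iff_exists, eq_comm]
  rw [this]
  exact MeasurableSet.iUnion fun k => measurableSet_sampleTime hX Δ n k

lemma measurable_sampleTime_toNat (hX : ∀ i, Measurable (X i)) (Δ : ℝ) (n : ℕ) :
    Measurable fun ω => (sampleTime X Δ n ω).toNat := by
  refine measurable_to_countable' fun k => ?_
  rcases Nat.eq_zero_or_pos k with rfl | hk
  · have : (fun ω => (sampleTime X Δ n ω).toNat) ⁻¹' {0}
        = {ω | sampleTime X Δ n ω = ((0 : ℕ) : ℕ∞)} ∪ {ω | sampleTime X Δ n ω ≠ ⊤}ᶜ := by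
      ext ω
      simp [ENat.toNat_eq_zero]
    rw [this]
    exact (measurableSet_sampleTime hX Δ n 0).union
      (measurableSet_sampleTime_ne_top hX Δ n).compl
  · have : (fun ω => (sampleTime X Δ n ω).toNat) ⁻¹' {k}
        = {ω | sampleTime X Δ n ω = (k : ℕ∞)} := by
      ext ω
      simp [ENat.toNat_eq_iff hk.ne']
    rw [this]
    exact measurableSet_sampleTime hX Δ n k

lemma measurable_walk_comp (hX : ∀ i, Measurable (X i)) {T : Ω → ℕ} (hT : Measurable T) :
    Measurable fun ω => walk X (T ω) ω :=
  (measurable_from_prod_countable_right (f := fun p : ℕ × Ω => walk X p.1 p.2)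
    (measurable_walk hX)).comp (hT.prodMk measurable_id)

lemma measurable_overshoot (hX : ∀ i, Measurable (X i)) (Δ : ℝ) (n : ℕ) :
    Measurable (overshoot X Δ n) :=
  ((measurable_walk_comp hX (measurable_sampleTime_toNat hX Δ (n + 1))).sub
    (measurable_walk_comp hX (measurable_sampleTime_toNat hX Δ n))).sub_const Δ

lemma measurable_numSamples (hX : ∀ i, Measurable (X i)) {Δ : ℝ} (hΔ : 0 < Δ) (t : ℝ) :
    Measurable (numSamples X Δ t) := by
  rcases lt_or_ge t 0 with ht | ht
  · have : numSamples X Δ t = fun _ => 0 := by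
      ext ω
      exact numSamples_of_neg ht
    rw [this]
    exact measurable_const
  · refine measurable_of_Ici fun n => ?_
    have : numSamples X Δ t ⁻¹' Set.Ici n = sampledBy X Δ n ⌊t⌋₊ := by
      ext ω
      exact (mem_sampledBy_iff hΔ ht).symm
    rw [this]
    exact measurableSet_sampledBy hX Δ n _

lemma measurable_lastSampleTime (hX : ∀ i, Measurable (X i)) {Δ : ℝ} (hΔ : 0 < Δ) (t : ℝ) :
    Measurable (lastSampleTime X Δ t) := by
  have h : Measurable fun p : ℕ × Ω => ((sampleTime X Δ p.1 p.2).toNat : ℝ) :=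
    measurable_from_prod_countable_right fun n =>
      measurable_from_nat.comp (measurable_sampleTime_toNat hX Δ n)
  exact h.comp ((measurable_numSamples hX hΔ t).prodMk measurable_id)

end Measurability

/-! ### Wald's identity, Kolmogorov's inequality and the drawdown. -/

section Moments

variable {Ω : Type*} [MeasurableSpace Ω] {P : Measure Ω} {X : ℕ → Ω → ℝ} {ν : Measure ℝ}

lemma IsIID.memLp_walk (h : IsIID P X ν) (h2 : MemLp id 2 ν) (n : ℕ) : MemLp (walk X n) 2 P :=
  memLp_finsetSum _ fun i _ => h.memLp h2 i

variable [IsProbabilityMeasure P]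

/-- Wald's identity at a finite time: whether step `n` is taken depends only on the past, so it
contributes the drift times the probability of still moving. -/
lemma IsIID.integral_stoppedWalk (h : IsIID P X ν) (h1 : Integrable id ν) {D : Set ℝ}
    (hD : MeasurableSet D) (y : ℝ) (n : ℕ) :
    Integrable (stoppedWalk D X y n) P ∧ ∫ ω, stoppedWalk D X y n ω ∂P
      = y - (∫ x, x ∂ν) * ∑ s ∈ Finset.range n, P.real {ω | stoppedWalk D X y s ω ∈ D} := by
  classical
  induction n with
  | zero => exact ⟨integrable_const y, by simp [stoppedWalk]⟩
  | succ n ih =>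
    obtain ⟨i1, i2⟩ := ih
    set A : Set Ω := {ω | stoppedWalk D X y n ω ∈ D} with hA
    have hpast : MeasurableSet[past X n] A := measurable_past_stoppedWalk hD X y n hD
    have hAm : MeasurableSet A := h.past_le n _ hpast
    set I : Ω → ℝ := A.indicator 1 with hI
    have hIm : Measurable[past X n] I :=
      (@measurable_const _ _ _ (past X n) (1 : ℝ)).indicator hpast
    have hIm' : Measurable I := hIm.mono (h.past_le n) le_rfl
    have hind : IndepFun I (X n) P := h.indep_next n hIm
    have hXi : Integrable (X n) P := (h.integrable_comp n measurable_id).2 h1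
    have hIi : Integrable I P := (integrable_const (1 : ℝ)).indicator hAm
    have hprod : Integrable (fun ω => I ω * X n ω) P := hind.integrable_mul hIi hXi
    have e : stoppedWalk D X y (n + 1) = fun ω => stoppedWalk D X y n ω - I ω * X n ω := by
      ext ω
      rw [stoppedWalk]
      by_cases hω : stoppedWalk D X y n ω ∈ D
      · rw [if_pos hω, hI, Set.indicator_of_mem (show ω ∈ A from hω)]; simp
      · rw [if_neg hω, hI, Set.indicator_of_notMem (show ω ∉ A from hω)]; simp
    refine ⟨by rw [e]; exact i1.sub hprod, ?_⟩
    rw [e, integral_sub i1 hprod, i2, hind.integral_fun_mul_eq_mul_integral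
      hIm'.aestronglyMeasurable (h.meas n).aestronglyMeasurable, Finset.sum_range_succ,
      show ∫ ω, X n ω ∂P = ∫ x, x ∂ν from h.integral_comp n measurable_id,
      show ∫ ω, I ω ∂P = P.real A from integral_indicator_one hAm]
    ring

/-- A centered step adds exactly its second moment to the mean of the square, and a frozen walk adds
nothing. -/
lemma IsIID.lintegral_stoppedWalk_sq_le (h : IsIID P X ν) (h2 : MemLp id 2 ν)
    (h0 : ∫ x, x ∂ν = 0) {D : Set ℝ} (hD : MeasurableSet D) (n : ℕ) :
    ∫⁻ ω, ENNReal.ofReal (stoppedWalk D X 0 n ω ^ 2) ∂P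
      ≤ ENNReal.ofReal (n * ∫ x, x ^ 2 ∂ν) := by
  have := h.isProbabilityMeasure
  have h1 : Integrable (fun x : ℝ => x) ν := h2.integrable (by norm_num)
  have hs : Integrable (fun x : ℝ => x ^ 2) ν := h2.integrable_sq
  set v := ∫ x, x ^ 2 ∂ν with hv
  have hv0 : 0 ≤ v := integral_nonneg fun x => sq_nonneg x
  have key : ∀ n : ℕ, (stepOp D ν)^[n] (fun z => ENNReal.ofReal (z ^ 2))
      ≤ fun z => ENNReal.ofReal (z ^ 2 + n * v) := by
    intro n
    induction n with
    | zero => intro z; simp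
    | succ n ih =>
      rw [Function.iterate_succ_apply']
      refine (stepOp_mono ih).trans fun z => ?_
      by_cases hz : z ∈ D
      · rw [stepOp_of_mem hz]
        have i1 : Integrable (fun x : ℝ => z ^ 2 - 2 * z * x) ν :=
          (integrable_const _).sub (h1.const_mul _)
        have i2 : Integrable (fun x : ℝ => z ^ 2 - 2 * z * x + x ^ 2) ν := i1.add hs
        have e : ∀ x : ℝ, (z - x) ^ 2 + n * v = z ^ 2 - 2 * z * x + x ^ 2 + n * v := fun x => by
          ring
        simp only [e]
        have i3 : Integrable (fun x : ℝ => z ^ 2 - 2 * z * x + x ^ 2 + n * v) ν :=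
          i2.add (integrable_const _)
        rw [← ofReal_integral_eq_lintegral_ofReal i3 (Eventually.of_forall fun x => by
            change 0 ≤ z ^ 2 - 2 * z * x + x ^ 2 + n * v
            rw [← e]; positivity)]
        refine ENNReal.ofReal_le_ofReal (le_of_eq ?_)
        rw [integral_add i2 (integrable_const _), integral_add i1 hs,
          integral_sub (integrable_const _) (h1.const_mul _), integral_const_mul, h0]
        simp only [integral_const, probReal_univ, one_smul]
        push_cast
        ring
      · rw [stepOp_of_notMem hz]
        refine ENNReal.ofReal_le_ofReal ?_
        push_cast
        linarith
  rw [h.lintegral_stoppedWalk hD (f := fun z => ENNReal.ofReal (z ^ 2)) (by fun_prop) 0 n]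
  simpa using key n 0

lemma walk_sub_const {Ω : Type*} (X : ℕ → Ω → ℝ) (m : ℝ) (n : ℕ) (ω : Ω) :
    walk (fun i ω => X i ω - m) n ω = walk X n ω - n * m := by
  simp [walk, Finset.sum_sub_distrib]

/-- The centered variables, their mean and their second moment. -/
lemma IsIID.center (h : IsIID P X ν) (h2 : MemLp id 2 ν) :
    IsIID P (fun i ω => X i ω - ∫ x, x ∂ν) (ν.map (· - ∫ x, x ∂ν)) ∧
    MemLp id 2 (ν.map (· - ∫ x, x ∂ν)) ∧ ∫ x, x ∂(ν.map (· - ∫ x, x ∂ν)) = 0 ∧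
    ∫ x, x ^ 2 ∂(ν.map (· - ∫ x, x ∂ν)) = ∫ x, (x - ∫ z, z ∂ν) ^ 2 ∂ν := by
  have := h.isProbabilityMeasure
  have h1 : Integrable (fun x : ℝ => x) ν := h2.integrable (by norm_num)
  have hm : Measurable fun x : ℝ => x - ∫ z, z ∂ν := measurable_id.sub_const _
  refine ⟨h.comp hm, ?_, ?_, ?_⟩
  · rw [memLp_map_measure_iff aestronglyMeasurable_id hm.aemeasurable]
    exact h2.sub (memLp_const _)
  · rw [integral_map hm.aemeasurable (by fun_prop), integral_sub h1 (integrable_const _)]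
    simp
  · rw [integral_map hm.aemeasurable (by fun_prop)]

/-- Kolmogorov's maximal inequality. -/
lemma IsIID.measureReal_exists_le_abs_walk_sub (h : IsIID P X ν) (h2 : MemLp id 2 ν) {K : ℝ}
    (hK : 0 < K) (n : ℕ) :
    P.real {ω | ∃ j ≤ n, K ≤ |walk X j ω - j * ∫ x, x ∂ν|}
      ≤ n * (∫ x, (x - ∫ z, z ∂ν) ^ 2 ∂ν) / K ^ 2 := by
  obtain ⟨hc, hc2, hc0, hcv⟩ := h.center h2
  set Y : ℕ → Ω → ℝ := fun i ω => X i ω - ∫ x, x ∂ν with hY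
  set D : Set ℝ := Set.Ioo (-K) K with hDdef
  have hD : MeasurableSet D := measurableSet_Ioo
  have hv0 : 0 ≤ ∫ x, (x - ∫ z, z ∂ν) ^ 2 ∂ν := integral_nonneg fun x => sq_nonneg _
  have hle := hc.lintegral_stoppedWalk_sq_le hc2 hc0 hD n
  rw [hcv] at hle
  -- Stopping at the exit from `(-K, K)` preserves a large deviation until time `n`, so Markov's
  -- inequality at the single time `n` controls the maximum.
  have hsub : {ω | ∃ j ≤ n, K ≤ |walk X j ω - j * ∫ x, x ∂ν|} ⊆
      {ω | ENNReal.ofReal (K ^ 2) ≤ ENNReal.ofReal (stoppedWalk D Y 0 n ω ^ 2)} := by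
    rintro ω ⟨j, hj, hj'⟩
    have hnot : stoppedWalk D Y 0 n ω ∉ D := fun hcon => by
      have := stoppedWalk_mem_iff.1 hcon j hj
      rw [hDdef, Set.mem_Ioo, ← abs_lt, zero_sub, abs_neg, hY, walk_sub_const] at this
      exact absurd hj' (not_le.2 this)
    rw [hDdef, Set.mem_Ioo, ← abs_lt, not_lt] at hnot
    refine ENNReal.ofReal_le_ofReal ?_
    rw [← sq_abs (stoppedWalk D Y 0 n ω)]
    gcongr
  have hmark := mul_meas_ge_le_lintegral (μ := P)
    (f := fun ω => ENNReal.ofReal (stoppedWalk D Y 0 n ω ^ 2))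
    ((hc.measurable_stoppedWalk hD 0 n).pow_const 2).ennreal_ofReal (ENNReal.ofReal (K ^ 2))
  have hfin : ENNReal.ofReal (K ^ 2) * P {ω | ∃ j ≤ n, K ≤ |walk X j ω - j * ∫ x, x ∂ν|}
      ≤ ENNReal.ofReal (n * ∫ x, (x - ∫ z, z ∂ν) ^ 2 ∂ν) :=
    ((mul_le_mul_right (measure_mono hsub) _).trans hmark).trans hle
  rw [le_div_iff₀ (by positivity), mul_comm]
  have := ENNReal.toReal_mono ENNReal.ofReal_ne_top hfin
  rwa [ENNReal.toReal_mul, ENNReal.toReal_ofReal (by positivity),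
    ENNReal.toReal_ofReal (by positivity)] at this

/-- The second moment bound with `D = univ`, where the walk never stops, followed by the
Cauchy–Schwarz inequality in the form of a nonnegative variance. -/
lemma IsIID.integral_abs_walk_sub_le (h : IsIID P X ν) (h2 : MemLp id 2 ν) (n : ℕ) :
    ∫ ω, |walk X n ω - n * ∫ x, x ∂ν| ∂P
      ≤ √(n * ∫ x, (x - ∫ z, z ∂ν) ^ 2 ∂ν) := by
  obtain ⟨hc, hc2, hc0, hcv⟩ := h.center h2
  have hle := hc.lintegral_stoppedWalk_sq_le hc2 hc0 MeasurableSet.univ n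
  have hv0 : 0 ≤ ∫ x, (x - ∫ z, z ∂ν) ^ 2 ∂ν := integral_nonneg fun x => sq_nonneg _
  have hL : MemLp (fun ω => walk X n ω - n * ∫ x, x ∂ν) 2 P :=
    (h.memLp_walk h2 n).sub (memLp_const _)
  have hsq : ∫ ω, (walk X n ω - n * ∫ x, x ∂ν) ^ 2 ∂P
      ≤ n * ∫ x, (x - ∫ z, z ∂ν) ^ 2 ∂ν := by
    have e : ∀ ω, stoppedWalk Set.univ (fun i ω => X i ω - ∫ x, x ∂ν) 0 n ω ^ 2
        = (walk X n ω - n * ∫ x, x ∂ν) ^ 2 := fun ω => by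
      rw [stoppedWalk_eq fun _ _ => Set.mem_univ _, walk_sub_const]; ring
    simp only [e, hcv] at hle
    rw [← ofReal_integral_eq_lintegral_ofReal hL.integrable_sq
      (Eventually.of_forall fun _ => sq_nonneg _)] at hle
    exact (ENNReal.ofReal_le_ofReal_iff (by positivity)).1 hle
  refine Real.le_sqrt_of_sq_le (le_trans ?_ hsq)
  have hv := variance_nonneg (fun ω => |walk X n ω - n * ∫ x, x ∂ν|) P
  have habs : MemLp (fun ω => |walk X n ω - n * ∫ x, x ∂ν|) 2 P := hL.abs
  rw [variance_eq_sub habs] at hv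
  simp only [Pi.pow_apply, sq_abs] at hv
  linarith

/-! ### The drawdown of the walk -/

/-- The drawdown `max_{s ≤ n} S_s - S_n`. -/
noncomputable def drawdown {Ω : Type*} (X : ℕ → Ω → ℝ) : ℕ → Ω → ℝ
  | 0, _ => 0
  | n + 1, ω => max (drawdown X n ω - X n ω) 0

lemma drawdown_nonneg {Ω : Type*} (X : ℕ → Ω → ℝ) (n : ℕ) (ω : Ω) : 0 ≤ drawdown X n ω := by
  cases n with
  | zero => exact le_rfl
  | succ n => exact le_max_right _ _

lemma walk_sub_le_drawdown {Ω : Type*} (X : ℕ → Ω → ℝ) (ω : Ω) {s n : ℕ} (hsn : s ≤ n) :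
    walk X s ω - walk X n ω ≤ drawdown X n ω := by
  induction n, hsn using Nat.le_induction with
  | base => rw [sub_self]; exact drawdown_nonneg X s ω
  | succ n _ ih =>
    rw [walk_succ, drawdown]
    exact le_trans (by linarith) (le_max_left _ _)

/-- Forgetting the first step removes one candidate from the running maximum. With stationarity,
this makes the second moment of the drawdown nondecreasing in `n`. -/
lemma drawdown_shift_le {Ω : Type*} (X : ℕ → Ω → ℝ) (n : ℕ) (ω : Ω) :
    drawdown (fun i => X (1 + i)) n ω ≤ drawdown X (n + 1) ω := by
  induction n with
  | zero => exact drawdown_nonneg X 1 ω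
  | succ n ih =>
    rw [drawdown, drawdown, add_comm 1 n]
    exact max_le_max (by linarith) le_rfl

lemma drawdown_path {Ω : Type*} (X : ℕ → Ω → ℝ) (n : ℕ) (ω : Ω) :
    drawdown X n ω = drawdown (fun i (x : ℕ → ℝ) => x i) n (fun i => X i ω) := by
  induction n with
  | zero => rfl
  | succ n ih => rw [drawdown, drawdown, ih]

lemma measurable_past_drawdown {Ω : Type*} (X : ℕ → Ω → ℝ) (n : ℕ) : Measurable[past X n] (drawdown X n) := by
  induction n with
  | zero => exact @measurable_const _ _ _ (past X 0) 0
  | succ n ih =>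
    have ih' : Measurable[past X (n + 1)] (drawdown X n) :=
      ih.mono (past_mono X n.le_succ) le_rfl
    exact Measurable.max (ih'.sub (measurable_past X n.lt_succ_self))
      (@measurable_const _ _ _ (past X (n + 1)) 0)

lemma measurable_drawdown (hX : ∀ i, Measurable (X i)) (n : ℕ) : Measurable (drawdown X n) :=
  (measurable_past_drawdown X n).mono (past_le hX n) le_rfl

lemma IsIID.memLp_drawdown (h : IsIID P X ν) (h2 : MemLp id 2 ν) (n : ℕ) :
    MemLp (drawdown X n) 2 P := by
  induction n with
  | zero => exact memLp_const 0
  | succ n ih => exact (ih.sub (h.memLp h2 n)).pos_part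

/-- The mean drawdown of a walk with positive drift is bounded. -/
lemma IsIID.integral_drawdown_le (h : IsIID P X ν) (h2 : MemLp id 2 ν) (hμ : 0 < ∫ x, x ∂ν)
    (n : ℕ) : ∫ ω, drawdown X n ω ∂P ≤ (∫ x, x ^ 2 ∂ν) / (2 * ∫ x, x ∂ν) := by
  have hW := h.memLp_drawdown h2
  have hX2 := h.memLp h2 n
  have hXi : Integrable (X n) P := hX2.integrable (by norm_num)
  have hWi : Integrable (drawdown X n) P := (hW n).integrable (by norm_num)
  have hind : IndepFun (drawdown X n) (X n) P := h.indep_next n (measurable_past_drawdown X n)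
  have hprod : Integrable (fun ω => drawdown X n ω * X n ω) P := hind.integrable_mul hWi hXi
  have e1 : ∫ ω, X n ω ∂P = ∫ x, x ∂ν := h.integral_comp n measurable_id
  have e2 : ∫ ω, X n ω ^ 2 ∂P = ∫ x, x ^ 2 ∂ν :=
    h.integral_comp n (f := fun x => x ^ 2) (by fun_prop)
  have i4 : Integrable (fun ω => drawdown X n ω ^ 2 - 2 * (drawdown X n ω * X n ω)) P :=
    (hW n).integrable_sq.sub (hprod.const_mul 2)
  -- Squaring the recursion makes the mean drawdown appear with the negative factor `-2 μ`. As the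
  -- second moment does not decrease in `n`, the mean is bounded.
  have hexp : ∫ ω, drawdown X (n + 1) ω ^ 2 ∂P ≤ ∫ ω, drawdown X n ω ^ 2 ∂P
      - 2 * ((∫ ω, drawdown X n ω ∂P) * ∫ x, x ∂ν) + ∫ x, x ^ 2 ∂ν := by
    rw [← e2, ← e1, ← hind.integral_fun_mul_eq_mul_integral hWi.aestronglyMeasurable
      hXi.aestronglyMeasurable, ← integral_const_mul, ← integral_sub (hW n).integrable_sq
      (hprod.const_mul 2), ← integral_add i4 hX2.integrable_sq]
    refine integral_mono (hW (n + 1)).integrable_sq (i4.add hX2.integrable_sq) fun ω => ?_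
    simp only [drawdown]
    rcases max_cases (drawdown X n ω - X n ω) 0 with ⟨hm, _⟩ | ⟨hm, _⟩
    · rw [hm]; exact le_of_eq (by ring)
    · rw [hm]; nlinarith [sq_nonneg (drawdown X n ω - X n ω)]
  have hshift : ∫ ω, drawdown (fun i => X (1 + i)) n ω ^ 2 ∂P = ∫ ω, drawdown X n ω ^ 2 ∂P := by
    have hF : Measurable fun x : ℕ → ℝ => drawdown (fun i (x : ℕ → ℝ) => x i) n x ^ 2 :=
      (measurable_drawdown (fun i => measurable_pi_apply i) n).pow_const 2
    have a1 := integral_map (μ := P) h.measurable_path.aemeasurable hF.aestronglyMeasurable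
    have a2 := integral_map (μ := P) (h.shift 1).measurable_path.aemeasurable
      hF.aestronglyMeasurable
    rw [h.map_path_shift, a1] at a2
    simp only [← drawdown_path] at a2
    exact a2.symm
  have hmono : ∫ ω, drawdown X n ω ^ 2 ∂P ≤ ∫ ω, drawdown X (n + 1) ω ^ 2 ∂P := by
    rw [← hshift]
    refine integral_mono ((h.shift 1).memLp_drawdown h2 n).integrable_sq
      (hW (n + 1)).integrable_sq fun ω => ?_
    exact pow_le_pow_left₀ (drawdown_nonneg _ n ω) (drawdown_shift_le X n ω) 2
  rw [le_div_iff₀ (by positivity)]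
  linarith

end Moments

/-! ### Means of the first sampling time and of the overshoots. -/

section Sampling

variable {Ω : Type*} [MeasurableSpace Ω] {P : Measure Ω} {X : ℕ → Ω → ℝ}
  {ν : Measure ℝ} {Δ C : ℝ}

lemma IsIID.measurableSet_lt_sampleTime_one (h : IsIID P X ν) (Δ : ℝ) (n : ℕ) :
    MeasurableSet {ω | (n : ℕ∞) < sampleTime X Δ 1 ω} := by
  simp only [lt_sampleTime_one_iff]
  exact h.measurable_stoppedWalk measurableSet_Ioi Δ n measurableSet_Ioi

lemma IsIID.lintegral_sampleTime_one (h : IsIID P X ν)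
    (hfin : ∀ᵐ ω ∂P, sampleTime X Δ 1 ω ≠ ⊤) :
    ∫⁻ ω, ((sampleTime X Δ 1 ω).toNat : ℝ≥0∞) ∂P
      = ∑' s : ℕ, P {ω | (s : ℕ∞) < sampleTime X Δ 1 ω} := by
  have e : ∀ s : ℕ, P {ω | (s : ℕ∞) < sampleTime X Δ 1 ω}
      = ∫⁻ ω, {ω | (s : ℕ∞) < sampleTime X Δ 1 ω}.indicator (fun _ => (1 : ℝ≥0∞)) ω ∂P :=
    fun s => (lintegral_indicator_one (h.measurableSet_lt_sampleTime_one Δ s)).symm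
  simp only [e]
  rw [← lintegral_tsum fun s => (measurable_const.indicator
    (h.measurableSet_lt_sampleTime_one Δ s)).aemeasurable]
  refine lintegral_congr_ae ?_
  filter_upwards [hfin] with ω hω
  obtain ⟨k, hk⟩ := ENat.ne_top_iff_exists.1 hω
  simp only [Set.indicator_apply, Set.mem_ofPred_eq, ← hk, ENat.toNat_natCast, Nat.cast_lt]
  rw [tsum_eq_sum (s := Finset.range k) fun s hs => if_neg (by simpa using hs)]
  rw [Finset.sum_congr rfl fun s hs => if_pos (Finset.mem_range.1 hs)]
  simp

variable [IsProbabilityMeasure P]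

/-- By Wald's identity the sum times `μ` is `Δ` minus the mean of the stopped walk, which is at
least `-C` by the overshoot bound. -/
lemma IsIID.sum_measureReal_lt_sampleTime_one_le (h : IsIID P X ν) (h2 : MemLp id 2 ν)
    (hμ : 0 < ∫ x, x ∂ν) (hC0 : 0 ≤ C)
    (hC : ∀ y, 0 < y → ∀ n, meanOvershootUpTo ν n y ≤ ENNReal.ofReal C) (hΔ : 0 < Δ) (n : ℕ) :
    ∑ s ∈ Finset.range n, P.real {ω | (s : ℕ∞) < sampleTime X Δ 1 ω}
      ≤ (Δ + C) / ∫ x, x ∂ν := by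
  have hpr := h.isProbabilityMeasure
  have h1 : Integrable id ν := h2.integrable (by norm_num)
  obtain ⟨i1, i2⟩ := h.integral_stoppedWalk h1 (measurableSet_Ioi (a := (0 : ℝ))) Δ n
  have e : ∀ s : ℕ, {ω | stoppedWalk (Set.Ioi 0) X Δ s ω ∈ Set.Ioi (0 : ℝ)}
      = {ω | (s : ℕ∞) < sampleTime X Δ 1 ω} := fun s => by
    ext ω; exact lt_sampleTime_one_iff.symm
  simp only [e] at i2
  have hlow : -C ≤ ∫ ω, stoppedWalk (Set.Ioi 0) X Δ n ω ∂P := by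
    have hle := hC Δ hΔ n
    rw [meanOvershootUpTo, ← h.lintegral_stoppedWalk measurableSet_Ioi (by fun_prop)] at hle
    have i3 : Integrable (fun ω => max (-stoppedWalk (Set.Ioi 0) X Δ n ω) 0) P := i1.neg.pos_part
    have h3 : ∫ ω, max (-stoppedWalk (Set.Ioi 0) X Δ n ω) 0 ∂P ≤ C := by
      rw [← ENNReal.ofReal_le_ofReal_iff hC0, ofReal_integral_eq_lintegral_ofReal i3
        (Eventually.of_forall fun _ => le_max_right _ _)]
      refine le_trans (lintegral_mono fun ω => ?_) hle
      rw [ENNReal.ofReal_max]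
      simp
    have h4 : ∫ ω, -stoppedWalk (Set.Ioi 0) X Δ n ω ∂P
        ≤ ∫ ω, max (-stoppedWalk (Set.Ioi 0) X Δ n ω) 0 ∂P :=
      integral_mono i1.neg i3 fun ω => le_max_left _ _
    rw [integral_neg] at h4
    linarith
  rw [le_div_iff₀ hμ]
  linarith

lemma IsIID.tsum_measure_lt_sampleTime_one_le (h : IsIID P X ν) (h2 : MemLp id 2 ν)
    (hμ : 0 < ∫ x, x ∂ν) (hC0 : 0 ≤ C)
    (hC : ∀ y, 0 < y → ∀ n, meanOvershootUpTo ν n y ≤ ENNReal.ofReal C) (hΔ : 0 < Δ) :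
    ∑' s : ℕ, P {ω | (s : ℕ∞) < sampleTime X Δ 1 ω} ≤ ENNReal.ofReal ((Δ + C) / ∫ x, x ∂ν) := by
  refine ENNReal.tsum_le_of_sum_range_le fun n => ?_
  have := h.sum_measureReal_lt_sampleTime_one_le h2 hμ hC0 hC hΔ n
  refine le_trans (le_of_eq ?_) (ENNReal.ofReal_le_ofReal this)
  rw [ENNReal.ofReal_sum_of_nonneg fun _ _ => measureReal_nonneg]
  exact Finset.sum_congr rfl fun s _ => (ofReal_measureReal).symm

lemma IsIID.tendsto_measure_lt_sampleTime_one (h : IsIID P X ν) (h2 : MemLp id 2 ν)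
    (hμ : 0 < ∫ x, x ∂ν) (hC0 : 0 ≤ C)
    (hC : ∀ y, 0 < y → ∀ n, meanOvershootUpTo ν n y ≤ ENNReal.ofReal C) (hΔ : 0 < Δ) :
    Tendsto (fun s : ℕ => P {ω | (s : ℕ∞) < sampleTime X Δ 1 ω}) atTop (𝓝 0) :=
  ENNReal.tendsto_atTop_zero_of_tsum_ne_top
    (ne_top_of_le_ne_top ENNReal.ofReal_ne_top
      (h.tsum_measure_lt_sampleTime_one_le h2 hμ hC0 hC hΔ))

lemma IsIID.ae_sampleTime_one_ne_top (h : IsIID P X ν) (h2 : MemLp id 2 ν)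
    (hμ : 0 < ∫ x, x ∂ν) (hC0 : 0 ≤ C)
    (hC : ∀ y, 0 < y → ∀ n, meanOvershootUpTo ν n y ≤ ENNReal.ofReal C) (hΔ : 0 < Δ) :
    ∀ᵐ ω ∂P, sampleTime X Δ 1 ω ≠ ⊤ := by
  rw [ae_iff]
  refine le_antisymm (ge_of_tendsto' (h.tendsto_measure_lt_sampleTime_one h2 hμ hC0 hC hΔ)
    fun n => measure_mono fun ω hω => ?_) bot_le
  have hω' : sampleTime X Δ 1 ω = ⊤ := by simpa using hω
  simp [hω']

lemma IsIID.integrable_sampleTime_one (h : IsIID P X ν) (h2 : MemLp id 2 ν)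
    (hμ : 0 < ∫ x, x ∂ν) (hC0 : 0 ≤ C)
    (hC : ∀ y, 0 < y → ∀ n, meanOvershootUpTo ν n y ≤ ENNReal.ofReal C) (hΔ : 0 < Δ) :
    Integrable (fun ω => ((sampleTime X Δ 1 ω).toNat : ℝ)) P ∧
      period P X Δ * (∫ x, x ∂ν) ≤ Δ + C := by
  have hfin := h.ae_sampleTime_one_ne_top h2 hμ hC0 hC hΔ
  have hle := h.tsum_measure_lt_sampleTime_one_le h2 hμ hC0 hC hΔ
  rw [← h.lintegral_sampleTime_one hfin] at hle
  have hm : Measurable fun ω => ((sampleTime X Δ 1 ω).toNat : ℝ) :=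
    measurable_from_nat.comp (measurable_sampleTime_toNat h.meas Δ 1)
  have e : ∀ ω, ENNReal.ofReal ((sampleTime X Δ 1 ω).toNat : ℝ)
      = ((sampleTime X Δ 1 ω).toNat : ℝ≥0∞) := fun ω => ENNReal.ofReal_natCast _
  have hi : Integrable (fun ω => ((sampleTime X Δ 1 ω).toNat : ℝ)) P := by
    refine ⟨hm.aestronglyMeasurable, ?_⟩
    rw [hasFiniteIntegral_iff_ofReal (Eventually.of_forall fun ω => Nat.cast_nonneg _)]
    simp only [e]
    exact lt_of_le_of_lt hle ENNReal.ofReal_lt_top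
  refine ⟨hi, ?_⟩
  rw [← le_div_iff₀ hμ, ← ENNReal.ofReal_le_ofReal_iff (by positivity), period,
    ofReal_integral_eq_lintegral_ofReal hi (Eventually.of_forall fun ω => Nat.cast_nonneg _)]
  simpa only [e] using hle

/-- The period is at least of the order of the threshold. -/
lemma IsIID.threshold_le_period (h : IsIID P X ν) (h2 : MemLp id 2 ν) (hμ : 0 < ∫ x, x ∂ν)
    (hi : Integrable (fun ω => ((sampleTime X Δ 1 ω).toNat : ℝ)) P)
    (hfin : ∀ᵐ ω ∂P, sampleTime X Δ 1 ω ≠ ⊤) (hΔ : 0 < Δ) :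
    Δ ≤ 4 * (∫ x, x ∂ν) * period P X Δ
      + 4 * (∫ x, (x - ∫ z, z ∂ν) ^ 2 ∂ν) / ∫ x, x ∂ν := by
  set μ := ∫ x, x ∂ν with hμdef
  set v := ∫ x, (x - μ) ^ 2 ∂ν with hv
  have hv0 : 0 ≤ v := integral_nonneg fun x => sq_nonneg _
  have hper0 : 0 ≤ period P X Δ := integral_nonneg fun ω => Nat.cast_nonneg _
  by_cases hsmall : Δ ≤ 4 * v / μ
  · have : 0 ≤ 4 * μ * period P X Δ := by positivity
    linarith
  push Not at hsmall
  rw [div_lt_iff₀ hμ] at hsmall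
  -- By time `m` the drift covers at most half of `Δ`, so sampling by then needs a deviation of `Δ /
  -- 2`. Its probability is at most `1 / 2` because `Δ > 4 * v / μ`.
  set m := ⌊Δ / (2 * μ)⌋₊ with hm
  have hm1 : (m : ℝ) ≤ Δ / (2 * μ) := Nat.floor_le (by positivity)
  have hm2 : Δ / (2 * μ) < m + 1 := Nat.lt_floor_add_one _
  rw [le_div_iff₀ (by positivity)] at hm1
  rw [div_lt_iff₀ (by positivity)] at hm2
  set A : Set Ω := {ω | (m : ℕ∞) < sampleTime X Δ 1 ω} with hA
  have hAm : MeasurableSet A := h.measurableSet_lt_sampleTime_one Δ m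
  have hcompl : P.real Aᶜ ≤ 1 / 2 := by
    have hsub : Aᶜ ⊆ {ω | ∃ j ≤ m, Δ / 2 ≤ |walk X j ω - j * μ|} := by
      intro ω hω
      have hω' : sampleTime X Δ 1 ω ≤ (m : ℕ∞) := not_lt.1 hω
      obtain ⟨k, hk⟩ := ENat.ne_top_iff_exists.1
        (ne_top_of_le_ne_top (ENat.natCast_ne_top m) hω')
      have hkm : k ≤ m := by rw [← hk] at hω'; exact_mod_cast hω'
      refine ⟨k, hkm, le_trans ?_ (le_abs_self _)⟩
      have := (sampleTime_one_eq_iff.1 hk.symm).1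
      have hkm' : (k : ℝ) ≤ m := by exact_mod_cast hkm
      nlinarith
    refine (measureReal_mono hsub).trans
      ((h.measureReal_exists_le_abs_walk_sub h2 (by positivity) m).trans ?_)
    rw [div_le_iff₀ (by positivity)]
    rw [← hv]
    nlinarith
  have hAr : 1 / 2 ≤ P.real A := by
    rw [measureReal_compl hAm, probReal_univ] at hcompl
    linarith
  have hper : (m + 1) * P.real A ≤ period P X Δ := by
    rw [period, ← smul_eq_mul, smul_eq_mul, mul_comm, ← smul_eq_mul,
      ← setIntegral_const (μ := P) (s := A) ((m : ℝ) + 1), ← integral_indicator hAm]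
    refine integral_mono_ae ((integrable_const _).indicator hAm) hi ?_
    filter_upwards [hfin] with ω hω
    by_cases hωA : ω ∈ A
    · rw [Set.indicator_of_mem hωA]
      obtain ⟨k, hk⟩ := ENat.ne_top_iff_exists.1 hω
      have hlt : (m : ℕ∞) < sampleTime X Δ 1 ω := hωA
      rw [← hk, Nat.cast_lt] at hlt
      rw [← hk, ENat.toNat_natCast]
      exact_mod_cast hlt
    · rw [Set.indicator_of_notMem hωA]
      exact Nat.cast_nonneg _
  have hfinal : (m + 1 : ℝ) / 2 ≤ period P X Δ := by
    have : (m + 1 : ℝ) / 2 ≤ (m + 1) * P.real A := by nlinarith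
    linarith
  have : 0 ≤ 4 * v / μ := by positivity
  nlinarith

/-- Monotone convergence: the negative part of the stopped walk is zero before `τ_1` and equals the
overshoot from then on. -/
lemma IsIID.lintegral_overshoot (h : IsIID P X ν)
    (hfin : ∀ᵐ ω ∂P, sampleTime X Δ 1 ω ≠ ⊤) :
    ∫⁻ ω, ENNReal.ofReal (overshoot X Δ 0 ω) ∂P = ⨆ n, meanOvershootUpTo ν n Δ := by
  have hf : Measurable fun z : ℝ => ENNReal.ofReal (-z) := by fun_prop
  have e : ∀ n, meanOvershootUpTo ν n Δ
      = ∫⁻ ω, ENNReal.ofReal (-stoppedWalk (Set.Ioi 0) X Δ n ω) ∂P := fun n =>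
    (h.lintegral_stoppedWalk measurableSet_Ioi hf Δ n).symm
  simp only [e]
  rw [← lintegral_iSup (f := fun n ω => ENNReal.ofReal (-stoppedWalk (Set.Ioi 0) X Δ n ω))
    fun n => hf.comp (h.measurable_stoppedWalk measurableSet_Ioi Δ n)]
  · refine lintegral_congr_ae ?_
    filter_upwards [hfin] with ω hω
    obtain ⟨k, hk⟩ := ENat.ne_top_iff_exists.1 hω
    refine le_antisymm ?_ (iSup_le fun n => ?_)
    · refine le_iSup_of_le k ?_
      rw [stoppedWalk_eq_neg_overshoot hk.symm le_rfl, neg_neg]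
    · rcases le_or_gt k n with hkn | hkn
      · rw [stoppedWalk_eq_neg_overshoot hk.symm hkn, neg_neg]
      · have : 0 < stoppedWalk (Set.Ioi 0) X Δ n ω := by
          rw [← lt_sampleTime_one_iff, ← hk]; exact_mod_cast hkn
        rw [ENNReal.ofReal_of_nonpos (by linarith)]
        exact bot_le
  · refine monotone_nat_of_le_succ fun n ω => ?_
    by_cases hn : stoppedWalk (Set.Ioi 0) X Δ n ω ∈ Set.Ioi (0 : ℝ)
    · rw [ENNReal.ofReal_of_nonpos (by have : 0 < stoppedWalk (Set.Ioi 0) X Δ n ω := hn; linarith)]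
      exact bot_le
    · rw [stoppedWalk_of_notMem hn n.le_succ]

lemma IsIID.integrable_overshoot (h : IsIID P X ν) (h2 : MemLp id 2 ν)
    (hμ : 0 < ∫ x, x ∂ν) (hC0 : 0 ≤ C)
    (hC : ∀ y, 0 < y → ∀ n, meanOvershootUpTo ν n y ≤ ENNReal.ofReal C) (hΔ : 0 < Δ) :
    Integrable (overshoot X Δ 0) P ∧ 0 ≤ meanOvershoot P X Δ ∧ meanOvershoot P X Δ ≤ C ∧
      ENNReal.ofReal (meanOvershoot P X Δ) = ⨆ n, meanOvershootUpTo ν n Δ := by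
  have hfin := h.ae_sampleTime_one_ne_top h2 hμ hC0 hC hΔ
  have hlin := h.lintegral_overshoot hfin
  have h0 : 0 ≤ᵐ[P] overshoot X Δ 0 := by
    filter_upwards [hfin] with ω hω using overshoot_nonneg hω
  have hle : ⨆ n, meanOvershootUpTo ν n Δ ≤ ENNReal.ofReal C := iSup_le fun n => hC Δ hΔ n
  have hi : Integrable (overshoot X Δ 0) P := by
    refine ⟨(measurable_overshoot h.meas Δ 0).aestronglyMeasurable, ?_⟩
    rw [hasFiniteIntegral_iff_ofReal h0, hlin]
    exact lt_of_le_of_lt hle ENNReal.ofReal_lt_top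
  have e : ENNReal.ofReal (meanOvershoot P X Δ) = ⨆ n, meanOvershootUpTo ν n Δ := by
    rw [← hlin, meanOvershoot, ofReal_integral_eq_lintegral_ofReal hi h0]
  refine ⟨hi, integral_nonneg_of_ae h0, ?_, e⟩
  rw [← ENNReal.ofReal_le_ofReal_iff hC0, e]
  exact hle

/-- If the law of the steps is not upward skip-free, the mean overshoot is bounded below. -/
lemma IsIID.exists_le_meanOvershoot (h : IsIID P X ν) (h2 : MemLp id 2 ν)
    (hμ : 0 < ∫ x, x ∂ν) (hC0 : 0 ≤ C)
    (hC : ∀ y, 0 < y → ∀ n, meanOvershootUpTo ν n y ≤ ENNReal.ofReal C)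
    (hsf : ∀ d : ℝ, 0 < d → ¬ ∀ᵐ x ∂ν, ∃ k : ℤ, k ≤ 1 ∧ x = k * d) :
    ∃ c Δ₀ : ℝ, 0 < c ∧ ∀ Δ, Δ₀ < Δ → 0 < Δ → c ≤ meanOvershoot P X Δ := by
  have hpr := h.isProbabilityMeasure
  obtain ⟨L₁, hL₁, hwin⟩ := exists_window hμ hsf
  -- The walk is first run to the lower threshold `Δ - 2 * L`. By Markov's inequality it overshoots
  -- this by more than `L` with probability at most `1 / 4`. Otherwise, once the lower threshold is
  -- passed, the remaining distance to `Δ` lies in the window `[L, 2 * L]`.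
  set L := max L₁ (4 * C) with hL
  have hL0 : 0 < L := hL₁.trans_le (le_max_left _ _)
  obtain ⟨M, c, hc, hcM⟩ := hwin L (le_max_left _ _)
  have hc' : 0 < min c 1 := lt_min hc one_pos
  -- Truncation at `1`, as `c` may be infinite.
  have hctop : min c 1 ≠ ⊤ := ne_top_of_le_ne_top ENNReal.one_ne_top (min_le_right _ _)
  refine ⟨(min c 1).toReal / 4, 2 * L, by have := ENNReal.toReal_pos hc'.ne' hctop; linarith,
    fun Δ hΔ hΔ0 => ?_⟩
  obtain ⟨-, hη0, -, hη⟩ := h.integrable_overshoot h2 hμ hC0 hC hΔ0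
  set y := Δ - 2 * L with hy
  have hy0 : 0 < y := sub_pos.2 hΔ
  obtain ⟨n, hn⟩ : ∃ n : ℕ, P {ω | (n : ℕ∞) < sampleTime X y 1 ω} ≤ ENNReal.ofReal (1 / 2) :=
    ((h.tendsto_measure_lt_sampleTime_one h2 hμ hC0 hC hy0).eventually_le_const
      (ENNReal.ofReal_pos.2 (by norm_num))).exists
  set Z := stoppedWalk (Set.Ioi 0) X y n with hZ
  have hZm : Measurable Z := h.measurable_stoppedWalk measurableSet_Ioi y n
  have hpos : P.real {ω | 0 < Z ω} ≤ 1 / 2 := by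
    have : {ω | 0 < Z ω} = {ω | (n : ℕ∞) < sampleTime X y 1 ω} := by
      ext ω; exact lt_sampleTime_one_iff.symm
    rw [this]
    exact ENNReal.toReal_le_of_le_ofReal (by norm_num) hn
  have hfar : P.real {ω | Z ω < -L} ≤ 1 / 4 := by
    have hle := hC y hy0 n
    rw [meanOvershootUpTo, ← h.lintegral_stoppedWalk measurableSet_Ioi (by fun_prop)] at hle
    have hmark := mul_meas_ge_le_lintegral (μ := P) (f := fun ω => ENNReal.ofReal (-Z ω))
      (hZm.neg.ennreal_ofReal) (ENNReal.ofReal L)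
    have hsub : {ω | Z ω < -L} ⊆ {ω | ENNReal.ofReal L ≤ ENNReal.ofReal (-Z ω)} := fun ω hω => by
      have : Z ω < -L := hω
      exact ENNReal.ofReal_le_ofReal (by linarith)
    have h3 : ENNReal.ofReal L * P {ω | Z ω < -L} ≤ ENNReal.ofReal C :=
      ((mul_le_mul_right (measure_mono hsub) _).trans hmark).trans hle
    have h4 := ENNReal.toReal_mono ENNReal.ofReal_ne_top h3
    rw [ENNReal.toReal_mul, ENNReal.toReal_ofReal hL0.le, ENNReal.toReal_ofReal hC0] at h4
    have h5 : 4 * C ≤ L := le_max_right _ _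
    change (P {ω | Z ω < -L}).toReal ≤ 1 / 4
    by_contra! hcon
    nlinarith
  set B : Set Ω := {ω | Z ω ∈ Set.Icc (-L) 0} with hB
  have hBm : MeasurableSet B := hZm measurableSet_Icc
  have hBr : 1 / 4 ≤ P.real B := by
    have hcov : Bᶜ ⊆ {ω | 0 < Z ω} ∪ {ω | Z ω < -L} := fun ω hω => by
      by_contra hcon
      simp only [Set.mem_union, Set.mem_ofPred_eq, not_or, not_lt] at hcon
      exact hω ⟨hcon.2, hcon.1⟩
    have h1 := (measureReal_mono hcov).trans (measureReal_union_le (μ := P) _ _)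
    rw [measureReal_compl hBm, probReal_univ] at h1
    linarith
  have hgstep : meanOvershootUpTo ν M ≤ stepOp (Set.Ioi 0) ν (meanOvershootUpTo ν M) := by
    rw [← meanOvershootUpTo_succ]
    exact monotone_meanOvershootUpTo ν M.le_succ
  have hlow : min c 1 * P B ≤ meanOvershootUpTo ν (n + M) Δ := by
    have e1 : meanOvershootUpTo ν (n + M) = (stepOp (Set.Ioi 0) ν)^[n] (meanOvershootUpTo ν M) :=
      Function.iterate_add_apply _ _ _ _
    have e2 := iterate_stepOp_Ioi_le (ν := ν) (L := 2 * L) (by positivity) hgstep n Δ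
    have e3 := iterate_stepOp_translate (ν := ν) (2 * L) (meanOvershootUpTo ν M) n y
    rw [show y + 2 * L = Δ by rw [hy]; ring] at e3
    rw [e1]
    refine le_trans ?_ e2
    rw [e3]
    set I : ℝ → ℝ≥0∞ := (Set.Icc (-L) 0).indicator fun _ => min c 1 with hI
    have e4 : I ≤ fun z => meanOvershootUpTo ν M (z + 2 * L) := fun z => by
      by_cases hz : z ∈ Set.Icc (-L) 0
      · rw [hI, Set.indicator_of_mem hz]
        exact (min_le_left _ _).trans
          (hcM _ ⟨by have := hz.1; linarith, by have := hz.2; linarith⟩)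
      · rw [hI, Set.indicator_of_notMem hz]; exact bot_le
    refine le_trans (le_of_eq ?_) ((monotone_stepOp (Set.Ioi 0) ν).iterate n e4 y)
    rw [← h.lintegral_stoppedWalk measurableSet_Ioi
      (measurable_const.indicator measurableSet_Icc) y n, ← lintegral_indicator_const hBm]
    rfl
  have hfinal : min c 1 * P B ≤ ENNReal.ofReal (meanOvershoot P X Δ) := by
    rw [hη]
    exact hlow.trans (le_iSup (fun n => meanOvershootUpTo ν n Δ) (n + M))
  have h6 := ENNReal.toReal_mono ENNReal.ofReal_ne_top hfinal
  rw [ENNReal.toReal_mul, ENNReal.toReal_ofReal hη0] at h6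
  have h7 : (min c 1).toReal * (1 / 4) ≤ (min c 1).toReal * (P B).toReal :=
    mul_le_mul_of_nonneg_left hBr ENNReal.toReal_nonneg
  linarith

/-- The overshoots of a sample that starts before `T`. -/
lemma IsIID.setLIntegral_overshoot (h : IsIID P X ν) (hfin : ∀ᵐ ω ∂P, sampleTime X Δ 1 ω ≠ ⊤)
    (n : ℕ) : (∀ᵐ ω ∂P, sampleTime X Δ n ω ≠ ⊤) ∧
    ∀ T : ℕ, ∫⁻ ω in sampledBy X Δ n T, ENNReal.ofReal (overshoot X Δ n ω) ∂P
      = P (sampledBy X Δ n T) * ∫⁻ ω, ENNReal.ofReal (overshoot X Δ 0 ω) ∂P := by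
  have hcoord : ∀ i, Measurable fun x : ℕ → ℝ => x i := fun i => measurable_pi_apply i
  -- almost surely, the next sampling time is finite whenever `τ_n` is
  have hnext : ∀ n, ∀ᵐ ω ∂P, sampleTime X Δ n ω ≠ ⊤ → sampleTime X Δ (n + 1) ω ≠ ⊤ := by
    intro n
    have hm : ∀ m : ℕ, ∀ᵐ ω ∂P, sampleTime X Δ n ω = (m : ℕ∞) →
        sampleTime (fun i => X (m + i)) Δ 1 ω ≠ ⊤ := fun m => by
      have hset : MeasurableSet {x : ℕ → ℝ | sampleTime (fun i (x : ℕ → ℝ) => x i) Δ 1 x ≠ ⊤} :=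
        measurableSet_sampleTime_ne_top hcoord Δ 1
      have a1 : ∀ᵐ x ∂(P.map fun ω i => X i ω),
          sampleTime (fun i (x : ℕ → ℝ) => x i) Δ 1 x ≠ ⊤ := by
        rw [ae_map_iff h.measurable_path.aemeasurable hset]
        filter_upwards [hfin] with ω hω
        rwa [← sampleTime_path]
      rw [← h.map_path_shift m, ae_map_iff (h.shift m).measurable_path.aemeasurable hset] at a1
      filter_upwards [a1] with ω hω _
      rwa [sampleTime_path]
    filter_upwards [ae_all_iff.2 hm] with ω hω htop
    obtain ⟨m, hm⟩ := ENat.ne_top_iff_exists.1 htop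
    exact (sampleTime_succ_ne_top_iff hm.symm).2 (hω m hm.symm)
  have hall : ∀ n, ∀ᵐ ω ∂P, sampleTime X Δ n ω ≠ ⊤ := by
    intro n
    induction n with
    | zero => exact Eventually.of_forall fun ω => ENat.natCast_ne_top 0
    | succ n ih =>
      filter_upwards [ih, hnext n] with ω h1 h2 using h2 h1
  refine ⟨hall n, fun T => ?_⟩
  set F : (ℕ → ℝ) → ℝ≥0∞ :=
    fun x => ENNReal.ofReal (overshoot (fun i (x : ℕ → ℝ) => x i) Δ 0 x) with hF
  have hFm : Measurable F := (measurable_overshoot hcoord Δ 0).ennreal_ofReal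
  -- Strong Markov property, one value of `τ_n` at a time: the event `τ_n = m` belongs to the past
  -- of `m`, and the next overshoot depends on later steps only.
  have hone : ∀ m : ℕ, ∫⁻ ω in {ω | sampleTime X Δ n ω = (m : ℕ∞)},
      ENNReal.ofReal (overshoot X Δ n ω) ∂P = P {ω | sampleTime X Δ n ω = (m : ℕ∞)}
        * ∫⁻ ω, ENNReal.ofReal (overshoot X Δ 0 ω) ∂P := fun m => by
    have key := h.lintegral_future m (measurableSet_past_sampleTime X Δ n m) hFm
    simp only [hF, ← overshoot_path] at key
    rw [← key]
    refine setLIntegral_congr_fun_ae (measurableSet_sampleTime h.meas Δ n m) ?_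
    filter_upwards [hall (n + 1)] with ω hω hm
    rw [overshoot_eq_shift hm hω]
  have hun : sampledBy X Δ n T
      = ⋃ m ∈ Finset.range (T + 1), {ω | sampleTime X Δ n ω = (m : ℕ∞)} := by
    ext ω
    simp [sampledBy]
  have hdisj : (↑(Finset.range (T + 1)) : Set ℕ).PairwiseDisjoint
      fun m : ℕ => {ω | sampleTime X Δ n ω = (m : ℕ∞)} := by
    intro a _ b _ hab
    refine Set.disjoint_left.2 fun ω ha hb => hab ?_
    have ha' : sampleTime X Δ n ω = (a : ℕ∞) := ha
    have hb' : sampleTime X Δ n ω = (b : ℕ∞) := hb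
    rw [ha'] at hb'
    exact_mod_cast hb'
  rw [hun, lintegral_biUnion_finset hdisj fun m _ => measurableSet_sampleTime h.meas Δ n m,
    measure_biUnion_finset hdisj fun m _ => measurableSet_sampleTime h.meas Δ n m,
    Finset.sum_mul]
  exact Finset.sum_congr rfl fun m _ => hone m

/-- The expected sum of the overshoots up to time `t`, by Wald's identity. -/
lemma IsIID.lintegral_sum_overshoot_le (h : IsIID P X ν)
    (hfin : ∀ᵐ ω ∂P, sampleTime X Δ 1 ω ≠ ⊤) (hΔ : 0 < Δ) {t : ℝ} (ht : 0 ≤ t) :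
    ∫⁻ ω, ENNReal.ofReal (∑ n ∈ Finset.range (numSamples X Δ t ω), overshoot X Δ n ω) ∂P
      ≤ (∫⁻ ω, ((numSamples X Δ t ω : ℕ) + 1 : ℝ≥0∞) ∂P)
        * ∫⁻ ω, ENNReal.ofReal (overshoot X Δ 0 ω) ∂P := by
  set T := ⌊t⌋₊ with hT
  have hm : ∀ n, MeasurableSet (sampledBy X Δ n T) := fun n => measurableSet_sampledBy h.meas Δ n T
  -- The sum has `N(t)` terms but is enlarged to all `n` with `τ_n ≤ T`. That condition is decided
  -- before the `n`-th overshoot, unlike `τ_{n+1} ≤ T`. The price is one extra sample.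
  have h1 : ∀ ω, ENNReal.ofReal (∑ n ∈ Finset.range (numSamples X Δ t ω), overshoot X Δ n ω)
      ≤ ∑' n, (sampledBy X Δ n T).indicator (fun ω => ENNReal.ofReal (overshoot X Δ n ω)) ω := by
    intro ω
    obtain ⟨-, -, -, -, hnn, -⟩ := exists_lastSampleTime (X := X) (ω := ω) hΔ ht
    rw [ENNReal.ofReal_sum_of_nonneg fun n hn => hnn n (Finset.mem_range.1 hn)]
    refine le_trans (Finset.sum_le_sum fun n hn => le_of_eq ?_)
      (ENNReal.sum_le_tsum (Finset.range (numSamples X Δ t ω)))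
    rw [Set.indicator_of_mem ((mem_sampledBy_iff hΔ ht).2 (Finset.mem_range.1 hn).le)]
  have h2 : ∀ ω, ∑' n, (sampledBy X Δ n T).indicator (fun _ => (1 : ℝ≥0∞)) ω
      = (numSamples X Δ t ω : ℕ) + 1 := by
    intro ω
    have hmem : ∀ n, ω ∈ sampledBy X Δ n T ↔ n ∈ Finset.range (numSamples X Δ t ω + 1) :=
      fun n => by rw [hT, mem_sampledBy_iff hΔ ht, Finset.mem_range, Nat.lt_succ_iff]
    rw [tsum_eq_sum fun s hs => Set.indicator_of_notMem (fun h => hs ((hmem s).1 h)) _,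
      Finset.sum_congr rfl fun s hs => Set.indicator_of_mem ((hmem s).2 hs) _]
    simp
  calc _ ≤ ∫⁻ ω, ∑' n, (sampledBy X Δ n T).indicator
        (fun ω => ENNReal.ofReal (overshoot X Δ n ω)) ω ∂P := lintegral_mono h1
    _ = ∑' n, ∫⁻ ω in sampledBy X Δ n T, ENNReal.ofReal (overshoot X Δ n ω) ∂P := by
        rw [lintegral_tsum fun n => ((measurable_overshoot h.meas Δ n).ennreal_ofReal.indicator
          (hm n)).aemeasurable]
        exact tsum_congr fun n => lintegral_indicator (hm n) _
    _ = (∑' n, P (sampledBy X Δ n T)) * ∫⁻ ω, ENNReal.ofReal (overshoot X Δ 0 ω) ∂P := by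
        rw [← ENNReal.tsum_mul_right]
        exact tsum_congr fun n => (h.setLIntegral_overshoot hfin n).2 T
    _ = _ := by
        congr 1
        simp only [← h2]
        rw [lintegral_tsum fun n => (measurable_const.indicator (hm n)).aemeasurable]
        exact tsum_congr fun n => (lintegral_indicator_one (hm n)).symm

end Sampling

/-! ### A nonasymptotic bound on the error of `N(t) Δ / t`. -/

section Estimate

variable {Ω : Type*} [MeasurableSpace Ω] {P : Measure Ω} {X : ℕ → Ω → ℝ} {ν : Measure ℝ}
  {Δ C : ℝ}

/-- The sum of the overshoots of the samples taken up to time `t`. -/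
noncomputable def sumOvershoot {Ω : Type*} (X : ℕ → Ω → ℝ) (Δ t : ℝ) (ω : Ω) : ℝ :=
  ∑ n ∈ Finset.range (numSamples X Δ t ω), overshoot X Δ n ω

lemma sumOvershoot_nonneg {Ω : Type*} {X : ℕ → Ω → ℝ} (hΔ : 0 < Δ) {t : ℝ} (ht : 0 ≤ t) (ω : Ω) :
    0 ≤ sumOvershoot X Δ t ω := by
  obtain ⟨-, -, -, -, hnn, -⟩ := exists_lastSampleTime (X := X) (ω := ω) hΔ ht
  exact Finset.sum_nonneg fun n hn => hnn n (Finset.mem_range.1 hn)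

lemma measurable_sumOvershoot (hX : ∀ i, Measurable (X i)) (hΔ : 0 < Δ) (t : ℝ) :
    Measurable (sumOvershoot X Δ t) := by
  set F : ℕ × Ω → ℝ := fun p => ∑ n ∈ Finset.range p.1, overshoot X Δ n p.2 with hF
  have h : Measurable F := by
    refine measurable_from_prod_countable_right fun k => ?_
    simp only [hF]
    exact Finset.measurable_fun_sum (Finset.range k) fun n _ => measurable_overshoot hX Δ n
  have e : sumOvershoot X Δ t = F ∘ fun ω => (numSamples X Δ t ω, ω) := rfl
  rw [e]
  exact h.comp ((measurable_numSamples hX hΔ t).prodMk measurable_id)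

lemma integrable_numSamples [IsFiniteMeasure P] (hX : ∀ i, Measurable (X i)) (hΔ : 0 < Δ) (t : ℝ) :
    Integrable (fun ω => (numSamples X Δ t ω : ℝ)) P := by
  refine Integrable.of_bound
    (measurable_from_nat.comp (measurable_numSamples hX hΔ t)).aestronglyMeasurable (⌊t⌋₊ : ℝ)
    (Eventually.of_forall fun ω => ?_)
  rw [Real.norm_eq_abs, Nat.abs_cast]
  exact_mod_cast numSamples_le (X := X) (ω := ω) hΔ t

lemma measurable_hatMu (hX : ∀ i, Measurable (X i)) (hΔ : 0 < Δ) (t : ℝ) :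
    Measurable (hatMu X Δ t) :=
  ((measurable_from_nat.comp (measurable_numSamples hX hΔ t)).mul_const Δ).div
    (measurable_lastSampleTime hX hΔ t)

lemma integrable_abs_checkMu_sub [IsFiniteMeasure P] (hX : ∀ i, Measurable (X i)) (hΔ : 0 < Δ)
    (t m : ℝ) : Integrable (fun ω => |checkMu X Δ t ω - m|) P :=
  ((((integrable_numSamples hX hΔ t).mul_const Δ).div_const t).sub (integrable_const m)).abs

variable [IsProbabilityMeasure P]

/-- The expected number of samples up to time `t`. -/
lemma IsIID.integral_numSamples_le (h : IsIID P X ν) (h2 : MemLp id 2 ν) (hμ : 0 < ∫ x, x ∂ν)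
    (hΔ : 0 < Δ) {t : ℝ} (ht : 0 ≤ t) :
    ∫ ω, (numSamples X Δ t ω : ℝ) ∂P
      ≤ (t * (∫ x, x ∂ν) + (∫ x, x ^ 2 ∂ν) / (2 * ∫ x, x ∂ν)) / Δ := by
  set T := ⌊t⌋₊ with hT
  have hTt : (T : ℝ) ≤ t := Nat.floor_le ht
  have iN := integrable_numSamples (P := P) h.meas hΔ t
  have iW : Integrable (drawdown X T) P := (h.memLp_drawdown h2 T).integrable (by norm_num)
  have iS : Integrable (walk X T) P := (h.memLp_walk h2 T).integrable (by norm_num)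
  have eS : ∫ ω, walk X T ω ∂P = T * ∫ x, x ∂ν := by
    simp only [walk]
    rw [integral_finsetSum _ fun i _ => (h.memLp h2 i).integrable (by norm_num)]
    have e : ∀ i, ∫ ω, X i ω ∂P = ∫ x, x ∂ν := fun i => h.integral_comp i measurable_id
    simp [e]
  rw [le_div_iff₀ hΔ, ← integral_mul_const]
  -- Dropping the nonnegative overshoots, `N(t) Δ` is at most the walk at the last sampling time,
  -- which exceeds `S_T` by no more than the drawdown.
  calc ∫ ω, (numSamples X Δ t ω : ℝ) * Δ ∂P ≤ ∫ ω, (walk X T ω + drawdown X T ω) ∂P := by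
        refine integral_mono (iN.mul_const Δ) (iS.add iW) fun ω => ?_
        obtain ⟨m, hm, -, e, -, -⟩ := exists_lastSampleTime (X := X) (ω := ω) hΔ ht
        have h1 := sumOvershoot_nonneg (X := X) hΔ ht ω
        have h2 := walk_sub_le_drawdown X ω hm
        unfold sumOvershoot at h1
        simp only
        rw [e]
        linarith
    _ = T * (∫ x, x ∂ν) + ∫ ω, drawdown X T ω ∂P := by rw [integral_add iS iW, eS]
    _ ≤ _ := add_le_add (mul_le_mul_of_nonneg_right hTt hμ.le) (h.integral_drawdown_le h2 hμ T)

/-- The expected sum of the overshoots up to time `t`. -/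
lemma IsIID.integral_sumOvershoot_le (h : IsIID P X ν) (h2 : MemLp id 2 ν)
    (hμ : 0 < ∫ x, x ∂ν) (hC0 : 0 ≤ C)
    (hC : ∀ y, 0 < y → ∀ n, meanOvershootUpTo ν n y ≤ ENNReal.ofReal C) (hΔ : 0 < Δ)
    {t : ℝ} (ht : 0 ≤ t) :
    Integrable (sumOvershoot X Δ t) P ∧ ∫ ω, sumOvershoot X Δ t ω ∂P
      ≤ ((t * (∫ x, x ∂ν) + (∫ x, x ^ 2 ∂ν) / (2 * ∫ x, x ∂ν)) / Δ + 1)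
        * meanOvershoot P X Δ := by
  have hfin := h.ae_sampleTime_one_ne_top h2 hμ hC0 hC hΔ
  obtain ⟨-, hη0, -, hη⟩ := h.integrable_overshoot h2 hμ hC0 hC hΔ
  have hle := h.lintegral_sum_overshoot_le hfin hΔ ht
  have iN := integrable_numSamples (P := P) h.meas hΔ t
  have i1 : Integrable (fun ω => (numSamples X Δ t ω : ℝ) + 1) P := iN.add (integrable_const 1)
  have e : ∫⁻ ω, ((numSamples X Δ t ω : ℕ) + 1 : ℝ≥0∞) ∂P
      = ENNReal.ofReal (∫ ω, ((numSamples X Δ t ω : ℝ) + 1) ∂P) := by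
    rw [ofReal_integral_eq_lintegral_ofReal i1 (Eventually.of_forall fun ω => by positivity)]
    refine lintegral_congr fun ω => ?_
    rw [ENNReal.ofReal_add (Nat.cast_nonneg _) zero_le_one, ENNReal.ofReal_natCast,
      ENNReal.ofReal_one]
  have hN0 : 0 ≤ ∫ ω, ((numSamples X Δ t ω : ℝ) + 1) ∂P := integral_nonneg fun ω => by positivity
  rw [e, h.lintegral_overshoot hfin, ← hη, ← ENNReal.ofReal_mul hN0] at hle
  have h0 : 0 ≤ᵐ[P] sumOvershoot X Δ t :=
    Eventually.of_forall fun ω => sumOvershoot_nonneg hΔ ht ω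
  have hi : Integrable (sumOvershoot X Δ t) P := by
    refine ⟨(measurable_sumOvershoot h.meas hΔ t).aestronglyMeasurable, ?_⟩
    rw [hasFiniteIntegral_iff_ofReal h0]
    exact lt_of_le_of_lt hle ENNReal.ofReal_lt_top
  refine ⟨hi, ?_⟩
  have h3 : ∫ ω, sumOvershoot X Δ t ω ∂P
      ≤ (∫ ω, ((numSamples X Δ t ω : ℝ) + 1) ∂P) * meanOvershoot P X Δ := by
    rw [← ENNReal.ofReal_le_ofReal_iff (mul_nonneg hN0 hη0),
      ofReal_integral_eq_lintegral_ofReal hi h0]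
    exact hle
  refine h3.trans (mul_le_mul_of_nonneg_right ?_ hη0)
  rw [integral_add iN (integrable_const 1)]
  simpa using h.integral_numSamples_le h2 hμ hΔ ht

/-- The mean absolute error of the estimator `N(t) Δ / t`, not asymptotically. -/
theorem IsIID.integral_abs_checkMu_sub_le (h : IsIID P X ν) (h2 : MemLp id 2 ν)
    (hμ : 0 < ∫ x, x ∂ν) (hC0 : 0 ≤ C)
    (hC : ∀ y, 0 < y → ∀ n, meanOvershootUpTo ν n y ≤ ENNReal.ofReal C) (hΔ : 0 < Δ)
    {t : ℝ} (ht : 0 < t) :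
    ∫ ω, |checkMu X Δ t ω - ∫ x, x ∂ν| ∂P
      ≤ (√(t * ∫ x, (x - ∫ z, z ∂ν) ^ 2 ∂ν) + (∫ x, x ∂ν) + Δ
        + (∫ x, x ^ 2 ∂ν) / (2 * ∫ x, x ∂ν)
        + ((t * (∫ x, x ∂ν) + (∫ x, x ^ 2 ∂ν) / (2 * ∫ x, x ∂ν)) / Δ + 1)
          * meanOvershoot P X Δ) / t := by
  obtain ⟨iH, hH⟩ := h.integral_sumOvershoot_le h2 hμ hC0 hC hΔ ht.le
  have hR := h.integral_abs_walk_sub_le h2 ⌊t⌋₊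
  have hW := h.integral_drawdown_le h2 hμ ⌊t⌋₊
  set μ := ∫ x, x ∂ν with hμdef
  set v := ∫ x, (x - μ) ^ 2 ∂ν with hv
  have hv0 : 0 ≤ v := integral_nonneg fun x => sq_nonneg _
  set T := ⌊t⌋₊ with hT
  have hTt : (T : ℝ) ≤ t := Nat.floor_le ht.le
  have hTt' : t < T + 1 := Nat.lt_floor_add_one t
  have iW : Integrable (drawdown X T) P := (h.memLp_drawdown h2 T).integrable (by norm_num)
  have iR : Integrable (fun ω => |walk X T ω - T * μ|) P :=
    (((h.memLp_walk h2 T).integrable (by norm_num)).sub (integrable_const _)).abs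
  have hsqrt : √(T * v) ≤ √(t * v) := Real.sqrt_le_sqrt (by gcongr)
  have i1 : Integrable (fun ω => |walk X T ω - T * μ| + (μ + Δ)) P := iR.add (integrable_const _)
  have i2 : Integrable (fun ω => |walk X T ω - T * μ| + (μ + Δ) + drawdown X T ω) P := i1.add iW
  -- The drawdown and `Δ` bound the two directions in which the walk can move after the last sample.
  -- The term `μ` accounts for rounding `t` down.
  have hpt : ∀ ω, |checkMu X Δ t ω - μ|
      ≤ (|walk X T ω - T * μ| + (μ + Δ) + drawdown X T ω + sumOvershoot X Δ t ω) / t := by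
    intro ω
    obtain ⟨m, hm, -, e, -, hlt⟩ := exists_lastSampleTime (X := X) (ω := ω) hΔ ht.le
    have h1 := sumOvershoot_nonneg (X := X) hΔ ht.le ω
    have h2 := walk_sub_le_drawdown X ω hm
    have h3 := hlt T hm le_rfl
    have h4 := le_abs_self (walk X T ω - T * μ)
    have h5 := neg_abs_le (walk X T ω - T * μ)
    have h6 := drawdown_nonneg X T ω
    have e1 : checkMu X Δ t ω - μ = (numSamples X Δ t ω * Δ - t * μ) / t := by
      rw [checkMu]; field_simp
    rw [e1, abs_div, abs_of_pos ht]
    refine div_le_div_of_nonneg_right ?_ ht.le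
    rw [e]
    change |walk X m ω - sumOvershoot X Δ t ω - t * μ| ≤ _
    have a1 : (T : ℝ) * μ ≤ t * μ := by gcongr
    have a2 : t * μ ≤ (T + 1) * μ := by gcongr
    rw [abs_le]
    constructor <;> nlinarith
  calc ∫ ω, |checkMu X Δ t ω - μ| ∂P
      ≤ ∫ ω, (|walk X T ω - T * μ| + (μ + Δ) + drawdown X T ω + sumOvershoot X Δ t ω) / t ∂P :=
        integral_mono (integrable_abs_checkMu_sub h.meas hΔ t μ) ((i2.add iH).div_const t) hpt
    _ = (∫ ω, |walk X T ω - T * μ| ∂P + (μ + Δ) + ∫ ω, drawdown X T ω ∂P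
          + ∫ ω, sumOvershoot X Δ t ω ∂P) / t := by
        rw [integral_div, integral_add i2 iH, integral_add i1 iW,
          integral_add iR (integrable_const _)]
        simp
    _ ≤ _ := div_le_div_of_nonneg_right (by linarith) ht.le

end Estimate

/-- Replacing `m` by `T` in the normalization of a centered walk. -/
lemma abs_div_sub_div_le {A θ κ m q s T R R' H : ℝ} (hA : 0 < A) (hθ : 0 < θ) (hθ1 : θ ≤ 1 / 2)
    (hκ : 0 < κ) (hs : 0 < s) (hq : 0 < q) (hqq : q * q = T) (hTs : T ≤ s * s)
    (hmT : m ≤ T) (hm : (1 - θ) * (s * s) ≤ m) (hR : |R| ≤ A * s) (hRR : |R' - R| ≤ 2 * (κ * s))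
    (hH : |H| ≤ κ * s) :
    |s * (R' - R - H) / m + R * (s / m - 1 / q)| ≤ 6 * κ + 2 * A * θ := by
  have hss : 0 < s * s := by positivity
  have hm0 : s * s / 2 ≤ m := by
    have : (1 / 2) * (s * s) ≤ (1 - θ) * (s * s) := by gcongr; linarith
    linarith
  have hmpos : 0 < m := by linarith
  have hqs : q ≤ s := by
    refine abs_le_of_sq_le_sq' ?_ hs.le |>.2
    rw [sq, sq]; linarith
  have b1 : |s * (R' - R - H) / m| ≤ 6 * κ := by
    rw [abs_div, abs_of_pos hmpos, div_le_iff₀ hmpos, abs_mul, abs_of_pos hs]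
    have c1 : |R' - R - H| ≤ 3 * (κ * s) := by
      have := abs_sub (R' - R) H
      linarith
    calc s * |R' - R - H| ≤ s * (3 * (κ * s)) := by gcongr
      _ = 6 * κ * (s * s / 2) := by ring
      _ ≤ 6 * κ * m := by gcongr
  have b2 : |R * (s / m - 1 / q)| ≤ 2 * A * θ := by
    have c1 : |s / m - 1 / q| ≤ 2 * θ / s := by
      rw [le_div_iff₀ hs]
      have c2 : 0 ≤ s / m - 1 / q := by
        rw [sub_nonneg, div_le_div_iff₀ hq hmpos]
        have : q * q ≤ s * q := by gcongr
        linarith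
      rw [abs_of_nonneg c2, sub_mul]
      have c3 : s / m * s ≤ 1 + 2 * θ := by
        rw [div_mul_eq_mul_div, div_le_iff₀ hmpos]
        have e1 : (1 + 2 * θ) * ((1 - θ) * (s * s)) ≤ (1 + 2 * θ) * m := by gcongr
        have e2 : 0 ≤ θ * (1 - 2 * θ) * (s * s) :=
          mul_nonneg (mul_nonneg hθ.le (by linarith)) hss.le
        have e3 : (1 + 2 * θ) * ((1 - θ) * (s * s)) = s * s + θ * (1 - 2 * θ) * (s * s) := by ring
        linarith
      have c4 : 1 ≤ 1 / q * s := by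
        rw [div_mul_eq_mul_div, one_mul, le_div_iff₀ hq]
        linarith
      linarith
    rw [abs_mul]
    calc |R| * |s / m - 1 / q| ≤ (A * s) * (2 * θ / s) := by gcongr
      _ = 2 * A * θ := by field_simp
  exact (abs_add_le _ _).trans (add_le_add b1 b2)

/-! ### Limits in probability for `N(t) Δ / τ(t)`. -/

section Limits

variable {Ω : Type*} [MeasurableSpace Ω] {P : Measure Ω} [IsProbabilityMeasure P]
  {X : ℕ → Ω → ℝ} {ν : Measure ℝ} {C : ℝ}

/-- Off an event of small probability, the walk is close to its drift up to time `t` and has small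
fluctuations between the last sampling time and `t`, and the overshoots are small. -/
lemma IsIID.exists_bad_event (h : IsIID P X ν) (h2 : MemLp id 2 ν)
    (hμ : 0 < ∫ x, x ∂ν) (hC0 : 0 ≤ C)
    (hC : ∀ y, 0 < y → ∀ n, meanOvershootUpTo ν n y ≤ ENNReal.ofReal C) {Δ t : ℝ} (hΔ : 0 < Δ)
    (ht : 0 ≤ t) {K κ : ℝ} (hK : 0 < K) (hκ : 0 < κ) {k : ℕ} (hk : Δ + 2 * K ≤ k * ∫ x, x ∂ν) :
    ∃ B : Set Ω, P.real B ≤ t * (∫ x, (x - ∫ z, z ∂ν) ^ 2 ∂ν) / K ^ 2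
        + ((t * (∫ x, x ∂ν) + (∫ x, x ^ 2 ∂ν) / (2 * ∫ x, x ∂ν)) / Δ + 1) * C / κ
        + k * (∫ x, (x - ∫ z, z ∂ν) ^ 2 ∂ν) / κ ^ 2 ∧
      ∀ ω, ω ∉ B → ∃ m : ℕ, m ≤ ⌊t⌋₊ ∧ ⌊t⌋₊ ≤ m + k ∧
        hatMu X Δ t ω = (walk X m ω - sumOvershoot X Δ t ω) / m ∧
        |walk X m ω - m * ∫ x, x ∂ν| < K ∧ |walk X ⌊t⌋₊ ω - ⌊t⌋₊ * ∫ x, x ∂ν| < K ∧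
        |sumOvershoot X Δ t ω| < κ ∧
        |(walk X m ω - m * ∫ x, x ∂ν) - (walk X ⌊t⌋₊ ω - ⌊t⌋₊ * ∫ x, x ∂ν)| < 2 * κ := by
  obtain ⟨iH, hH⟩ := h.integral_sumOvershoot_le h2 hμ hC0 hC hΔ ht
  obtain ⟨-, hη0, hηC, -⟩ := h.integrable_overshoot h2 hμ hC0 hC hΔ
  have hmax := h.measureReal_exists_le_abs_walk_sub h2 hK ⌊t⌋₊
  have hwin := (h.shift (⌊t⌋₊ - k)).measureReal_exists_le_abs_walk_sub h2 hκ k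
  set μ := ∫ x, x ∂ν with hμdef
  set v := ∫ x, (x - μ) ^ 2 ∂ν with hv
  set b := (∫ x, x ^ 2 ∂ν) / (2 * μ) with hb
  have hv0 : 0 ≤ v := integral_nonneg fun x => sq_nonneg _
  have hb0 : 0 ≤ b := div_nonneg (integral_nonneg fun x => sq_nonneg x) (by positivity)
  set T := ⌊t⌋₊ with hT
  have hTt : (T : ℝ) ≤ t := Nat.floor_le ht
  set B₁ : Set Ω := {ω | ∃ j ≤ T, K ≤ |walk X j ω - j * μ|} with hB₁
  set B₂ : Set Ω := {ω | κ ≤ sumOvershoot X Δ t ω} with hB₂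
  -- Fluctuations over the last `k` steps. If `k > T`, the truncated difference makes the window
  -- start at `0`, which still covers all times up to `T`.
  set B₃ : Set Ω := {ω | ∃ j ≤ k, κ ≤ |walk (fun i => X (T - k + i)) j ω - j * μ|} with hB₃
  have p1 : P.real B₁ ≤ t * v / K ^ 2 := hmax.trans (by gcongr)
  have p2 : P.real B₂ ≤ ((t * μ + b) / Δ + 1) * C / κ := by
    rw [le_div_iff₀ hκ, mul_comm]
    refine (mul_meas_ge_le_integral_of_nonneg
      (Eventually.of_forall fun ω => sumOvershoot_nonneg hΔ ht ω) iH κ).trans (hH.trans ?_)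
    gcongr
  refine ⟨B₁ ∪ B₂ ∪ B₃, ?_, fun ω hω => ?_⟩
  · refine (measureReal_union_le _ _).trans (add_le_add ?_ hwin)
    exact (measureReal_union_le _ _).trans (add_le_add p1 p2)
  · simp only [Set.mem_union, not_or] at hω
    obtain ⟨⟨h1, h2'⟩, h3⟩ := hω
    have g1 : ∀ j ≤ T, |walk X j ω - j * μ| < K := fun j hj => by
      by_contra! hcon; exact h1 ⟨j, hj, hcon⟩
    have g2 : sumOvershoot X Δ t ω < κ := not_le.1 h2'
    have g3 : ∀ j ≤ k, |walk (fun i => X (T - k + i)) j ω - j * μ| < κ := fun j hj => by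
      by_contra! hcon; exact h3 ⟨j, hj, hcon⟩
    obtain ⟨m, hm, hlast, e, -, hlt⟩ := exists_lastSampleTime (X := X) (ω := ω) hΔ ht
    have a1 := g1 m hm
    have a2 := g1 T le_rfl
    -- Since `S_T - S_m < Δ` and both centered values are below `K`, `(T - m) * μ < Δ + 2 * K`.
    have hTm : T ≤ m + k := by
      have a3 := hlt T hm le_rfl
      have a4 := (abs_lt.1 a1).2
      have a5 := (abs_lt.1 a2).1
      have a6 : (T : ℝ) * μ < (m + k) * μ := by nlinarith
      have a7 : (T : ℝ) < m + k := lt_of_mul_lt_mul_right a6 hμ.le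
      exact_mod_cast a7.le
    refine ⟨m, hm, hTm, ?_, a1, a2, ?_, ?_⟩
    · rw [hatMu, hlast, e]; rfl
    · rwa [abs_of_nonneg (sumOvershoot_nonneg hΔ ht ω)]
    · obtain ⟨i, hi⟩ : ∃ i, m = (T - k) + i := ⟨m - (T - k), by omega⟩
      obtain ⟨j, hj⟩ : ∃ j, T = (T - k) + j := ⟨T - (T - k), by omega⟩
      have b1 := abs_lt.1 (g3 i (by omega))
      have b2 := abs_lt.1 (g3 j (by omega))
      have w1 := walk_add_sub (X := X) (ω := ω) (T - k) i
      have w2 := walk_add_sub (X := X) (ω := ω) (T - k) j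
      rw [← hi] at w1
      rw [← hj] at w2
      have c1 : (m : ℝ) = ((T - k : ℕ) : ℝ) + i := by exact_mod_cast hi
      have c2 : (T : ℝ) = ((T - k : ℕ) : ℝ) + j := by exact_mod_cast hj
      rw [← w1] at b1
      rw [← w2] at b2
      have d1 : (m : ℝ) * μ = ((T - k : ℕ) : ℝ) * μ + i * μ := by rw [c1]; ring
      have d2 : (T : ℝ) * μ = ((T - k : ℕ) : ℝ) * μ + j * μ := by
        rw [← add_mul, ← c2]
      rw [abs_lt]
      constructor <;> linarith [b1.1, b1.2, b2.1, b2.2]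

variable {ι : Type*} {l : Filter ι} {Δ t : ι → ℝ}

/-- The estimator `N(t) Δ / τ(t)` is consistent. -/
lemma IsIID.tendstoInMeasure_hatMu (h : IsIID P X ν) (h2 : MemLp id 2 ν)
    (hμ : 0 < ∫ x, x ∂ν) (hC0 : 0 ≤ C)
    (hC : ∀ y, 0 < y → ∀ n, meanOvershootUpTo ν n y ≤ ENNReal.ofReal C) (hΔ : ∀ i, 0 < Δ i)
    (hΔt : Tendsto (fun i => Δ i / t i) l (𝓝 0)) (hΔ' : Tendsto Δ l atTop)
    (ht : Tendsto t l atTop) :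
    TendstoInMeasure P (fun i => hatMu X (Δ i) (t i)) l (fun _ => ∫ x, x ∂ν) := by
  rw [tendstoInMeasure_iff_measureReal_norm]
  intro ε hε
  -- The bound `8 * κ ≤ μ` keeps `k` small enough that `m ≥ t / 2`. The error is then below `2 * κ *
  -- t / m ≤ 4 * κ < ε`.
  obtain ⟨κ, hκ, hκε, hκμ⟩ : ∃ κ : ℝ, 0 < κ ∧ 4 * κ < ε ∧ 8 * κ ≤ ∫ x, x ∂ν :=
    ⟨min (ε / 8) ((∫ x, x ∂ν) / 8), lt_min (by linarith) (by linarith),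
      by have := min_le_left (ε / 8) ((∫ x, x ∂ν) / 8); linarith,
      by have := min_le_right (ε / 8) ((∫ x, x ∂ν) / 8); linarith⟩
  have hbad := fun (i : ι) (hi : 0 < t i) (k : ℕ) hk => h.exists_bad_event h2 hμ hC0 hC (hΔ i) hi.le
    (K := κ * t i) (κ := κ * t i) (by positivity) (by positivity) (k := k) hk
  set μ := ∫ x, x ∂ν with hμdef
  set v := ∫ x, (x - μ) ^ 2 ∂ν with hv
  set b := (∫ x, x ^ 2 ∂ν) / (2 * μ) with hb
  have hv0 : 0 ≤ v := integral_nonneg fun x => sq_nonneg _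
  have hti : Tendsto (fun i => (t i)⁻¹) l (𝓝 0) := tendsto_inv_atTop_zero.comp ht
  have hΔi : Tendsto (fun i => (Δ i)⁻¹) l (𝓝 0) := tendsto_inv_atTop_zero.comp hΔ'
  have hlim : Tendsto (fun i => v / κ ^ 2 * (t i)⁻¹
      + ((μ + b * (t i)⁻¹) * (Δ i)⁻¹ + (t i)⁻¹) * C / κ + v / κ ^ 2 * (t i)⁻¹) l (𝓝 0) := by
    have := (((hti.const_mul (v / κ ^ 2)).add
      ((((((hti.const_mul b).const_add μ).mul hΔi).add hti).mul_const C).div_const κ)).add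
      (hti.const_mul (v / κ ^ 2)))
    simpa using this
  refine squeeze_zero' (Eventually.of_forall fun i => measureReal_nonneg) ?_ hlim
  filter_upwards [ht.eventually_ge_atTop 16, hΔt.eventually_lt_const
    (show (0 : ℝ) < μ / 8 by positivity)] with i hi1 hi2
  have hti0 : 0 < t i := by linarith
  rw [div_lt_iff₀ hti0] at hi2
  set k := ⌈(Δ i + 2 * (κ * t i)) / μ⌉₊ with hk
  have hk1 : Δ i + 2 * (κ * t i) ≤ k * μ := by
    rw [← div_le_iff₀ hμ]; exact Nat.le_ceil _
  have hΔ0 := hΔ i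
  have hk2 : (k : ℝ) < (Δ i + 2 * (κ * t i)) / μ + 1 := Nat.ceil_lt_add_one (by positivity)
  have hk3 : (k : ℝ) + 1 ≤ t i / 2 := by
    have : (Δ i + 2 * (κ * t i)) / μ ≤ 3 / 8 * t i := by
      rw [div_le_iff₀ hμ]; nlinarith
    linarith
  obtain ⟨B, hB, hgood⟩ := hbad i hti0 k hk1
  have hsub : {ω | ε ≤ ‖hatMu X (Δ i) (t i) ω - μ‖} ⊆ B := by
    intro ω hω
    by_contra hωB
    obtain ⟨m, hm1, hm2, e, g1, -, g3, -⟩ := hgood ω hωB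
    have hfl : t i < ⌊t i⌋₊ + 1 := Nat.lt_floor_add_one _
    have hm2' : (⌊t i⌋₊ : ℝ) ≤ m + k := by exact_mod_cast hm2
    have hm0 : t i / 2 ≤ m := by linarith
    have hmpos : (0 : ℝ) < m := by linarith
    have hω' : ε ≤ |hatMu X (Δ i) (t i) ω - μ| := hω
    have e2 : hatMu X (Δ i) (t i) ω - μ
        = ((walk X m ω - m * μ) - sumOvershoot X (Δ i) (t i) ω) / m := by
      rw [e]; field_simp; ring
    rw [e2, abs_div, abs_of_pos hmpos, le_div_iff₀ hmpos] at hω'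
    have := abs_sub (walk X m ω - m * μ) (sumOvershoot X (Δ i) (t i) ω)
    nlinarith
  refine (measureReal_mono hsub).trans (hB.trans (add_le_add (add_le_add ?_ ?_) ?_))
  · exact le_of_eq (by field_simp)
  · exact le_of_eq (by field_simp)
  · have : k * v / (κ * t i) ^ 2 ≤ t i * v / (κ * t i) ^ 2 := by gcongr; linarith
    exact this.trans (le_of_eq (by field_simp))

set_option maxHeartbeats 1000000 in
/-- The estimator `N(t) Δ / τ(t)` is asymptotically the centered and normalized walk. -/
lemma IsIID.tendstoInMeasure_hatMu_sub (h : IsIID P X ν) (h2 : MemLp id 2 ν)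
    (hμ : 0 < ∫ x, x ∂ν) (hC0 : 0 ≤ C)
    (hC : ∀ y, 0 < y → ∀ n, meanOvershootUpTo ν n y ≤ ENNReal.ofReal C) {σ : ℝ} (hσ : 0 < σ)
    (hΔ : ∀ i, 0 < Δ i)
    (hΔt : Tendsto (fun i => Δ i / t i) l (𝓝 0)) (hΔ' : Tendsto Δ l atTop)
    (ht : Tendsto t l atTop) (htΔ : Tendsto (fun i => √(t i) / Δ i) l (𝓝 0)) :
    TendstoInMeasure P ((fun i ω => (hatMu X (Δ i) (t i) ω - ∫ x, x ∂ν) / (σ / √(t i)))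
      - fun i ω => (√⌊t i⌋₊ * σ)⁻¹ * (walk X ⌊t i⌋₊ ω - ⌊t i⌋₊ * ∫ x, x ∂ν)) l 0 := by
  rw [tendstoInMeasure_iff_measureReal_norm]
  intro ε hε
  rw [Metric.tendsto_nhds]
  intro η hη
  have hbad := fun (i : ι) (hi : 0 < t i) {K κ : ℝ} (hK : 0 < K) (hκ : 0 < κ) (k : ℕ) hk =>
    h.exists_bad_event h2 hμ hC0 hC (hΔ i) hi.le (K := K) (κ := κ) hK hκ (k := k) hk
  set μ := ∫ x, x ∂ν with hμdef
  set v := ∫ x, (x - μ) ^ 2 ∂ν with hv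
  set b := (∫ x, x ^ 2 ∂ν) / (2 * μ) with hb
  have hv0 : 0 ≤ v := integral_nonneg fun x => sq_nonneg _
  -- The walk may deviate on the scale `A * √t`. This is the one part of the bad event whose bound
  -- does not vanish, so `A` is taken large.
  obtain ⟨A, hA, hAη⟩ : ∃ A : ℝ, 0 < A ∧ v / A ^ 2 < η / 2 := by
    refine ⟨√(4 * (v + 1) / η), by positivity, ?_⟩
    rw [Real.sq_sqrt (by positivity), div_lt_iff₀ (by positivity)]
    field_simp
    linarith
  obtain ⟨κ, hκ, hκε⟩ : ∃ κ : ℝ, 0 < κ ∧ 6 * κ ≤ ε * σ / 4 := ⟨ε * σ / 24, by positivity, by linarith⟩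
  obtain ⟨θ, hθ, hθε, hθ1⟩ : ∃ θ : ℝ, 0 < θ ∧ 2 * A * θ ≤ ε * σ / 4 ∧ θ ≤ 1 / 2 :=
    ⟨min (ε * σ / (8 * A)) (1 / 2), lt_min (by positivity) (by norm_num), by
      have := min_le_left (ε * σ / (8 * A)) (1 / 2)
      rw [le_div_iff₀ (by positivity)] at this
      linarith, min_le_right _ _⟩
  have hs : Tendsto (fun i => √(t i)) l atTop := Real.tendsto_sqrt_atTop.comp ht
  have hti : Tendsto (fun i => (t i)⁻¹) l (𝓝 0) := tendsto_inv_atTop_zero.comp ht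
  have hsi : Tendsto (fun i => (√(t i))⁻¹) l (𝓝 0) := tendsto_inv_atTop_zero.comp hs
  have hΔi : Tendsto (fun i => (Δ i)⁻¹) l (𝓝 0) := tendsto_inv_atTop_zero.comp hΔ'
  have hkt : Tendsto (fun i => (Δ i / t i + 2 * A * (√(t i))⁻¹) / μ + 2 * (t i)⁻¹) l (𝓝 0) := by
    have := ((hΔt.add (hsi.const_mul (2 * A))).div_const μ).add (hti.const_mul 2)
    simpa using this
  -- The overshoot term vanishes because `√t / Δ → 0`, and the window term because `k / t → 0`.
  have hlim : Tendsto (fun i => v / A ^ 2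
      + (√(t i) / Δ i * μ + b * (Δ i)⁻¹ * (√(t i))⁻¹ + (√(t i))⁻¹) * C / κ
      + ((Δ i / t i + 2 * A * (√(t i))⁻¹) / μ + 2 * (t i)⁻¹) * v / κ ^ 2) l
      (𝓝 (v / A ^ 2)) := by
    have := ((tendsto_const_nhds (x := v / A ^ 2)).add
      (((((htΔ.mul_const μ).add ((hΔi.const_mul b).mul hsi)).add hsi).mul_const C).div_const κ)).add
      ((hkt.mul_const v).div_const (κ ^ 2))
    simpa using this
  filter_upwards [ht.eventually_ge_atTop 1, hkt.eventually_lt_const hθ,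
    hlim.eventually_lt_const (show v / A ^ 2 < η by linarith)] with i hi1 hi2 hi3
  have hti0 : 0 < t i := by linarith
  have hsp : 0 < √(t i) := Real.sqrt_pos.2 hti0
  have hss : √(t i) * √(t i) = t i := Real.mul_self_sqrt hti0.le
  have hΔ0 := hΔ i
  set s := √(t i) with hsdef
  set k := ⌈(Δ i + 2 * (A * s)) / μ⌉₊ with hk
  have hk1 : Δ i + 2 * (A * s) ≤ k * μ := by
    rw [← div_le_iff₀ hμ]; exact Nat.le_ceil _
  have hk2 : (k : ℝ) < (Δ i + 2 * (A * s)) / μ + 1 := Nat.ceil_lt_add_one (by positivity)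
  have hk3 : (k : ℝ) + 1 ≤ ((Δ i / t i + 2 * A * s⁻¹) / μ + 2 * (t i)⁻¹) * t i := by
    have : ((Δ i / t i + 2 * A * s⁻¹) / μ + 2 * (t i)⁻¹) * t i
        = (Δ i + 2 * (A * s)) / μ + 2 := by
      rw [← hss]; field_simp
    linarith
  have hk4 : (k : ℝ) + 1 ≤ θ * t i := hk3.trans (by gcongr)
  obtain ⟨B, hB, hgood⟩ := hbad i hti0 (K := A * s) (κ := κ * s) (by positivity) (by positivity)
    k hk1
  set T := ⌊t i⌋₊ with hT
  have hTt : (T : ℝ) ≤ t i := Nat.floor_le hti0.le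
  have hfl : t i < T + 1 := Nat.lt_floor_add_one _
  have hsub : {ω | ε ≤ ‖((fun i ω => (hatMu X (Δ i) (t i) ω - μ) / (σ / √(t i)))
      - fun i ω => (√⌊t i⌋₊ * σ)⁻¹ * (walk X ⌊t i⌋₊ ω - ⌊t i⌋₊ * μ)) i ω
      - (0 : ι → Ω → ℝ) i ω‖} ⊆ B := by
    intro ω hω
    by_contra hωB
    obtain ⟨m, hm1, hm2, e, -, g2, g3, g4⟩ := hgood ω hωB
    have hω' : ε ≤ |(hatMu X (Δ i) (t i) ω - μ) / (σ / s)
        - (√T * σ)⁻¹ * (walk X T ω - T * μ) - 0| := hω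
    have hm1' : (m : ℝ) ≤ T := by exact_mod_cast hm1
    have hm2' : (T : ℝ) ≤ m + k := by exact_mod_cast hm2
    have hm3 : (1 - θ) * t i ≤ m := by linarith
    have hm0 : t i / 2 ≤ m := by nlinarith
    have hmpos : (0 : ℝ) < m := by linarith
    have hTpos : (0 : ℝ) < T := by linarith
    set q := √(T : ℝ) with hq
    have hqp : 0 < q := Real.sqrt_pos.2 hTpos
    have hqq : q * q = T := Real.mul_self_sqrt hTpos.le
    set R := walk X T ω - T * μ with hR
    set R' := walk X m ω - m * μ with hR'
    set H := sumOvershoot X (Δ i) (t i) ω with hH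
    have e2 : (hatMu X (Δ i) (t i) ω - μ) / (σ / s) - (q * σ)⁻¹ * R - 0
        = (s * (R' - R - H) / m + R * (s / m - 1 / q)) / σ := by
      rw [e, show walk X m ω = R' + m * μ by rw [hR']; ring]
      field_simp
      ring
    rw [e2, abs_div, abs_of_pos hσ, le_div_iff₀ hσ] at hω'
    have b3 := abs_div_sub_div_le hA hθ hθ1 hκ hsp hqp hqq (hTt.trans_eq hss.symm) hm1'
      (by rw [hss]; exact hm3) g2.le g4.le g3.le
    have : 0 < ε * σ := by positivity
    linarith
  rw [Real.dist_eq, sub_zero, abs_of_nonneg measureReal_nonneg]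
  refine lt_of_le_of_lt ((measureReal_mono hsub).trans (hB.trans ?_)) hi3
  refine add_le_add (add_le_add ?_ ?_) ?_
  · refine le_of_eq ?_
    rw [mul_pow, sq s, hss]; field_simp
  · refine le_of_eq ?_
    rw [show t i = s * s from hss.symm]; field_simp
  · rw [mul_pow, sq s, hss, div_le_div_iff₀ (by positivity) (by positivity)]
    have : (k : ℝ) * v ≤ ((Δ i / t i + 2 * A * s⁻¹) / μ + 2 * (t i)⁻¹) * t i * v := by
      gcongr; linarith
    have hκ2 : 0 ≤ κ ^ 2 := by positivity
    nlinarith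

end Limits

/-! ### Asymptotic normality. -/

section CentralLimit

variable {Ω : Type*} [MeasurableSpace Ω] {P : Measure Ω}
  {X : ℕ → Ω → ℝ} {ν : Measure ℝ} {C σ : ℝ} {ι : Type*} {l : Filter ι} {Δ t : ι → ℝ}

lemma IsIID.variance_eq (h : IsIID P X ν) :
    variance (X 0) P = ∫ x, (x - ∫ z, z ∂ν) ^ 2 ∂ν := by
  rw [variance_eq_integral (h.meas 0).aemeasurable]
  have e : ∫ ω, X 0 ω ∂P = ∫ x, x ∂ν := h.integral_comp 0 measurable_id
  rw [e]
  exact h.integral_comp (f := fun x => (x - ∫ z, z ∂ν) ^ 2) 0 (by fun_prop)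

variable [IsProbabilityMeasure P]

lemma TendstoInDistribution.comp_tendsto {Ω' κ : Type*} [MeasurableSpace Ω']
    {Q : Measure Ω'} [IsProbabilityMeasure Q] {Y : κ → Ω → ℝ} {Z : Ω' → ℝ} {l' : Filter κ}
    (h : TendstoInDistribution Y l' Z (fun _ => P) Q) {u : ι → κ} (hu : Tendsto u l l') :
    TendstoInDistribution (fun i => Y (u i)) l Z (fun _ => P) Q :=
  ⟨fun i => h.forall_aemeasurable (u i), h.aemeasurable_limit, h.tendsto.comp hu⟩

/-- The central limit theorem for the walk. -/
lemma IsIID.tendstoInDistribution_walk (h : IsIID P X ν) (h2 : MemLp id 2 ν) (hσ : 0 < σ)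
    (hσv : σ ^ 2 = ∫ x, (x - ∫ z, z ∂ν) ^ 2 ∂ν) :
    TendstoInDistribution (fun (n : ℕ) ω => (√n * σ)⁻¹ * (walk X n ω - n * ∫ x, x ∂ν)) atTop
      (id : ℝ → ℝ) (fun _ => P) (gaussianReal 0 1) := by
  have hid : HasLaw (id : ℝ → ℝ) (gaussianReal 0 1) (gaussianReal 0 1) := HasLaw.id
  have hlaw := gaussianReal_const_mul hid σ
  have e : ∫ ω, X 0 ω ∂P = ∫ x, x ∂ν := h.integral_comp 0 measurable_id
  have hvar : (variance (X 0) P).toNNReal = .mk (σ ^ 2) (sq_nonneg _) * 1 := by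
    rw [h.variance_eq, ← hσv]
    ext
    simp [sq_nonneg]
  rw [mul_zero, ← hvar] at hlaw
  have key := tendstoInDistribution_inv_sqrt_mul_sum_sub hlaw (h.memLp h2 0) h.indep
    fun i => ⟨(h.meas i).aemeasurable, (h.meas 0).aemeasurable, by rw [h.law, h.law]⟩
  have key' := key.continuous_comp (g := fun x => σ⁻¹ * x) (by fun_prop)
  have e1 : ((fun x => σ⁻¹ * x) ∘ fun ω : ℝ => σ * id ω) = id := by
    ext x; simp [hσ.ne']
  rw [e1, e] at key'
  convert key' using 3 with n ω
  simp only [walk, Function.comp, mul_inv]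
  ring

/-- Slutsky's theorem: the normalized walk at time `⌊t⌋` converges in law, and the estimator differs
from it by a term vanishing in probability. -/
lemma IsIID.tendstoInDistribution_hatMu_of_isCountablyGenerated [l.IsCountablyGenerated]
    (h : IsIID P X ν) (h2 : MemLp id 2 ν) (hμ : 0 < ∫ x, x ∂ν) (hσ : 0 < σ)
    (hσv : σ ^ 2 = ∫ x, (x - ∫ z, z ∂ν) ^ 2 ∂ν) (hC0 : 0 ≤ C)
    (hC : ∀ y, 0 < y → ∀ n, meanOvershootUpTo ν n y ≤ ENNReal.ofReal C) (hΔ : ∀ i, 0 < Δ i)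
    (hΔt : Tendsto (fun i => Δ i / t i) l (𝓝 0)) (hΔ' : Tendsto Δ l atTop)
    (ht : Tendsto t l atTop) (htΔ : Tendsto (fun i => √(t i) / Δ i) l (𝓝 0)) :
    TendstoInDistribution (fun i ω => (hatMu X (Δ i) (t i) ω - ∫ x, x ∂ν) / (σ / √(t i))) l
      (id : ℝ → ℝ) (fun _ => P) (gaussianReal 0 1) :=
  tendstoInDistribution_of_tendstoInMeasure_sub _ _
    (TendstoInDistribution.comp_tendsto (h.tendstoInDistribution_walk h2 hσ hσv)
      (tendsto_nat_floor_atTop.comp ht))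
    (h.tendstoInMeasure_hatMu_sub h2 hμ hC0 hC hσ hΔ hΔt hΔ' ht htΔ)
    fun i => (((measurable_hatMu h.meas (hΔ i) (t i)).sub_const _).div_const _).aemeasurable

/-- The estimator `N(t) Δ / τ(t)` is asymptotically normal when `√t = o(Δ)`. -/
theorem IsIID.tendstoInDistribution_hatMu (h : IsIID P X ν) (h2 : MemLp id 2 ν)
    (hμ : 0 < ∫ x, x ∂ν) (hσ : 0 < σ)
    (hσv : σ ^ 2 = ∫ x, (x - ∫ z, z ∂ν) ^ 2 ∂ν) (hC0 : 0 ≤ C)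
    (hC : ∀ y, 0 < y → ∀ n, meanOvershootUpTo ν n y ≤ ENNReal.ofReal C) (hΔ : ∀ i, 0 < Δ i)
    (hΔt : Tendsto (fun i => Δ i / t i) l (𝓝 0)) (hΔ' : Tendsto Δ l atTop)
    (ht : Tendsto t l atTop) (htΔ : Tendsto (fun i => √(t i) / Δ i) l (𝓝 0)) :
    TendstoInDistribution (fun i ω => (hatMu X (Δ i) (t i) ω - ∫ x, x ∂ν) / (σ / √(t i))) l
      (id : ℝ → ℝ) (fun _ => P) (gaussianReal 0 1) := by
  -- the universal case is that of a countably generated filter on the pairs `(Δ, t)`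
  let D : {p : ℝ × ℝ // 0 < p.1} → ℝ := fun p => p.1.1
  let T : {p : ℝ × ℝ // 0 < p.1} → ℝ := fun p => p.1.2
  let l₀ : Filter {p : ℝ × ℝ // 0 < p.1} := (comap (fun p => D p / T p) (𝓝 0) ⊓ comap D atTop) ⊓
    (comap T atTop ⊓ comap (fun p => √(T p) / D p) (𝓝 0))
  have key := h.tendstoInDistribution_hatMu_of_isCountablyGenerated (l := l₀) (Δ := D) (t := T)
    h2 hμ hσ hσv hC0 hC (fun p => p.2) (tendsto_comap.mono_left (inf_le_left.trans inf_le_left))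
    (tendsto_comap.mono_left (inf_le_left.trans inf_le_right))
    (tendsto_comap.mono_left (inf_le_right.trans inf_le_left))
    (tendsto_comap.mono_left (inf_le_right.trans inf_le_right))
  refine TendstoInDistribution.comp_tendsto key (u := fun i => ⟨(Δ i, t i), hΔ i⟩) ?_
  exact tendsto_inf.2 ⟨tendsto_inf.2 ⟨tendsto_comap_iff.2 hΔt, tendsto_comap_iff.2 hΔ'⟩,
    tendsto_inf.2 ⟨tendsto_comap_iff.2 ht, tendsto_comap_iff.2 htΔ⟩⟩

end CentralLimit

/-! ### From explicit bounds to the asymptotic statements in terms of `δ`. -/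

section Regime

variable {ι : Type*} {l : Filter ι}

/-- A nonnegative quantity bounded by a multiple of `a + m b + c` is of the form
`O(a) + m O(b) + O(c)`. -/
lemma exists_isBigO_add {a b c m e : ι → ℝ} {K : ℝ}
    (h : ∀ᶠ i in l, 0 ≤ a i ∧ 0 ≤ b i ∧ 0 ≤ c i ∧ 0 ≤ m i ∧ 0 ≤ e i ∧
      e i ≤ K * (a i + m i * b i + c i)) :
    ∃ f g k : ι → ℝ, f =O[l] a ∧ g =O[l] b ∧ k =O[l] c ∧ ∀ i, e i = f i + m i * g i + k i := by
  -- The error is shared in proportion to the three bounds. If all of them vanish, so does the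
  -- error, and `0 / 0 = 0` does no harm.
  set ρ : ι → ℝ := fun i => e i / (a i + m i * b i + c i) with hρ
  have hρK : ∀ᶠ i in l, |ρ i| ≤ K ∨ (a i + m i * b i + c i = 0) := by
    filter_upwards [h] with i ⟨ha, hb, hc, hm, he, hle⟩
    have h0 : 0 ≤ a i + m i * b i + c i := by positivity
    rcases h0.eq_or_lt with h0 | h0
    · exact Or.inr h0.symm
    · left
      rw [abs_of_nonneg (div_nonneg he h0.le)]
      exact (div_le_iff₀ h0).2 hle
  have hbd : ∀ᶠ i in l, |ρ i| ≤ |K| := by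
    filter_upwards [hρK] with i hi
    rcases hi with hi | hi
    · exact hi.trans (le_abs_self K)
    · simp [hρ, hi]
  -- The first part is defined as the remainder so that the identity holds at every index, although
  -- the bound holds only eventually.
  refine ⟨fun i => e i - m i * (ρ i * b i) - ρ i * c i, fun i => ρ i * b i, fun i => ρ i * c i,
    ?_, ?_, ?_, fun i => by ring⟩
  · refine IsBigO.of_bound |K| ?_
    filter_upwards [h, hbd] with i ⟨ha, hb, hc, hm, he, hle⟩ hi
    have h0 : 0 ≤ a i + m i * b i + c i := by positivity
    have e1 : e i - m i * (ρ i * b i) - ρ i * c i = ρ i * a i := by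
      have : e i = ρ i * (a i + m i * b i + c i) := by
        rcases h0.eq_or_lt with h0 | h0
        · rw [← h0, mul_zero] at hle ⊢
          linarith
        · exact (div_mul_cancel₀ _ h0.ne').symm
      linarith
    rw [e1, norm_mul]
    exact mul_le_mul_of_nonneg_right hi (norm_nonneg _)
  · refine IsBigO.of_bound |K| ?_
    filter_upwards [hbd] with i hi
    rw [norm_mul]
    exact mul_le_mul_of_nonneg_right hi (norm_nonneg _)
  · refine IsBigO.of_bound |K| ?_
    filter_upwards [hbd] with i hi
    rw [norm_mul]
    exact mul_le_mul_of_nonneg_right hi (norm_nonneg _)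

lemma exists_isBigO_add_two {a b m e : ι → ℝ} {K : ℝ}
    (h : ∀ᶠ i in l, 0 ≤ a i ∧ 0 ≤ b i ∧ 0 ≤ m i ∧ 0 ≤ e i ∧ e i ≤ K * (a i + m i * b i)) :
    ∃ f g : ι → ℝ, f =O[l] a ∧ g =O[l] b ∧ ∀ i, e i = f i + m i * g i := by
  obtain ⟨f, g, k, hf, hg, hk, he⟩ := exists_isBigO_add (c := fun _ => 0) (h.mono
    fun i ⟨ha, hb, hm, he, hle⟩ => ⟨ha, hb, le_rfl, hm, he, by rwa [add_zero]⟩)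
  exact ⟨fun i => f i + k i, g, hf.add (hk.trans (isBigO_zero _ _)), hg,
    fun i => by rw [he]; ring⟩

/-- The error bound, with the threshold replaced by the period. -/
lemma le_of_error_bound {A D K q L d e m s v : ℝ} (hA : 0 < A) (hq : 0 ≤ q)
    (hL : D ≤ L * d) (hD : A * d ≤ 2 * D) (hd : 1 ≤ d) (hds : d ≤ s * s) (hs : 0 < s)
    (hm : 0 ≤ m) (hK1 : A + L + q ≤ K) (hK2 : 2 * (A + q) / A + 1 ≤ K)
    (he : e ≤ (s * v + A + D + q + ((s * s * A + q) / D + 1) * m) / (s * s)) :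
    e ≤ K * (d / (s * s) + m * (1 / d)) + v * (1 / s) := by
  have hss : 0 < s * s := by positivity
  have hd0 : 0 < d := by linarith
  have hD0 : 0 < D := by have : 0 < A * d := by positivity
                         linarith
  have e1 : (s * v + A + D + q + ((s * s * A + q) / D + 1) * m) / (s * s)
      = v * (1 / s) + (A + D + q) / (s * s) + m * ((A + q / (s * s)) / D + 1 / (s * s)) := by
    field_simp
    ring
  have b1 : (A + D + q) / (s * s) ≤ K * (d / (s * s)) := by
    rw [← mul_div_assoc]
    gcongr
    calc A + D + q ≤ A * d + L * d + q * d := by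
          have := mul_le_mul_of_nonneg_left hd hA.le
          have := mul_le_mul_of_nonneg_left hd hq
          linarith
      _ = (A + L + q) * d := by ring
      _ ≤ K * d := by gcongr
  have b2 : (A + q / (s * s)) / D + 1 / (s * s) ≤ K * (1 / d) := by
    have c1 : (A + q / (s * s)) / D ≤ (A + q) / (A * d / 2) := by
      gcongr
      · exact div_le_self hq (hd.trans hds)
      · linarith
    have c2 : 1 / (s * s) ≤ 1 / d := by gcongr
    calc (A + q / (s * s)) / D + 1 / (s * s) ≤ (A + q) / (A * d / 2) + 1 / d := add_le_add c1 c2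
      _ = (2 * (A + q) / A + 1) * (1 / d) := by field_simp
      _ ≤ K * (1 / d) := by gcongr
  have b3 := mul_le_mul_of_nonneg_left b2 hm
  rw [e1] at he
  linarith

/-- The arithmetic and geometric means of `d / s²` and `1 / d`. -/
lemma one_div_le_add {d s : ℝ} (hd : 0 < d) (hs : 0 < s) :
    1 / s ≤ d / (s * s) + 1 / d := by
  rw [div_add_div _ _ (by positivity) hd.ne', div_le_div_iff₀ hs (by positivity)]
  have := mul_nonneg hs.le (sq_nonneg (d - s))
  have := mul_pos (mul_pos hs hs) hd
  nlinarith

variable {Ω : Type*} [MeasurableSpace Ω] {P : Measure Ω} [IsProbabilityMeasure P]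
  {X : ℕ → Ω → ℝ} {ν : Measure ℝ} {C : ℝ} {Δ t : ι → ℝ}

lemma IsIID.threshold_le (h : IsIID P X ν) (h2 : MemLp id 2 ν) (hμ : 0 < ∫ x, x ∂ν) (hC0 : 0 ≤ C)
    (hC : ∀ y, 0 < y → ∀ n, meanOvershootUpTo ν n y ≤ ENNReal.ofReal C)
    {Δ : ℝ} (hΔ : 0 < Δ) (h1 : 1 ≤ period P X Δ) :
    Δ ≤ (4 * (∫ x, x ∂ν) + 4 * (∫ x, (x - ∫ z, z ∂ν) ^ 2 ∂ν) / ∫ x, x ∂ν) * period P X Δ := by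
  refine (h.threshold_le_period h2 hμ (h.integrable_sampleTime_one h2 hμ hC0 hC hΔ).1
    (h.ae_sampleTime_one_ne_top h2 hμ hC0 hC hΔ) hΔ).trans ?_
  rw [add_mul]
  gcongr
  refine le_mul_of_one_le_right (div_nonneg (mul_nonneg (by norm_num) ?_) hμ.le) h1
  exact integral_nonneg fun x => sq_nonneg _

/-- `δ μ ≤ Δ + C` forces `Δ` to grow with `δ`. -/
lemma IsIID.tendsto_threshold (h : IsIID P X ν) (h2 : MemLp id 2 ν) (hμ : 0 < ∫ x, x ∂ν)
    (hC0 : 0 ≤ C) (hC : ∀ y, 0 < y → ∀ n, meanOvershootUpTo ν n y ≤ ENNReal.ofReal C)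
    (hΔ : ∀ i, 0 < Δ i) (hδ : Tendsto (fun i => period P X (Δ i)) l atTop) :
    Tendsto Δ l atTop := by
  have : Tendsto (fun i => period P X (Δ i) * (∫ x, x ∂ν) - C) l atTop :=
    tendsto_atTop_add_const_right _ _ (hδ.atTop_mul_const hμ)
  refine tendsto_atTop_mono (fun i => ?_) this
  linarith [(h.integrable_sampleTime_one h2 hμ hC0 hC (hΔ i)).2]

lemma IsIID.threshold_isBigO_period (h : IsIID P X ν) (h2 : MemLp id 2 ν) (hμ : 0 < ∫ x, x ∂ν)
    (hC0 : 0 ≤ C) (hC : ∀ y, 0 < y → ∀ n, meanOvershootUpTo ν n y ≤ ENNReal.ofReal C)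
    (hΔ : ∀ i, 0 < Δ i) (hδ : Tendsto (fun i => period P X (Δ i)) l atTop) :
    Δ =O[l] fun i => period P X (Δ i) := by
  refine IsBigO.of_bound
    (4 * (∫ x, x ∂ν) + 4 * (∫ x, (x - ∫ z, z ∂ν) ^ 2 ∂ν) / ∫ x, x ∂ν) ?_
  filter_upwards [hδ.eventually_ge_atTop 1] with i hi
  rw [Real.norm_of_nonneg (hΔ i).le, Real.norm_of_nonneg (by linarith)]
  exact h.threshold_le h2 hμ hC0 hC (hΔ i) hi

lemma IsIID.period_isBigO_threshold (h : IsIID P X ν) (h2 : MemLp id 2 ν) (hμ : 0 < ∫ x, x ∂ν)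
    (hC0 : 0 ≤ C) (hC : ∀ y, 0 < y → ∀ n, meanOvershootUpTo ν n y ≤ ENNReal.ofReal C)
    (hΔ : ∀ i, 0 < Δ i) (hδ : Tendsto (fun i => period P X (Δ i)) l atTop) :
    (fun i => period P X (Δ i)) =O[l] Δ := by
  refine IsBigO.of_bound (2 / ∫ x, x ∂ν) ?_
  filter_upwards [hδ.eventually_ge_atTop 1,
    (h.tendsto_threshold h2 hμ hC0 hC hΔ hδ).eventually_ge_atTop C] with i hi hi'
  rw [Real.norm_of_nonneg (hΔ i).le, Real.norm_of_nonneg (by linarith), div_mul_eq_mul_div,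
    le_div_iff₀ hμ]
  linarith [(h.integrable_sampleTime_one h2 hμ hC0 hC (hΔ i)).2]

/-- The mean absolute error of the estimator `N(t) Δ / t` is eventually at most
`K (δ / t + E[η] / δ) + σ / √t`. -/
lemma IsIID.eventually_integral_abs_checkMu_sub_le (h : IsIID P X ν) (h2 : MemLp id 2 ν)
    (hμ : 0 < ∫ x, x ∂ν) (hC0 : 0 ≤ C)
    (hC : ∀ y, 0 < y → ∀ n, meanOvershootUpTo ν n y ≤ ENNReal.ofReal C)
    (hΔ : ∀ i, 0 < Δ i) (hδ : Tendsto (fun i => period P X (Δ i)) l atTop)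
    (ht : Tendsto t l atTop) (hδt : (fun i => period P X (Δ i)) =o[l] t) :
    ∃ K : ℝ, 0 ≤ K ∧ ∀ᶠ i in l, 1 ≤ period P X (Δ i) ∧ 0 < t i ∧
      ∫ ω, |checkMu X (Δ i) (t i) ω - ∫ x, x ∂ν| ∂P
        ≤ K * (period P X (Δ i) / t i + meanOvershoot P X (Δ i) * (1 / period P X (Δ i)))
          + √(∫ x, (x - ∫ z, z ∂ν) ^ 2 ∂ν) * (1 / √(t i)) := by
  have hv0 : 0 ≤ ∫ x, (x - ∫ z, z ∂ν) ^ 2 ∂ν := integral_nonneg fun x => sq_nonneg _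
  have hq0 : 0 ≤ ∫ x, x ^ 2 ∂ν := integral_nonneg fun x => sq_nonneg _
  set L := 4 * (∫ x, x ∂ν) + 4 * (∫ x, (x - ∫ z, z ∂ν) ^ 2 ∂ν) / ∫ x, x ∂ν with hL
  have hb0 : 0 ≤ (∫ x, x ^ 2 ∂ν) / (2 * ∫ x, x ∂ν) := by positivity
  have hbound := fun (i : ι) (hi : 0 < t i) =>
    h.integral_abs_checkMu_sub_le h2 hμ hC0 hC (hΔ i) hi
  set b := (∫ x, x ^ 2 ∂ν) / (2 * ∫ x, x ∂ν) with hb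
  set A := ∫ x, x ∂ν with hA
  refine ⟨max (A + L + b) (2 * (A + b) / A + 1), le_max_of_le_right (by positivity), ?_⟩
  filter_upwards [hδ.eventually_ge_atTop 1, ht.eventually_gt_atTop 0, hδt.bound one_pos,
    (h.tendsto_threshold h2 hμ hC0 hC hΔ hδ).eventually_ge_atTop C] with i h1 h3 h4 h5
  refine ⟨h1, h3, ?_⟩
  rw [one_mul, Real.norm_of_nonneg (by linarith), Real.norm_of_nonneg h3.le] at h4
  have hss : √(t i) * √(t i) = t i := Real.mul_self_sqrt h3.le
  have hbi := hbound i h3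
  rw [Real.sqrt_mul h3.le] at hbi
  have hp := (h.integrable_sampleTime_one h2 hμ hC0 hC (hΔ i)).2
  obtain ⟨-, hm0, -, -⟩ := h.integrable_overshoot h2 hμ hC0 hC (hΔ i)
  have := le_of_error_bound (A := A) (D := Δ i) (q := b) (L := L)
    (d := period P X (Δ i)) (m := meanOvershoot P X (Δ i)) (s := √(t i))
    (v := √(∫ x, (x - A) ^ 2 ∂ν)) (e := ∫ ω, |checkMu X (Δ i) (t i) ω - A| ∂P) hμ hb0
    (h.threshold_le h2 hμ hC0 hC (hΔ i) h1) (by linarith) h1 (hss.symm ▸ h4)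
    (Real.sqrt_pos.2 h3) hm0 (le_max_left _ _) (le_max_right _ _) (by rw [hss]; exact hbi)
  rwa [hss] at this

/-- The mean absolute error of `N(t) Δ / t` is `O(δ / t) + E[η] O(1 / δ) + O(1 / √t)`. -/
theorem IsIID.exists_isBigO_checkMu (h : IsIID P X ν) (h2 : MemLp id 2 ν)
    (hμ : 0 < ∫ x, x ∂ν) (hC0 : 0 ≤ C)
    (hC : ∀ y, 0 < y → ∀ n, meanOvershootUpTo ν n y ≤ ENNReal.ofReal C)
    (hΔ : ∀ i, 0 < Δ i) (hδ : Tendsto (fun i => period P X (Δ i)) l atTop)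
    (ht : Tendsto t l atTop) (hδt : (fun i => period P X (Δ i)) =o[l] t) :
    ∃ f g k : ι → ℝ, f =O[l] (fun i => period P X (Δ i) / t i) ∧
      g =O[l] (fun i => 1 / period P X (Δ i)) ∧ k =O[l] (fun i => 1 / √(t i)) ∧
      ∀ i, ∫ ω, |checkMu X (Δ i) (t i) ω - ∫ x, x ∂ν| ∂P
        = f i + meanOvershoot P X (Δ i) * g i + k i := by
  obtain ⟨K, hK, hev⟩ := h.eventually_integral_abs_checkMu_sub_le h2 hμ hC0 hC hΔ hδ ht hδt
  set v := √(∫ x, (x - ∫ z, z ∂ν) ^ 2 ∂ν) with hv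
  have hv0 : 0 ≤ v := Real.sqrt_nonneg _
  refine exists_isBigO_add (K := K + v) (hev.mono fun i ⟨h1, h3, hle⟩ => ?_)
  obtain ⟨-, hm0, -, -⟩ := h.integrable_overshoot h2 hμ hC0 hC (hΔ i)
  have hd : 0 < period P X (Δ i) := by linarith
  refine ⟨by positivity, by positivity, by positivity, hm0,
    integral_nonneg fun ω => abs_nonneg _, hle.trans ?_⟩
  have c1 : 0 ≤ v * (period P X (Δ i) / t i + meanOvershoot P X (Δ i) * (1 / period P X (Δ i))) := by
    positivity
  have c2 : 0 ≤ K * (1 / √(t i)) := by positivity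
  linarith

/-- If the steps are degenerate or not upward skip-free, the mean absolute error of `N(t) Δ / t` is
`O(δ / t) + E[η] O(1 / δ)`. -/
theorem IsIID.exists_isBigO_checkMu_of_not_skipFree (h : IsIID P X ν) (h2 : MemLp id 2 ν)
    (hμ : 0 < ∫ x, x ∂ν) (hC0 : 0 ≤ C)
    (hC : ∀ y, 0 < y → ∀ n, meanOvershootUpTo ν n y ≤ ENNReal.ofReal C)
    (hΔ : ∀ i, 0 < Δ i) (hδ : Tendsto (fun i => period P X (Δ i)) l atTop)
    (ht : Tendsto t l atTop) (hδt : (fun i => period P X (Δ i)) =o[l] t)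
    (hsf : ∫ x, (x - ∫ z, z ∂ν) ^ 2 ∂ν = 0 ∨
      ∀ d : ℝ, 0 < d → ¬ ∀ᵐ x ∂ν, ∃ k : ℤ, k ≤ 1 ∧ x = k * d) :
    ∃ f g : ι → ℝ, f =O[l] (fun i => period P X (Δ i) / t i) ∧
      g =O[l] (fun i => 1 / period P X (Δ i)) ∧
      ∀ i, ∫ ω, |checkMu X (Δ i) (t i) ω - ∫ x, x ∂ν| ∂P
        = f i + meanOvershoot P X (Δ i) * g i := by
  obtain ⟨K, hK, hev⟩ := h.eventually_integral_abs_checkMu_sub_le h2 hμ hC0 hC hΔ hδ ht hδt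
  rcases hsf with hv | hsf
  · refine exists_isBigO_add_two (K := K) (hev.mono fun i ⟨h1, h3, hle⟩ => ?_)
    obtain ⟨-, hm0, -, -⟩ := h.integrable_overshoot h2 hμ hC0 hC (hΔ i)
    have hd : 0 < period P X (Δ i) := by linarith
    refine ⟨by positivity, by positivity, hm0, integral_nonneg fun ω => abs_nonneg _, ?_⟩
    rwa [hv, Real.sqrt_zero, zero_mul, add_zero] at hle
  · obtain ⟨c, Δ₀, hc, hcm⟩ := h.exists_le_meanOvershoot h2 hμ hC0 hC hsf
    set v := √(∫ x, (x - ∫ z, z ∂ν) ^ 2 ∂ν) with hv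
    have hv0 : 0 ≤ v := Real.sqrt_nonneg _
    refine exists_isBigO_add_two (K := K + (v + v / c)) ?_
    filter_upwards [hev, (h.tendsto_threshold h2 hμ hC0 hC hΔ hδ).eventually_gt_atTop Δ₀]
      with i ⟨h1, h3, hle⟩ h4
    have hmc := hcm (Δ i) h4 (hΔ i)
    have hm0 := hc.le.trans hmc
    have hd : 0 < period P X (Δ i) := by linarith
    refine ⟨by positivity, by positivity, hm0, integral_nonneg fun ω => abs_nonneg _,
      hle.trans ?_⟩
    have c1 := one_div_le_add hd (Real.sqrt_pos.2 h3)
    rw [Real.mul_self_sqrt h3.le] at c1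
    have c2 : v * (1 / √(t i)) ≤ v * (period P X (Δ i) / t i) + v * (1 / period P X (Δ i)) := by
      rw [← mul_add]; gcongr
    -- The lower bound `c ≤ E[η]` turns the `1 / δ` of the mean inequality into a multiple of `E[η]
    -- / δ`.
    have c3 : v * (1 / period P X (Δ i))
        ≤ v / c * (meanOvershoot P X (Δ i) * (1 / period P X (Δ i))) := by
      calc v * (1 / period P X (Δ i)) = v / c * (c * (1 / period P X (Δ i))) := by field_simp
        _ ≤ _ := by gcongr
    have c4 : 0 ≤ v * (meanOvershoot P X (Δ i) * (1 / period P X (Δ i))) := by positivity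
    have c5 : 0 ≤ v / c * (period P X (Δ i) / t i) := by positivity
    linarith

/-- The mean absolute error of `N(t) Δ / t` is `O(1 / √t)` when `δ = Θ(√t)`. -/
theorem IsIID.sqrt_mul_integral_abs_checkMu_sub_isBigO (h : IsIID P X ν) (h2 : MemLp id 2 ν)
    (hμ : 0 < ∫ x, x ∂ν) (hC0 : 0 ≤ C)
    (hC : ∀ y, 0 < y → ∀ n, meanOvershootUpTo ν n y ≤ ENNReal.ofReal C)
    (hΔ : ∀ i, 0 < Δ i) (hδ : Tendsto (fun i => period P X (Δ i)) l atTop)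
    (ht : Tendsto t l atTop) (hδt : (fun i => period P X (Δ i)) =o[l] t)
    (hΘ : (fun i => period P X (Δ i)) =Θ[l] (fun i => √(t i))) :
    (fun i => √(t i) * ∫ ω, |checkMu X (Δ i) (t i) ω - ∫ x, x ∂ν| ∂P) =O[l] (fun _ => (1 : ℝ)) := by
  obtain ⟨K, hK, hev⟩ := h.eventually_integral_abs_checkMu_sub_le h2 hμ hC0 hC hΔ hδ ht hδt
  obtain ⟨A, hA⟩ := hΘ.1.bound
  obtain ⟨B, hB⟩ := hΘ.2.bound
  set v := √(∫ x, (x - ∫ z, z ∂ν) ^ 2 ∂ν) with hv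
  refine IsBigO.of_bound (K * (A + C * B) + v) ?_
  filter_upwards [hev, hA, hB] with i ⟨h1, h3, hle⟩ hA hB
  obtain ⟨-, hm0, hmC, -⟩ := h.integrable_overshoot h2 hμ hC0 hC (hΔ i)
  have hs : 0 < √(t i) := Real.sqrt_pos.2 h3
  have hd : 0 < period P X (Δ i) := by linarith
  have he : 0 ≤ ∫ ω, |checkMu X (Δ i) (t i) ω - ∫ x, x ∂ν| ∂P :=
    integral_nonneg fun ω => abs_nonneg _
  rw [Real.norm_of_nonneg hd.le, Real.norm_of_nonneg hs.le] at hA hB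
  rw [norm_one, mul_one, Real.norm_of_nonneg (by positivity)]
  have c1 : √(t i) * (period P X (Δ i) / t i) ≤ A := by
    nth_rw 2 [← Real.mul_self_sqrt h3.le]
    rw [show √(t i) * (period P X (Δ i) / (√(t i) * √(t i))) = period P X (Δ i) / √(t i) by
      field_simp]
    rwa [div_le_iff₀ hs]
  -- Here the uniform bound `E[η] ≤ C` makes `E[η] / δ` of order `1 / √t`.
  have c2 : √(t i) * (meanOvershoot P X (Δ i) * (1 / period P X (Δ i))) ≤ C * B := by
    have : √(t i) / period P X (Δ i) ≤ B := by rwa [div_le_iff₀ hd]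
    calc √(t i) * (meanOvershoot P X (Δ i) * (1 / period P X (Δ i)))
        = meanOvershoot P X (Δ i) * (√(t i) / period P X (Δ i)) := by ring
      _ ≤ C * B := by gcongr
  calc √(t i) * ∫ ω, |checkMu X (Δ i) (t i) ω - ∫ x, x ∂ν| ∂P
      ≤ √(t i) * (K * (period P X (Δ i) / t i + meanOvershoot P X (Δ i) * (1 / period P X (Δ i)))
          + v * (1 / √(t i))) := by gcongr
    _ = K * (√(t i) * (period P X (Δ i) / t i)
          + √(t i) * (meanOvershoot P X (Δ i) * (1 / period P X (Δ i)))) + v := by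
        field_simp
    _ ≤ K * (A + C * B) + v := by gcongr

end Regime

/-! ### Transfer of the skip-free condition to the law of a step. -/

section Law

variable {Ω : Type*} [MeasurableSpace Ω] {P : Measure Ω} {Y : Ω → ℝ}

lemma not_ae_map_of_not_isSkipFree (hY : Measurable Y) (h : ¬ IsSkipFree P Y) {d : ℝ}
    (hd : 0 < d) : ¬ ∀ᵐ x ∂(P.map Y), ∃ k : ℤ, k ≤ 1 ∧ x = k * d := by
  intro hae
  refine h ⟨d, hd, ?_⟩
  exact ae_of_ae_map hY.aemeasurable hae

end Law

end LowRate

theorem mainTheorem5 {Ω : Type*} [MeasurableSpace Ω] (P : Measure Ω) [IsProbabilityMeasure P]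
    (X : ℕ → Ω → ℝ) (hXm : ∀ i, Measurable (X i))
    (hindep : iIndepFun X P) (hident : ∀ i, IdentDistrib (X i) (X 0) P P)
    (hL2 : MemLp (X 0) 2 P)
    (μ σ : ℝ) (hμ : μ = ∫ ω, X 0 ω ∂P) (hμpos : 0 < μ) (hσ : σ = √(variance (X 0) P)) :
    -- the sampling times are finite, and `τ_1` and `η_1` have finite means
    (∀ Δ : ℝ, 0 < Δ →
      (∀ᵐ ω ∂P, ∀ n, LowRate.sampleTime X Δ n ω ≠ ⊤) ∧
      Integrable (fun ω => ((LowRate.sampleTime X Δ 1 ω).toNat : ℝ)) P ∧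
      Integrable (LowRate.overshoot X Δ 0) P) ∧
    -- the regime: `Δ` and `t` vary along an arbitrary filter, `δ, t → ∞` and `δ = o(t)`
    (∀ {ι : Type*} (l : Filter ι) (Δ t : ι → ℝ), (∀ i, 0 < Δ i) →
      Tendsto (fun i => LowRate.period P X (Δ i)) l atTop →
      Tendsto t l atTop →
      (fun i => LowRate.period P X (Δ i)) =o[l] t →
      -- (i)
      ((∀ i, Integrable (fun ω => |LowRate.checkMu X (Δ i) (t i) ω - μ|) P) ∧
        (∃ f g h : ι → ℝ,
          f =O[l] (fun i => LowRate.period P X (Δ i) / t i) ∧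
          g =O[l] (fun i => 1 / LowRate.period P X (Δ i)) ∧
          h =O[l] (fun i => 1 / √(t i)) ∧
          ∀ i, ∫ ω, |LowRate.checkMu X (Δ i) (t i) ω - μ| ∂P
            = f i + LowRate.meanOvershoot P X (Δ i) * g i + h i) ∧
        (σ = 0 ∨ ¬ LowRate.IsSkipFree P (X 0) →
          ∃ f g : ι → ℝ,
            f =O[l] (fun i => LowRate.period P X (Δ i) / t i) ∧
            g =O[l] (fun i => 1 / LowRate.period P X (Δ i)) ∧
            ∀ i, ∫ ω, |LowRate.checkMu X (Δ i) (t i) ω - μ| ∂P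
              = f i + LowRate.meanOvershoot P X (Δ i) * g i) ∧
        ((fun i => LowRate.period P X (Δ i)) =Θ[l] (fun i => √(t i)) →
          (fun i => √(t i) * ∫ ω, |LowRate.checkMu X (Δ i) (t i) ω - μ| ∂P)
            =O[l] (fun _ => (1 : ℝ)))) ∧
      -- (ii)
      TendstoInMeasure P (fun i => LowRate.hatMu X (Δ i) (t i)) l (fun _ => μ) ∧
      -- (iii)
      (0 < σ →
        (fun i => √(t i)) =o[l] (fun i => LowRate.period P X (Δ i)) →
        TendstoInDistribution
          (fun i ω => (LowRate.hatMu X (Δ i) (t i) ω - μ) / (σ / √(t i))) l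
          (id : ℝ → ℝ) (fun _ => P) (gaussianReal 0 1))) := by
  have h : LowRate.IsIID P X (P.map (X 0)) := ⟨hXm, hindep, fun i => (hident i).map_eq⟩
  have hν := h.isProbabilityMeasure
  have h2 : MemLp id 2 (P.map (X 0)) :=
    (memLp_map_measure_iff aestronglyMeasurable_id (hXm 0).aemeasurable).2 hL2
  have hmean : μ = ∫ x, x ∂(P.map (X 0)) := hμ.trans (h.integral_comp 0 measurable_id)
  have hvar := h.variance_eq
  have hv0 : 0 ≤ variance (X 0) P := variance_nonneg _ _
  have hm : 0 < ∫ x, x ∂(P.map (X 0)) := hmean ▸ hμpos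
  -- A single constant serves all thresholds, which allows `Δ` to vary freely along the filter.
  obtain ⟨C, hC0, hC⟩ := LowRate.exists_overshoot_bound h2 hm
  refine ⟨fun Δ hΔ => ⟨?_, (h.integrable_sampleTime_one h2 hm hC0 hC hΔ).1,
    (h.integrable_overshoot h2 hm hC0 hC hΔ).1⟩, fun {ι} l Δ t hΔ hδ ht hδt => ?_⟩
  · exact ae_all_iff.2 fun n =>
      (h.setLIntegral_overshoot (h.ae_sampleTime_one_ne_top h2 hm hC0 hC hΔ) n).1
  have hΔ' := h.tendsto_threshold h2 hm hC0 hC hΔ hδ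
  have hΔt : Tendsto (fun i => Δ i / t i) l (𝓝 0) :=
    ((h.threshold_isBigO_period h2 hm hC0 hC hΔ hδ).trans_isLittleO hδt).tendsto_div_nhds_zero
  subst hmean
  refine ⟨⟨fun i => LowRate.integrable_abs_checkMu_sub hXm (hΔ i) _ _,
    h.exists_isBigO_checkMu h2 hm hC0 hC hΔ hδ ht hδt, fun hsf => ?_,
    h.sqrt_mul_integral_abs_checkMu_sub_isBigO h2 hm hC0 hC hΔ hδ ht hδt⟩,
    h.tendstoInMeasure_hatMu h2 hm hC0 hC hΔ hΔt hΔ' ht, fun hσpos htδ => ?_⟩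
  · refine h.exists_isBigO_checkMu_of_not_skipFree h2 hm hC0 hC hΔ hδ ht hδt (hsf.imp ?_ ?_)
    · intro h0
      rw [← hvar]
      exact (Real.sqrt_eq_zero hv0).1 (hσ ▸ h0)
    · exact fun h0 d hd => LowRate.not_ae_map_of_not_isSkipFree (hXm 0) h0 hd
  -- The condition `√t = o(δ)` passes to `√t = o(Δ)` because `δ = O(Δ)`.
  · refine h.tendstoInDistribution_hatMu h2 hm hσpos ?_ hC0 hC hΔ hΔt hΔ' ht
      (htδ.trans_isBigO (h.period_isBigO_threshold h2 hm hC0 hC hΔ hδ)).tendsto_div_nhds_zero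
    rw [hσ, Real.sq_sqrt hv0, hvar]
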